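/- **Setting.** A hypergraph has $n$ vertices and $m$ edges (distinct vertex sets); it is $k$-uniform if every edge has $k$ vertices. Two distinct edges are adjacent in the line graph $L(H)$ if they intersect; $\Delta$ is the maximum degree of $L(H)$ (the maximum edge degree), and $N(f)$ is the set of edges intersecting $f$. A two-coloring is proper if no edge is monochromatic. Logarithms in the algorithm and in part 2 are to base $2$. A $(t,s,\delta)$-*local computation algorithm* (LCA) for two-coloring a class of hypergraphs is a randomized random-access procedure that gets the hypergraph through its incidence lists and its parameters $n,m,\Delta$, keeps a computation memory between queries, and, for every hypergraph of the class with $n$ vertices and every sequence of queried vertices, spends at most $t(n)$ elementary operations on each query, never occupies more than $s(n)$ bits of memory, and with probability at least $1-\delta(n)$ answers all queries consistently with one proper two-coloring of the whole hypergraph. **Base algorithm** (parameters $k$ and $\alpha$; put $a=\lceil\alpha k\rceil$, which is $\alpha k$ when $\alpha k$ is an integer). Every vertex is uncolored (initially), accepted (with a color), or troubled. An edge is *safe* if it contains accepted vertices of both colors, otherwise *bad* if it contains at least $k-a$ accepted vertices, otherwise *unsafe*. *Processing* an uncolored vertex means: mark it troubled if it lies in a bad edge, otherwise accept it with a uniformly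 random color. *Determining the status* of an edge means processing its uncolored vertices one by one until the edge becomes safe or none is left. A query for $v$ processes $v$ if it is uncolored. If $v$ is then troubled, the algorithm * builds the final component of $v$: it determines the status of a bad edge containing $v$ and starts a set $B$ with that edge. Repeatedly it determines the status of all edges of $N(f)$ for $f\in B$, and of all edges of $N(g)$ for the unsafe edges $g$ found intersecting an edge of $B$, and adds all bad edges that it finds to $B$; it fails if $|B|>2(\Delta+1)\log m$; * colors it: let $C$ consist of $B$ and all unsafe edges intersecting an edge of $B$, each restricted to its troubled vertices. In each of at most $\lceil 2\log m\rceil$ trials it colors the vertices of $C$ uniformly at random and then, for at most $\lceil 2|C|/\max(\Delta,1)\rceil$ steps, either stops with success if no edge of $C$ is monochromatic, or gives new random colors to all vertices of a monochromatic edge of $C$ (time-limited Moser–Tardos RESAMPLE). After success all vertices of $C$ become accepted with their current colors; if all trials are unsuccessful, it fails. Finally the color of $v$ is returned. **Theorem.** 1. For all $k$ and all real $\alpha\le 1/4$, the base algorithm (with an implementation in which every elementary operation on memory, input or random bits is counted) is a $(t,s,\delta)$-LCA, with $t(n)=O(\log^2 n)$, $s(n)=O(n)$ and $\delta(n)=O(1/n)$,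 for two-coloring the $k$-uniform hypergraphs without isolated vertices that satisfy $2e(\Delta+1)<2^{\alpha k}$. The implied constants depend only on $k$ and $\alpha$. In particular ($\alpha=1/4$) this holds under $2e(\Delta+1)<2^{k/4}$. 2. Let $H$ be a $k$-uniform hypergraph with $m\ge1$ edges and maximum edge degree $\Delta$, let $\alpha k$ be an integer with $0\le\alpha k\le k$, and let $c>0$. Process all vertices of $H$ one by one (a vertex lying in a bad edge becomes troubled, any other vertex is accepted with a uniformly random color; an edge is bad if it contains at least $(1-\alpha)k$ accepted vertices and all its accepted vertices have the same color), where the next vertex may be chosen on-line depending on everything that has happened so far. A *witness structure* is a nonempty set $T$ of edges, no two of them adjacent in $L(H)$, such that $T$ is connected in the graph in which two edges are joined when their distance in $L(H)$ is $2$ or $3$ (a $(2,3)$-tree); it is *satisfied* if after the process all its edges are bad. If $$\frac{8\Delta^3}{2^{(1-\alpha)k}}<\frac12\qquad\text{and}\qquad u=\lceil (c+1)\log_2 m\rceil ,$$ then $$\Pr[\text{there is a satisfied witness structure of size } u]<\frac1{m^{c}} .$$ -/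

import Mathlib

open Filter Asymptotics

namespace HypergraphLCA

/-! ### Hypergraphs -/

/-- A finite hypergraph with vertices `0, …, n-1` and edges `0, …, m-1`; the edges are pairwise
distinct sets of vertices. -/
structure Hypergraph where
  n : ℕ
  m : ℕ
  edge : Fin m → Finset (Fin n)
  edge_injective : Function.Injective edge

namespace Hypergraph

variable (H : Hypergraph)

/-- Every edge has exactly `k` vertices. -/
def Uniform (k : ℕ) : Prop := ∀ e, (H.edge e).card = k

/-- Every vertex lies in some edge. -/
def NoIsolated : Prop := ∀ v, ∃ e, v ∈ H.edge e

/-- The line graph: distinct edges are adjacent when they intersect. -/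
def lineGraph : SimpleGraph (Fin H.m) where
  Adj e f := e ≠ f ∧ ¬ Disjoint (H.edge e) (H.edge f)
  symm := ⟨fun _ _ h => ⟨h.1.symm, fun hd => h.2 hd.symm⟩⟩
  loopless := ⟨fun _ h => h.1 rfl⟩

/-- The number of other edges intersecting `e`. -/
def edgeDegree (e : Fin H.m) : ℕ :=
  (Finset.univ.filter fun f => f ≠ e ∧ ¬ Disjoint (H.edge e) (H.edge f)).card

/-- The maximum edge degree `Δ`. -/
def maxEdgeDegree : ℕ := Finset.univ.sup H.edgeDegree

/-- A proper two-coloring: every edge contains two vertices of different colors. -/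
def ProperColoring (χ : Fin H.n → Bool) : Prop :=
  ∀ e, ∃ v ∈ H.edge e, ∃ w ∈ H.edge e, χ v ≠ χ w

/-! ### The global shattering phase and witness structures -/

/-- Status of a vertex during the shattering phase. -/
inductive VStatus
  | uncolored
  | troubled
  | accepted (color : Bool)
  deriving DecidableEq

/-- The vertices of `e` that have been accepted with color `b`. -/
def acceptedIn (s : Fin H.n → VStatus) (e : Fin H.m) (b : Bool) : Finset (Fin H.n) :=
  (H.edge e).filter fun v => s v = VStatus.accepted b

/-- An edge is bad (for the threshold `r`) if it contains `r` accepted vertices and all its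
accepted vertices have the same color. -/
def IsBad (r : ℕ) (s : Fin H.n → VStatus) (e : Fin H.m) : Prop :=
  r ≤ (H.acceptedIn s e true).card + (H.acceptedIn s e false).card ∧
    (H.acceptedIn s e true = ∅ ∨ H.acceptedIn s e false = ∅)

/-- An ordering of the vertices that is chosen on-line: depending on everything that happened so
far it names the next vertex to process. (A deterministic strategy can reconstruct the history
from the current statuses; a fixed ordering is a special case.) -/
def OnlineOrder : Type :=
  (s : Fin H.n → VStatus) → (∃ v, s v = VStatus.uncolored) → {v // s v = VStatus.uncolored}

open Classical in
/-- The shattering phase with `fuel` vertices left to process: the next vertex becomes troubled if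
it lies in a bad edge, and otherwise it is accepted with a uniformly random color. -/
noncomputable def shatter (r : ℕ) (σ : H.OnlineOrder) :
    ℕ → (Fin H.n → VStatus) → PMF (Fin H.n → VStatus)
  | 0, s => PMF.pure s
  | fuel + 1, s =>
    if h : ∃ v, s v = VStatus.uncolored then
      let v : Fin H.n := (σ s h).1
      if ∃ e, v ∈ H.edge e ∧ H.IsBad r s e then
        shatter r σ fuel (Function.update s v VStatus.troubled)
      else
        (PMF.uniformOfFintype Bool).bind fun b =>
          shatter r σ fuel (Function.update s v (VStatus.accepted b))
    else PMF.pure s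

/-- The outcome of the complete shattering phase. -/
noncomputable def shattering (r : ℕ) (σ : H.OnlineOrder) : PMF (Fin H.n → VStatus) :=
  H.shatter r σ H.n fun _ => VStatus.uncolored

/-- Edges at distance two or three in the line graph. -/
def distTwoThree : SimpleGraph (Fin H.m) where
  Adj e f := H.lineGraph.dist e f = 2 ∨ H.lineGraph.dist e f = 3
  symm := ⟨fun e f h => by rwa [SimpleGraph.dist_comm]⟩
  loopless := ⟨fun e h => by simp at h⟩

/-- A (nonempty) `(2,3)`-tree in the line graph. -/
def IsTwoThreeTree (T : Finset (Fin H.m)) : Prop :=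
  (∀ e ∈ T, ∀ f ∈ T, ¬ H.lineGraph.Adj e f) ∧
    (H.distTwoThree.induce (T : Set (Fin H.m))).Connected

/-- After the shattering phase there is a satisfied witness structure of size `u`: a `(2,3)`-tree
of `u` edges all of which are bad. -/
def HasSatisfiedWitness (r u : ℕ) (s : Fin H.n → VStatus) : Prop :=
  ∃ T : Finset (Fin H.m), H.IsTwoThreeTree T ∧ T.card = u ∧ ∀ e ∈ T, H.IsBad r s e

/-! ### The input tape -/

/-- Vertex number `v` lies in edge number `e`. -/
def Inc (v e : ℕ) : Prop :=
  ∃ (v' : Fin H.n) (e' : Fin H.m), (v' : ℕ) = v ∧ (e' : ℕ) = e ∧ v' ∈ H.edge e'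

instance (v e : ℕ) : Decidable (H.Inc v e) := by unfold Inc; infer_instance

/-- The edges containing `v`, as listed on the input tape. -/
def incidentList (v : ℕ) : List ℕ := (List.range H.m).filter fun e => H.Inc v e

/-- The vertices of `e`, as listed on the input tape. -/
def memberList (e : ℕ) : List ℕ := (List.range H.n).filter fun v => H.Inc v e

end Hypergraph

/-! ### Machine model

A random access machine with a read-only input tape (incidence lists), a random tape and a
read-write computation memory. The memory is divided into finitely many regions, each of them
addressed by natural numbers. A program is the tree of its elementary operations; apart from the
memory it has only a fixed number of registers holding vertices, edges, flags and counters. -/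

/-- The regions of the computation memory. -/
inductive Region
  | status | color | explored | inComp | arrB | arrU | arrQ | arrC | arrW | arrX
  deriving DecidableEq

/-- Programs with result in `α`. The answer of each operation is passed to the continuation. -/
inductive Prog (α : Type) : Type
  | ret (a : α) : Prog α
  | fail : Prog α
  | degree (v : ℕ) (next : ℕ → Prog α) : Prog α
  | incident (v i : ℕ) (next : ℕ → Prog α) : Prog α
  | member (e j : ℕ) (next : ℕ → Prog α) : Prog α
  | load (c : Region) (i : ℕ) (next : ℕ → Prog α) : Prog α
  | store (c : Region) (i x : ℕ) (next : Prog α) : Prog α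
  | coin (next : Bool → Prog α) : Prog α

namespace Prog

/-- Sequential composition. -/
def bind {α β : Type} : Prog α → (α → Prog β) → Prog β
  | ret a, g => g a
  | fail, _ => fail
  | degree v next, g => degree v fun x => (next x).bind g
  | incident v i next, g => incident v i fun x => (next x).bind g
  | member e j next, g => member e j fun x => (next x).bind g
  | load c i next, g => load c i fun x => (next x).bind g
  | store c i x next, g => store c i x (next.bind g)
  | coin next, g => coin fun b => (next b).bind g

instance : Monad Prog where
  pure := Prog.ret
  bind := Prog.bind

end Prog

/-- Contents of the computation memory, together with the set of cells written so far. -/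
structure Mem where
  cell : Region → ℕ → ℕ
  used : Finset (Region × ℕ)

namespace Mem

/-- The initial, blank memory. -/
def empty : Mem := ⟨fun _ _ => 0, ∅⟩

/-- Writing `x` to cell `i` of region `c`. -/
def write (μ : Mem) (c : Region) (i x : ℕ) : Mem where
  cell := fun c' i' => if c' = c ∧ i' = i then x else μ.cell c' i'
  used := insert (c, i) μ.used

/-- Occupied space in bits: each used cell counts with the length of its content plus one. -/
def bits (μ : Mem) : ℕ := ∑ p ∈ μ.used, (1 + Nat.size (μ.cell p.1 p.2))

end Mem

/-- Result of an execution: the returned value (`none` after a failure), the final memory, the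
number of executed operations and the maximum space that was occupied at any moment. -/
structure Result (α : Type) where
  value : Option α
  mem : Mem
  time : ℕ
  space : ℕ

/-- Accounting for one operation executed with memory `μ`. -/
def Result.charge {α : Type} (μ : Mem) (r : Result α) : Result α where
  value := r.value
  mem := r.mem
  time := r.time + 1
  space := max μ.bits r.space

/-- The distribution of the result of a program on the input `H` started with memory `μ`. -/
noncomputable def Prog.exec {α : Type} (H : Hypergraph) : Prog α → Mem → PMF (Result α)
  | .ret a, μ => PMF.pure ⟨some a, μ, 1, μ.bits⟩
  | .fail, μ => PMF.pure ⟨none, μ, 1, μ.bits⟩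
  | .degree v next, μ => ((next (H.incidentList v).length).exec H μ).map (Result.charge μ)
  | .incident v i next, μ =>
      ((next ((H.incidentList v).getD i 0)).exec H μ).map (Result.charge μ)
  | .member e j next, μ => ((next ((H.memberList e).getD j 0)).exec H μ).map (Result.charge μ)
  | .load c i next, μ => ((next (μ.cell c i)).exec H μ).map (Result.charge μ)
  | .store c i x next, μ => (next.exec H (μ.write c i x)).map (Result.charge μ)
  | .coin next, μ =>
      (PMF.uniformOfFintype Bool).bind fun b => ((next b).exec H μ).map (Result.charge μ)

/-! ### Local computation algorithms -/

/-- A query procedure for two-coloring: it is given the numbers `n`, `m` of vertices and edges and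
the maximum edge degree of the input, as well as the queried vertex, and it answers with a color.
Everything else it can learn about the input only through the input tape. -/
abbrev Procedure := (n m Δ : ℕ) → (v : ℕ) → Prog Bool

/-- The results of the queries `qs`, answered one after another starting with memory `μ`. The memory
is preserved between queries, and the run stops after a failure. -/
noncomputable def runQueries (H : Hypergraph) (query : ℕ → Prog Bool) :
    List (Fin H.n) → Mem → PMF (List (Result Bool))
  | [], _ => PMF.pure []
  | v :: vs, μ =>
      ((query v).exec H μ).bind fun r =>
        match r.value with
        | none => PMF.pure [r]
        | some _ => (runQueries H query vs r.mem).map fun rs => r :: rs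

/-- The run of the procedure `A` on the input `H` for the sequence `qs` of queries. -/
noncomputable def Procedure.run (A : Procedure) (H : Hypergraph) (qs : List (Fin H.n)) :
    PMF (List (Result Bool)) :=
  runQueries H (A H.n H.m H.maxEdgeDegree) qs Mem.empty

/-- All queries were answered, and the answers agree with a single proper two-coloring. -/
def Consistent (H : Hypergraph) (qs : List (Fin H.n)) (rs : List (Result Bool)) : Prop :=
  ∃ χ, H.ProperColoring χ ∧ List.Forall₂ (fun v r => r.value = some (χ v)) qs rs

/-- `A` is a `(t, s, δ)`-local computation algorithm for two-coloring the hypergraphs in `P`. -/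
structure IsLCA (P : Hypergraph → Prop) (A : Procedure) (t s δ : ℕ → ℝ) : Prop where
  time_le : ∀ H, P H → ∀ qs, ∀ rs ∈ (A.run H qs).support, ∀ r ∈ rs, (r.time : ℝ) ≤ t H.n
  space_le : ∀ H, P H → ∀ qs, ∀ rs ∈ (A.run H qs).support, ∀ r ∈ rs, (r.space : ℝ) ≤ s H.n
  failure_le : ∀ H, P H → ∀ qs,
    (A.run H qs).toOuterMeasure {rs | ¬ Consistent H qs rs} ≤ ENNReal.ofReal (δ H.n)

/-! ### The base algorithm -/

namespace Base

/-- Parameters: `k` is the size of edges, `a = αk`, `Δ` is the maximum edge degree and `m` the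
number of edges. -/
structure Params where
  k : ℕ
  a : ℕ
  Δ : ℕ
  m : ℕ

/-- The number `(1-α)k` of accepted vertices of one color that makes an edge bad. -/
def Params.threshold (p : Params) : ℕ := p.k - p.a

/-- The bound `⌊2(Δ+1) log₂ m⌋` on the number of bad edges in a final component. -/
def Params.compBound (p : Params) : ℕ := Nat.log 2 (p.m ^ (2 * (p.Δ + 1)))

/-- The number `⌈2 log₂ m⌉` of trials. -/
def Params.trials (p : Params) : ℕ := Nat.clog 2 (p.m ^ 2)

/-- The number `⌈2c / Δ⌉` of resampling steps for a component with `c` edges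
(with `Δ` replaced by `1` when the edges are pairwise disjoint). -/
def Params.steps (p : Params) (c : ℕ) : ℕ := ⌈(2 * c : ℚ) / (max p.Δ 1 : ℕ)⌉₊

/-- The types of edges. -/
inductive Kind
  | safe | bad | unsf
  deriving DecidableEq

/-- Codes of vertex statuses; a blank memory means that all vertices are uncolored. -/
abbrev uncolored : ℕ := 0
/-- Code of the status of vertices with a final color. -/
abbrev accepted : ℕ := 1
/-- Code of the status of vertices left for the final coloring phase. -/
abbrev troubled : ℕ := 2

/-- Runs `body` for the edges containing `v` at the first `i` positions of the list. -/
def forIncident {σ : Type} (v : ℕ) (body : σ → ℕ → Prog σ) : ℕ → σ → Prog σ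
  | 0, x => Prog.ret x
  | i + 1, x => .incident v i fun g => do
      let y ← body x g
      forIncident v body i y

/-- Runs `body` for the vertices of `e` at the first `j` positions of the list. -/
def forMembers {σ : Type} (e : ℕ) (body : σ → ℕ → Prog σ) : ℕ → σ → Prog σ
  | 0, x => Prog.ret x
  | j + 1, x => .member e j fun v => do
      let y ← body x v
      forMembers e body j y

/-- Runs `body` for all edges of `N(f)`; it may meet the same edge several times, and `f` itself. -/
def forNeighbors {σ : Type} (p : Params) (f : ℕ) (body : σ → ℕ → Prog σ) (x : σ) : Prog σ :=
  forMembers f (fun y v => .degree v fun d => forIncident v body d y) p.k x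

/-- Runs `body` for the entries of the array `c` at positions `0, …, i-1`. -/
def forArray {σ : Type} (c : Region) (body : σ → ℕ → Prog σ) : ℕ → σ → Prog σ
  | 0, x => Prog.ret x
  | i + 1, x => .load c i fun g => do
      let y ← body x g
      forArray c body i y

/-- The numbers of vertices of `g` with the given status and color `0` and `1`, respectively. -/
def countColors (p : Params) (st g : ℕ) : Prog (ℕ × ℕ) :=
  forMembers g (fun x v =>
    .load .status v fun s =>
      if s = st then
        .load .color v fun b => .ret (if b = 0 then (x.1 + 1, x.2) else (x.1, x.2 + 1))
      else .ret x) p.k (0, 0)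

/-- The current type of the edge `g`, determined by its accepted vertices. -/
def kindOf (p : Params) (g : ℕ) : Prog Kind := do
  let x ← countColors p accepted g
  if 0 < x.1 ∧ 0 < x.2 then .ret .safe
  else if p.threshold ≤ x.1 + x.2 then .ret .bad
  else .ret .unsf

/-- Some bad edge containing `v`, if there is one. -/
def findBad (p : Params) (v : ℕ) : Prog (Option ℕ) :=
  .degree v fun d =>
    forIncident v (fun found g => do
      let κ ← kindOf p g
      .ret (if κ = .bad then some g else found)) d none

/-- Assigns a random color to `v`. -/
def randomColor (v : ℕ) : Prog Unit :=
  .coin fun b => .store .color v b.toNat (.ret ())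

/-- Processes the uncolored vertex `v` in the shattering phase. -/
def processVertex (p : Params) (v : ℕ) : Prog Unit := do
  let e ← findBad p v
  if e.isSome then .store .status v troubled (.ret ())
  else do
    randomColor v
    .store .status v accepted (.ret ())

/-- Processes the uncolored vertices of `g`, unless `g` becomes safe, and returns its type. -/
def determineEdgeStatus (p : Params) (g : ℕ) : Prog Kind := do
  forMembers g (fun _ v => .load .status v fun s =>
    if s = uncolored then do
      let κ ← kindOf p g
      if κ = .safe then .ret () else processVertex p v
    else .ret ()) p.k ()
  kindOf p g

/-- Numbers of elements of the arrays `B` (bad edges of the component), `U` (unsafe edges to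
process), `Q` (bad edges to process) and `X` (edges marked as explored). -/
structure Counters where
  b : ℕ
  u : ℕ
  q : ℕ
  x : ℕ

/-- Exploring a neighbor `g` of a bad edge of the component. -/
def visitNeighbor (p : Params) (c : Counters) (g : ℕ) : Prog Counters :=
  .load .explored g fun flag =>
    if flag ≠ 0 then .ret c
    else .store .explored g 1 <| .store .arrX c.x g <| do
      let κ ← determineEdgeStatus p g
      match κ with
      | .bad => .store .arrQ c.q g (.ret { c with q := c.q + 1, x := c.x + 1 })
      | .unsf => .store .arrU c.u g (.ret { c with u := c.u + 1, x := c.x + 1 })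
      | .safe => .ret { c with x := c.x + 1 }

/-- Expands the bad-components of the edges in `Q`. The first argument only bounds the number of
iterations of the loop. -/
def expandBadComp (p : Params) : ℕ → Counters → Prog Counters
  | 0, _ => .fail
  | fuel + 1, c =>
    if c.q = 0 then .ret c
    else .load .arrQ (c.q - 1) fun f => .store .arrB c.b f <|
      if p.compBound < c.b + 1 then .fail
      else do
        let c' ← forNeighbors p f (visitNeighbor p) { c with q := c.q - 1, b := c.b + 1 }
        expandBadComp p fuel c'

/-- More iterations than `expandBadComp` can make before the component becomes too large. -/
def Params.badFuel (p : Params) : ℕ := p.compBound + 2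

/-- Marks the bad edge `g` as explored and expands its bad-component. -/
def startBadComp (p : Params) (c : Counters) (g : ℕ) : Prog Counters :=
  .store .explored g 1 <| .store .arrX c.x g <| .store .arrQ 0 g <|
    expandBadComp p p.badFuel { c with q := 1, x := c.x + 1 }

/-- Exploring a neighbor `g` of an unsafe edge adjacent to the component. -/
def visitViaUnsafe (p : Params) (c : Counters) (g : ℕ) : Prog Counters :=
  .load .explored g fun flag =>
    if flag ≠ 0 then .ret c
    else do
      let κ ← determineEdgeStatus p g
      if κ = .bad then startBadComp p c g else .ret c

/-- Processes the unsafe edges in `U`. The first argument only bounds the number of iterations of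
the loop. -/
def expandViaUnsafe (p : Params) : ℕ → Counters → Prog Counters
  | 0, _ => .fail
  | fuel + 1, c =>
    if c.u = 0 then .ret c
    else .load .arrU (c.u - 1) fun f => do
      let c' ← forNeighbors p f (visitViaUnsafe p) { c with u := c.u - 1 }
      expandViaUnsafe p fuel c'

/-- More iterations than `expandViaUnsafe` can make: each edge that it processes is adjacent to one
of the at most `compBound` edges of `B`. -/
def Params.unsafeFuel (p : Params) : ℕ := p.Δ * p.compBound + 2

/-- Collects in the array `B` the bad edges of the final component of the troubled vertex `v`. -/
def buildFinalComponent (p : Params) (v : ℕ) : Prog Counters := do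
  let found ← findBad p v
  match found with
  | none => .fail
  | some e => do
      let _ ← determineEdgeStatus p e
      let c ← startBadComp p ⟨0, 0, 0, 0⟩ e
      expandViaUnsafe p p.unsafeFuel c

/-- Adds the edge `g` to the array `C` of length `c`, and returns the new length. -/
def addToComp (c g : ℕ) : Prog ℕ :=
  .store .inComp g 1 <| .store .arrC c g <| .ret (c + 1)

/-- Adds to `C` the `b` bad edges of the component and all unsafe edges that intersect it. -/
def collectEdges (p : Params) (b : ℕ) : Prog ℕ :=
  forArray .arrB (fun c f => do
    let c' ← addToComp c f
    forNeighbors p f (fun c g => .load .inComp g fun flag =>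
      if flag ≠ 0 then .ret c
      else do
        let κ ← kindOf p g
        if κ = .unsf then addToComp c g else .ret c) c') b 0

/-- Assigns new random colors to the troubled vertices of `f`. -/
def resampleEdge (p : Params) (f : ℕ) : Prog Unit :=
  forMembers f (fun _ v => .load .status v fun s =>
    if s = troubled then randomColor v else .ret ()) p.k ()

/-- Takes edges from the list `W`, which contains all monochromatic edges of the restricted
component, until a monochromatic one is found. -/
def findMonochromatic (p : Params) : ℕ → Prog (Option (ℕ × ℕ))
  | 0 => .ret none
  | w + 1 => .load .arrW w fun f => do
      let x ← countColors p troubled f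
      if x.1 = 0 ∨ x.2 = 0 then .ret (some (f, w)) else findMonochromatic p w

/-- RESAMPLE with a limited number of steps; returns whether a proper coloring was found. -/
def resample (p : Params) : ℕ → ℕ → Prog Bool
  | 0, _ => .ret false
  | s + 1, w => do
      let found ← findMonochromatic p w
      match found with
      | none => .ret true
      | some (f, w') => do
          resampleEdge p f
          let w'' ← forNeighbors p f (fun w g => .load .inComp g fun flag =>
            if flag ≠ 0 then .store .arrW w g (.ret (w + 1)) else .ret w) w'
          resample p s w''

/-- One trial: assigns random colors to all troubled vertices of the `c` edges in `C`, and runs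
RESAMPLE. -/
def trial (p : Params) (c : ℕ) : Prog Bool := do
  let w ← forArray .arrC (fun w f => do
    resampleEdge p f
    .store .arrW w f (.ret (w + 1))) c 0
  resample p (p.steps c) w

/-- Repeated trials, until one of them succeeds. -/
def trialLoop (p : Params) (c : ℕ) : ℕ → Prog Unit
  | 0 => .fail
  | i + 1 => do
      let ok ← trial p c
      if ok then .ret () else trialLoop p c i

/-- The final coloring phase. Afterwards all vertices of the component are marked as accepted, and
the temporary flags are cleared. -/
def colorFinalComponent (p : Params) (n : Counters) : Prog Unit := do
  let c ← collectEdges p n.b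
  trialLoop p c p.trials
  forArray .arrC (fun _ f => .store .inComp f 0 <|
    forMembers f (fun _ v => .load .status v fun s =>
      if s = troubled then .store .status v accepted (.ret ()) else .ret ()) p.k ()) c ()
  forArray .arrX (fun _ g => .store .explored g 0 (.ret ())) n.x ()

/-- The main function: the color of the vertex `v`. -/
def query (p : Params) (v : ℕ) : Prog Bool :=
  .load .status v fun s => do
    if s = uncolored then processVertex p v else .ret ()
    .load .status v fun s' => do
      if s' = troubled then do
        let n ← buildFinalComponent p v
        colorFinalComponent p n
      else .ret ()
      .load .color v fun b => .ret (decide (b ≠ 0))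

end Base

/-- Beck's shattering phase followed by time-limited RESAMPLE on the final components, for
`k`-uniform hypergraphs and the parameter `α`. -/
noncomputable def baseAlgorithm (k : ℕ) (α : ℝ) : Procedure :=
  fun _ m Δ v => Base.query ⟨k, ⌈α * k⌉₊, Δ, m⟩ v

/-- The admissible inputs: `k`-uniform hypergraphs without isolated vertices that satisfy
`2e(Δ+1) < 2^(αk)`. -/
def Admissible (k : ℕ) (α : ℝ) (H : Hypergraph) : Prop :=
  H.Uniform k ∧ H.NoIsolated ∧
    2 * Real.exp 1 * ((H.maxEdgeDegree : ℝ) + 1) < (2 : ℝ) ^ (α * k)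

end HypergraphLCA

/-!
Both parts rest on one supermartingale. While vertices are processed, the potential of an edge is an
upper bound for the conditional probability that the edge becomes bad: it is zero for a safe edge,
one for a bad edge, and otherwise `2 ^ max j 1 / 2 ^ r` for `j` accepted vertices, where `r` is the
number of accepted vertices that makes an edge bad. Accepting one more vertex (but for the first
one) doubles the potential or makes the edge safe, with probability one half each. The edges of a
`(2,3)`-tree are pairwise disjoint, so the product of their potentials does not increase on average
either, and neither does the sum `treePot` over all `(2,3)`-trees of size `u` (`treePot_step`),
whatever the order of the vertices is. It is at least one as soon as some tree is satisfied. Its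
initial value is at most the number of trees times `(2 / 2 ^ r) ^ u`. As every edge has at most
`Δ ^ 3` edges at distance two or three, the trees with a given root are counted layer by layer with the
binomial theorem (`sum_pow_card_cutConn_le`), and `8Δ³ / 2 ^ r < 1/2` gives the bound `m / 2 ^ u`
(`treePot_initial_lt`). Part 2 follows directly (`shattering_hasSatisfiedWitness_lt`).

For the algorithm, three more facts are needed.

* The bad edges of a final component are connected by steps of length at most two in the line graph.
  A set of more than `(Δ + 1) u` such edges contains a `(2,3)`-tree of size `u + 1`
  (`exists_isTree`). So if the component becomes too large there is a satisfied witness structure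
  (`Inv.overflow`), and the supermartingale bounds the probability of this event.
* In a final component, `RESAMPLE` makes in expectation at most `|C| / max Δ 1` steps when it starts
  with random colors. The number of steps is compared with `stepPot`, the sum over all layered
  records of steps of the probability that all edges of the record are monochromatic when they are
  checked and recolored from the deepest layer to the first one. A resampling step pays for itself:
  putting it in front of the records of later steps is injective and never yields the
  record of the present step alone (`one_add_rs_stepPot_le`). Since the checks are independent, the
  expectation of `stepPot` is again bounded layer by layer (`rs_stepPot_le`). By Markov's inequality
  a trial fails with probability at most one half (`trial_spec`).
* After a successful trial the vertices of the component may be accepted. Every edge with a troubled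
  vertex of the component is safe already, or belongs to the component and is safe afterwards
  (`colorFinalComponent_spec`). Hence the colors never conflict, and an edge that is not safe always
  has at least `a > 0` vertices that are not accepted (`Abs`).

The quantity `failPot` adds to `treePot` the failure probability `2 ^ (-trials)` of the final
coloring phase for every vertex that is not accepted. Each query that builds a component makes one
such vertex accepted, so that `failPot` bounds the probability of failing from any moment on
(`query_spec`). If the sequence of queries is extended by all vertices and none of the queries
fails, all vertices are accepted and their colors form a proper coloring; this gives the consistency
(`toOuterMeasure_not_consistent_le`).

Time and space are bounded without reference to the contents of the memory: the predicate `Cost`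
counts operations and checks the addresses and the contents that are written, while the answers of
loads and of the input tape are arbitrary admissible values. The expansion of bad components within
the processing of unsafe edges, and the resampling steps within the trials, are nested loops with
`O(log n)` iterations each, up to factors depending on `k` and `α`, and nothing else takes longer;
this gives `O(log² n)` operations (`within_query`, `queryTime_le`).
-/

open scoped ENNReal

namespace HypergraphLCA

/-! ### Connected sets and their number -/

section CutConn

variable {V : Type*} [DecidableEq V]

/-- The set `T` contains `S`, and every element of `T` can be reached from `S` along `R` without
leaving `T`. The second condition is expressed by cuts: every proper part of `T` that contains `S`
is left by some pair of `R`. -/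
def CutConn (R : V → V → Prop) (S T : Finset V) : Prop :=
  S ⊆ T ∧ ∀ X, S ⊆ X → X ⊂ T → ∃ x ∈ X, ∃ y ∈ T \ X, R x y

lemma CutConn.refl (R : V → V → Prop) (S : Finset V) : CutConn R S S :=
  ⟨subset_rfl, fun _ h h' => absurd h h'.2⟩

lemma CutConn.insert {R : V → V → Prop} {S T : Finset V} (h : CutConn R S T) {t g : V}
    (ht : t ∈ T) (hg : R t g) : CutConn R S (insert g T) := by
  refine ⟨h.1.trans (Finset.subset_insert _ _), fun X hS hX => ?_⟩
  by_cases hT : T ⊆ X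
  · refine ⟨t, hT ht, g, ?_, hg⟩
    refine Finset.mem_sdiff.2 ⟨Finset.mem_insert_self _ _, fun hgX => hX.2 ?_⟩
    exact Finset.insert_subset hgX hT
  · obtain ⟨x, hx, y, hy, hxy⟩ := h.2 (X ∩ T) (Finset.subset_inter hS h.1)
      ⟨Finset.inter_subset_right, fun hc => hT (hc.trans Finset.inter_subset_left)⟩
    rw [Finset.mem_sdiff, Finset.mem_inter] at hy
    exact ⟨x, (Finset.mem_inter.1 hx).1, y,
      Finset.mem_sdiff.2 ⟨Finset.mem_insert_of_mem hy.1, fun hc => hy.2 ⟨hc, hy.1⟩⟩, hxy⟩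

lemma CutConn.eq_empty {R : V → V → Prop} {T : Finset V} (h : CutConn R ∅ T) : T = ∅ := by
  by_contra hT
  obtain ⟨x, hx, -⟩ := h.2 ∅ subset_rfl (Finset.ssubset_iff_subset_ne.2
    ⟨Finset.empty_subset _, Ne.symm hT⟩)
  simp at hx

/-- Removing the first layer: what remains is connected to the neighbors of that layer. -/
lemma CutConn.sdiff {N : V → Finset V} {S T : Finset V} (h : CutConn (fun a b => b ∈ N a) S T) :
    CutConn (fun a b => b ∈ N a) (S.biUnion N ∩ (T \ S)) (T \ S) := by
  refine ⟨Finset.inter_subset_right, fun X hS hX => ?_⟩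
  obtain ⟨x, hx, y, hy, hxy⟩ := h.2 (X ∪ S) Finset.subset_union_right (by
    refine Finset.ssubset_iff_subset_ne.2 ⟨Finset.union_subset
      (hX.1.trans Finset.sdiff_subset) h.1, fun hc => hX.2 ?_⟩
    intro z hz
    rw [← hc, Finset.mem_sdiff, Finset.mem_union] at hz
    tauto)
  simp only [Finset.mem_sdiff, Finset.mem_union, not_or] at hx hy
  rcases hx with hx | hx
  · exact ⟨x, hx, y, by simp [hy.1, hy.2.1, hy.2.2], hxy⟩
  · refine absurd (hS ?_) hy.2.1
    simp only [Finset.mem_inter, Finset.mem_biUnion, Finset.mem_sdiff]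
    exact ⟨⟨x, hx, hxy⟩, hy.1, hy.2.2⟩

/-- The weighted number of connected sets that start with the layer `S` in a graph of maximum
degree `D`. The induction removes the first layer; the next one is a set of neighbors of `S`, and
the binomial theorem sums over all possibilities for it. -/
lemma sum_pow_card_cutConn_le [Fintype V] (N : V → Finset V) (D : ℕ) (hN : ∀ v, (N v).card ≤ D)
    (z y : ℝ) (hz : 0 ≤ z) (hy : 0 ≤ y) (h : z * (1 + y) ^ D ≤ y) (d : ℕ) :
    ∀ S : Finset V, ∀ F : Finset (Finset V),
      (∀ T ∈ F, T.card ≤ d ∧ CutConn (fun a b => b ∈ N a) S T) →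
      ∑ T ∈ F, z ^ T.card ≤ y ^ S.card := by
  induction d with
  | zero =>
    intro S F hF
    have hsub : F ⊆ {∅} := fun T hT => by
      have := (hF T hT).1
      simpa using this
    rcases Finset.subset_singleton_iff.1 hsub with rfl | rfl
    · simpa using pow_nonneg hy _
    · have := (hF ∅ (by simp)).2.1
      simp [Finset.subset_empty.1 this]
  | succ d ih =>
    intro S F hF
    rcases S.eq_empty_or_nonempty with rfl | hS
    · have hsub : F ⊆ {∅} := fun T hT => by simpa using (hF T hT).2.eq_empty
      rcases Finset.subset_singleton_iff.1 hsub with rfl | rfl <;> simp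
    · classical
      have h1 : ∀ T ∈ F, z ^ T.card = z ^ S.card * z ^ (T \ S).card := fun T hT => by
        rw [← pow_add, Finset.card_sdiff_of_subset (hF T hT).2.1,
          Nat.add_sub_cancel' (Finset.card_le_card (hF T hT).2.1)]
      rw [Finset.sum_congr rfl h1, ← Finset.mul_sum]
      have h2 : ∑ T ∈ F, z ^ (T \ S).card ≤ (1 + y) ^ (S.biUnion N).card := by
        rw [← Finset.sum_fiberwise_of_maps_to (t := (S.biUnion N).powerset)
          (g := fun T => S.biUnion N ∩ (T \ S))
          (fun T _ => Finset.mem_powerset.2 Finset.inter_subset_left)]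
        have h3 := Finset.sum_pow_mul_eq_add_pow y 1 (S.biUnion N)
        simp only [one_pow, mul_one] at h3
        rw [add_comm, ← h3]
        refine Finset.sum_le_sum fun S' _ => ?_
        have hinj : Set.InjOn (fun T => T \ S)
            (F.filter fun T => S.biUnion N ∩ (T \ S) = S' : Finset _) := by
          intro T hT T' hT' he
          rw [Finset.mem_coe, Finset.mem_filter] at hT hT'
          have e1 := Finset.sdiff_union_of_subset (hF T hT.1).2.1
          have e2 := Finset.sdiff_union_of_subset (hF T' hT'.1).2.1
          rw [← e1, ← e2]
          exact congrArg (· ∪ S) he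
        rw [← Finset.sum_image (f := fun T => z ^ T.card) hinj]
        refine ih S' _ fun T' hT' => ?_
        obtain ⟨T, hT, rfl⟩ := Finset.mem_image.1 hT'
        obtain ⟨hTF, rfl⟩ := Finset.mem_filter.1 hT
        refine ⟨?_, (hF T hTF).2.sdiff⟩
        rw [Finset.card_sdiff_of_subset (hF T hTF).2.1]
        have := (hF T hTF).1
        have := hS.card_pos
        omega
      have h4 : (S.biUnion N).card ≤ D * S.card := by
        rw [mul_comm]
        exact Finset.card_biUnion_le_card_mul _ _ _ fun v _ => hN v
      calc z ^ S.card * ∑ T ∈ F, z ^ (T \ S).card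
          ≤ z ^ S.card * (1 + y) ^ (D * S.card) := by
            refine mul_le_mul_of_nonneg_left (h2.trans ?_) (pow_nonneg hz _)
            exact pow_le_pow_right₀ (by linarith) h4
        _ = (z * (1 + y) ^ D) ^ S.card := by rw [mul_pow, pow_mul]
        _ ≤ y ^ S.card := pow_le_pow_left₀ (by positivity) h _

end CutConn

namespace Hypergraph

variable (H : Hypergraph)

/-- The edges adjacent to `e` in the line graph. -/
def nbrs (e : Fin H.m) : Finset (Fin H.m) :=
  Finset.univ.filter fun f => f ≠ e ∧ ¬ Disjoint (H.edge e) (H.edge f)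

variable {H}

lemma mem_nbrs {e f : Fin H.m} : f ∈ H.nbrs e ↔ f ≠ e ∧ ¬ Disjoint (H.edge e) (H.edge f) := by
  simp [nbrs]

lemma mem_nbrs_comm {e f : Fin H.m} : f ∈ H.nbrs e ↔ e ∈ H.nbrs f := by
  rw [mem_nbrs, mem_nbrs, ne_comm, disjoint_comm]

lemma lineGraph_adj {e f : Fin H.m} : H.lineGraph.Adj e f ↔ f ∈ H.nbrs e := by
  rw [mem_nbrs, ne_comm]; rfl

lemma card_nbrs_le (e : Fin H.m) : (H.nbrs e).card ≤ H.maxEdgeDegree :=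
  Finset.le_sup (f := H.edgeDegree) (Finset.mem_univ e)

/-- The edges that are reached from `e` by two or three steps in the line graph which do not turn
back at once. -/
def farNbrs (H : Hypergraph) (e : Fin H.m) : Finset (Fin H.m) :=
  (H.nbrs e).biUnion fun g => (H.nbrs g).biUnion fun h => insert h ((H.nbrs h).erase g)

lemma card_farNbrs_le (e : Fin H.m) : (H.farNbrs e).card ≤ H.maxEdgeDegree ^ 3 := by
  have key : ∀ g, ∀ h ∈ H.nbrs g,
      (insert h ((H.nbrs h).erase g)).card ≤ H.maxEdgeDegree := fun g h hh => by
    refine (Finset.card_insert_le _ _).trans ?_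
    rw [Finset.card_erase_add_one (mem_nbrs_comm.1 hh)]
    exact card_nbrs_le h
  calc (H.farNbrs e).card
      ≤ (H.nbrs e).card * (H.maxEdgeDegree * H.maxEdgeDegree) := by
        refine Finset.card_biUnion_le_card_mul _ _ _ fun g _ => ?_
        refine (Finset.card_biUnion_le_card_mul _ _ _ fun h hh => key g h hh).trans ?_
        exact Nat.mul_le_mul_right _ (card_nbrs_le g)
    _ ≤ H.maxEdgeDegree * (H.maxEdgeDegree * H.maxEdgeDegree) :=
        Nat.mul_le_mul_right _ (card_nbrs_le e)
    _ = H.maxEdgeDegree ^ 3 := by ring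

/-- `f` can be reached from `e` by one or two steps in the line graph. -/
def Near (H : Hypergraph) (e f : Fin H.m) : Prop :=
  f ∈ H.nbrs e ∨ ∃ g ∈ H.nbrs e, f ∈ H.nbrs g

/-- The `(2,3)`-trees of size `u`, described by `CutConn` and `farNbrs`. -/
def IsTree (H : Hypergraph) (u : ℕ) (T : Finset (Fin H.m)) : Prop :=
  T.card = u ∧ (∀ e ∈ T, ∀ f ∈ T, f ∉ H.nbrs e) ∧
    ∃ e ∈ T, CutConn (fun a b => b ∈ H.farNbrs a) {e} T

lemma farNbrs_of_dist {e f : Fin H.m} (h : H.distTwoThree.Adj e f) : f ∈ H.farNbrs e := by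
  have hne : ∀ n, H.lineGraph.dist e f = n + 1 → ∃ p : H.lineGraph.Walk e f, p.length = n + 1 := by
    intro n hn
    have hr : H.lineGraph.Reachable e f := by
      by_contra hc
      rw [SimpleGraph.dist_eq_zero_of_not_reachable hc] at hn
      omega
    obtain ⟨p, hp⟩ := hr.exists_walk_length_eq_dist
    exact ⟨p, hp.trans hn⟩
  simp only [farNbrs, Finset.mem_biUnion]
  rcases h with h | h
  · obtain ⟨p, hp⟩ := hne 1 h
    match p, hp with
    | .cons h1 (.cons h2 .nil), _ =>
      exact ⟨_, lineGraph_adj.1 h1, _, lineGraph_adj.1 h2, Finset.mem_insert_self _ _⟩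
  · obtain ⟨p, hp⟩ := hne 2 h
    match p, hp with
    | .cons (v := g) h1 (.cons (v := x) h2 (.cons h3 .nil)), _ =>
      refine ⟨g, lineGraph_adj.1 h1, x, lineGraph_adj.1 h2, Finset.mem_insert_of_mem ?_⟩
      refine Finset.mem_erase.2 ⟨?_, lineGraph_adj.1 h3⟩
      rintro rfl
      have := SimpleGraph.dist_le (SimpleGraph.Walk.cons h1 .nil)
      simp only [SimpleGraph.Walk.length_cons, SimpleGraph.Walk.length_nil] at this
      omega

lemma IsTwoThreeTree.isTree {T : Finset (Fin H.m)} (h : H.IsTwoThreeTree T) :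
    H.IsTree T.card T := by
  obtain ⟨h1, h2⟩ := h
  refine ⟨rfl, fun e he f hf hef => h1 e he f hf (lineGraph_adj.2 hef), ?_⟩
  obtain ⟨⟨e, he⟩⟩ := h2.nonempty
  have he' : e ∈ T := he
  refine ⟨e, he', by simpa using he', fun X hX hXT => ?_⟩
  obtain ⟨y, hyT, hyX⟩ := Finset.exists_of_ssubset hXT
  have hwalk : ∀ (a b : (T : Set (Fin H.m))),
      (H.distTwoThree.induce (T : Set (Fin H.m))).Walk a b → a.1 ∈ X → b.1 ∉ X →
      ∃ x ∈ X, ∃ y ∈ T \ X, y ∈ H.farNbrs x := by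
    intro a b p
    induction p with
    | nil => exact fun ha hb => absurd ha hb
    | @cons u v w huv p ih =>
      intro hu hw
      by_cases hv : v.1 ∈ X
      · exact ih hv hw
      · exact ⟨u.1, hu, v.1, Finset.mem_sdiff.2 ⟨v.2, hv⟩, farNbrs_of_dist huv⟩
  obtain ⟨p⟩ := h2.preconnected ⟨e, he⟩ ⟨y, hyT⟩
  exact hwalk _ _ p (hX (by simp)) hyX

/-- A large set of edges that is connected by steps of length at most two contains a `(2,3)`-tree:
as long as the tree does not dominate the whole set, it can be extended by an edge that lies just
outside of its neighborhood. -/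
lemma exists_isTree {B : Finset (Fin H.m)} {e₀ : Fin H.m} (hB : CutConn H.Near {e₀} B) (u : ℕ) :
    (H.maxEdgeDegree + 1) * u < B.card → ∃ T ⊆ B, H.IsTree (u + 1) T := by
  induction u with
  | zero =>
    intro _
    refine ⟨{e₀}, hB.1, by simp, ?_, e₀, by simp, CutConn.refl _ _⟩
    simp [mem_nbrs]
  | succ u ih =>
    intro hu
    obtain ⟨T, hTB, hcard, hind, e, he, hconn⟩ := ih (by
      refine lt_of_le_of_lt ?_ hu
      exact Nat.mul_le_mul_left _ (Nat.le_succ u))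
    -- the part of `B` that is dominated by `T`
    set X := B ∩ T.biUnion fun t => insert t (H.nbrs t)
    have hXcard : X.card < B.card := by
      refine lt_of_le_of_lt ((Finset.card_le_card Finset.inter_subset_right).trans
        (Finset.card_biUnion_le_card_mul _ _ (H.maxEdgeDegree + 1) fun t _ => ?_)) (by
          rwa [hcard, mul_comm])
      exact (Finset.card_insert_le _ _).trans (Nat.succ_le_succ (card_nbrs_le t))
    have hXB : X ⊂ B := by
      refine Finset.ssubset_iff_subset_ne.2 ⟨Finset.inter_subset_left, fun hc => ?_⟩
      rw [hc] at hXcard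
      exact lt_irrefl _ hXcard
    have hTX : T ⊆ X := fun t ht => Finset.mem_inter.2
      ⟨hTB ht, Finset.mem_biUnion.2 ⟨t, ht, Finset.mem_insert_self _ _⟩⟩
    have hout : ∀ y ∈ B, y ∉ X → ∀ t ∈ T, y ≠ t ∧ y ∉ H.nbrs t := fun y hy hyX t ht => by
      constructor
      · rintro rfl; exact hyX (hTX ht)
      · exact fun hc => hyX (Finset.mem_inter.2 ⟨hy, Finset.mem_biUnion.2
          ⟨t, ht, Finset.mem_insert_of_mem hc⟩⟩)
    -- an element of `B` outside of `X` at distance two or three of `T`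
    obtain ⟨t, ht, y, hy, hyX, hty⟩ :
        ∃ t ∈ T, ∃ y ∈ B, y ∉ X ∧ y ∈ H.farNbrs t := by
      have hcross : ∃ x ∈ X, ∃ y ∈ B \ X, H.Near x y ∨ H.Near y x := by
        by_cases h0 : e₀ ∈ X
        · obtain ⟨x, hx, y, hy, h⟩ := hB.2 X (by simpa using h0) hXB
          exact ⟨x, hx, y, hy, Or.inl h⟩
        · obtain ⟨y, hy, x, hx, h⟩ := hB.2 (B \ X)
            (by simpa [h0] using hB.1 (Finset.mem_singleton_self e₀))
            (by
              refine Finset.ssubset_iff_subset_ne.2 ⟨Finset.sdiff_subset, fun hc => ?_⟩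
              have : e ∈ B \ X := by rw [hc]; exact hTB he
              exact (Finset.mem_sdiff.1 this).2 (hTX he))
          rw [Finset.mem_sdiff] at hx
          refine ⟨x, ?_, y, hy, Or.inr h⟩
          by_contra hc
          exact hx.2 (Finset.mem_sdiff.2 ⟨hx.1, hc⟩)
      have hsymm : ∀ x y, H.Near x y → H.Near y x := by
        rintro x y (h | ⟨g, h1, h2⟩)
        · exact Or.inl (mem_nbrs_comm.1 h)
        · exact Or.inr ⟨g, mem_nbrs_comm.1 h2, mem_nbrs_comm.1 h1⟩
      obtain ⟨x, hx, y, hy, h⟩ := hcross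
      have hxy : H.Near x y := h.elim id (hsymm y x)
      obtain ⟨hyB, hyX⟩ := Finset.mem_sdiff.1 hy
      obtain ⟨hxB, hx⟩ := Finset.mem_inter.1 hx
      obtain ⟨t, ht, hxt⟩ := Finset.mem_biUnion.1 hx
      refine ⟨t, ht, y, hyB, hyX, ?_⟩
      have ho := hout y hyB hyX t ht
      simp only [farNbrs, Finset.mem_biUnion, Finset.mem_insert, Finset.mem_erase]
      rcases Finset.mem_insert.1 hxt with rfl | hxt
      · rcases hxy with hxy | ⟨g, hg, hy⟩
        · exact absurd hxy ho.2
        · exact ⟨g, hg, y, hy, Or.inl rfl⟩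
      · rcases hxy with hxy | ⟨g, hg, hy⟩
        · exact ⟨x, hxt, y, hxy, Or.inl rfl⟩
        · refine ⟨x, hxt, g, hg, Or.inr ⟨?_, hy⟩⟩
          rintro rfl
          exact ho.2 hxt
    have hyT : y ∉ T := fun hc => (hout y hy hyX y hc).1 rfl
    refine ⟨insert y T, Finset.insert_subset hy hTB, ?_, ?_, e, Finset.mem_insert_of_mem he,
      hconn.insert ht hty⟩
    · rw [Finset.card_insert_of_notMem hyT, hcard]
    · intro a ha b hb
      rcases Finset.mem_insert.1 ha with ha | ha <;> rcases Finset.mem_insert.1 hb with hb | hb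
      · simp [ha, hb, mem_nbrs]
      · rw [ha, mem_nbrs_comm]; exact (hout y hy hyX b hb).2
      · rw [hb]; exact (hout y hy hyX a ha).2
      · exact hind a ha b hb

/-- The number of `(2,3)`-trees of size `u`, times the probability bound `(2 / 2 ^ r) ^ u` for a
single one. -/
lemma card_isTree_mul_lt {r u : ℕ} (hm : 1 ≤ H.m) (hu : 2 ≤ u)
    (h : 16 * (H.maxEdgeDegree : ℝ) ^ 3 < 2 ^ r) (F : Finset (Finset (Fin H.m)))
    (hF : ∀ T ∈ F, H.IsTree u T) :
    (F.card : ℝ) * (2 / 2 ^ r) ^ u < H.m * (1 / 2) ^ u := by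
  classical
  -- Each tree is counted with its root; the number of trees with a given root is estimated by
  -- `sum_pow_card_cutConn_le`, where `z` and `y` are still free.
  have key : ∀ z y : ℝ, 0 ≤ z → 0 ≤ y → z * (1 + y) ^ (H.maxEdgeDegree ^ 3) ≤ y →
      F.card * z ^ u ≤ H.m * y := by
    intro z y hz hy hzy
    have h2 : ∑ T ∈ F, z ^ T.card = F.card * z ^ u := by
      rw [Finset.sum_congr rfl fun T hT => by rw [(hF T hT).1], Finset.sum_const, nsmul_eq_mul]
    rw [← h2]
    calc ∑ T ∈ F, z ^ T.card
        ≤ ∑ T ∈ F, ∑ e : Fin H.m,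
            if CutConn (fun a b => b ∈ H.farNbrs a) {e} T then z ^ T.card else 0 := by
          refine Finset.sum_le_sum fun T hT => ?_
          obtain ⟨-, -, e, he, hc⟩ := hF T hT
          have hnn : ∀ e ∈ Finset.univ, (0 : ℝ) ≤
              if CutConn (fun a b => b ∈ H.farNbrs a) {e} T then z ^ T.card else 0 :=
            fun e _ => by split_ifs <;> positivity
          refine le_trans ?_ (Finset.single_le_sum hnn (Finset.mem_univ e))
          rw [if_pos hc]
      _ = ∑ e : Fin H.m, ∑ T ∈ F.filter fun T => CutConn (fun a b => b ∈ H.farNbrs a) {e} T,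
            z ^ T.card := by
          rw [Finset.sum_comm]
          exact Finset.sum_congr rfl fun e _ => (Finset.sum_filter _ _).symm
      _ ≤ ∑ e : Fin H.m, y := by
          refine Finset.sum_le_sum fun e _ => ?_
          have := sum_pow_card_cutConn_le H.farNbrs _ card_farNbrs_le z y hz hy hzy u {e}
            (F.filter fun T => CutConn (fun a b => b ∈ H.farNbrs a) {e} T) fun T hT => by
              obtain ⟨h1, h2⟩ := Finset.mem_filter.1 hT
              exact ⟨(hF T h1).1.le, h2⟩
          simpa using this
      _ = H.m * y := by simp
  have hm' : (1 : ℝ) ≤ H.m := by exact_mod_cast hm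
  have h2r : (0 : ℝ) < 2 ^ r := by positivity
  rcases Nat.eq_zero_or_pos H.maxEdgeDegree with h0 | h0
  · -- without adjacent edges there are no trees with two elements
    have hF0 : F = ∅ := by
      by_contra hne
      have h3 := key (2 * H.m) (2 * H.m) (by positivity) (by positivity) (by simp [h0])
      have h4 : (1 : ℝ) ≤ F.card := by
        exact_mod_cast Finset.card_pos.2 (Finset.nonempty_iff_ne_empty.2 hne)
      have h5 : (2 * (H.m : ℝ)) ^ 2 ≤ (2 * H.m) ^ u := pow_le_pow_right₀ (by linarith) hu
      nlinarith
    rw [hF0]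
    simp only [Finset.card_empty, Nat.cast_zero, zero_mul]
    positivity
  · set D := H.maxEdgeDegree ^ 3 with hD
    have hDpos : 0 < D := by positivity
    have hD1 : (1 : ℝ) ≤ D := by exact_mod_cast hDpos
    have hDr : (H.maxEdgeDegree : ℝ) ^ 3 = D := by rw [hD]; push_cast; rfl
    have he : (1 + 1 / (D : ℝ)) ^ D ≤ 4 := by
      have h6 : (1 + 1 / (D : ℝ)) ^ D ≤ Real.exp 1 := by
        calc (1 + 1 / (D : ℝ)) ^ D ≤ Real.exp (1 / (D : ℝ)) ^ D := by
              refine pow_le_pow_left₀ (by positivity) ?_ _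
              linarith [Real.add_one_le_exp (1 / (D : ℝ))]
          _ = Real.exp 1 := by
              rw [← Real.exp_nat_mul]; congr 1; field_simp
      linarith [Real.exp_one_lt_d9]
    -- `y = 1 / D` makes `(1 + y) ^ D` bounded
    have h7 := key (1 / (4 * D)) (1 / D) (by positivity) (by positivity) (by
      calc 1 / (4 * (D : ℝ)) * (1 + 1 / (D : ℝ)) ^ D ≤ 1 / (4 * (D : ℝ)) * 4 := by gcongr
        _ = 1 / D := by field_simp)
    have h8 : 2 / (2 : ℝ) ^ r = (1 / (4 * D)) * (8 * D / 2 ^ r) := by field_simp; norm_num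
    have h9 : 8 * (D : ℝ) / 2 ^ r < 1 / 2 := by
      rw [div_lt_iff₀ h2r]; rw [hDr] at h; linarith
    rw [h8, mul_pow, ← mul_assoc]
    calc (F.card : ℝ) * (1 / (4 * D)) ^ u * (8 * D / 2 ^ r) ^ u
        ≤ H.m * (1 / D) * (8 * D / 2 ^ r) ^ u := by gcongr
      _ ≤ H.m * 1 * (8 * D / 2 ^ r) ^ u := by
          have : 1 / (D : ℝ) ≤ 1 := by rw [div_le_one (by positivity)]; exact hD1
          gcongr
      _ < H.m * (1 / 2) ^ u := by
          rw [mul_one]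
          have := pow_lt_pow_left₀ h9 (by positivity) (by omega : u ≠ 0)
          nlinarith

end Hypergraph

/-! ### Expectations of programs -/

section Expect

variable {α β : Type*}

/-- The expected value of `f` under the distribution `p`. -/
noncomputable def expect (p : PMF α) (f : α → ℝ≥0∞) : ℝ≥0∞ := ∑' a, p a * f a

lemma expect_pure (a : α) (f : α → ℝ≥0∞) : expect (PMF.pure a) f = f a := by
  classical
  rw [expect, tsum_eq_single a fun b hb => by rw [PMF.pure_apply, if_neg hb, zero_mul]]
  simp

lemma expect_bind (p : PMF α) (q : α → PMF β) (f : β → ℝ≥0∞) :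
    expect (p.bind q) f = expect p fun a => expect (q a) f := by
  simp only [expect, PMF.bind_apply, ← ENNReal.tsum_mul_right, ← ENNReal.tsum_mul_left]
  rw [ENNReal.tsum_comm]
  simp only [mul_assoc]

lemma expect_map (p : PMF α) (g : α → β) (f : β → ℝ≥0∞) :
    expect (p.map g) f = expect p (f ∘ g) := by
  rw [PMF.map, expect_bind]
  simp only [Function.comp, expect_pure]
  rfl

lemma expect_coin (f : Bool → ℝ≥0∞) :
    expect (PMF.uniformOfFintype Bool) f = (f true + f false) / 2 := by
  rw [expect, tsum_bool]
  simp only [PMF.uniformOfFintype_apply, Fintype.card_bool, Nat.cast_ofNat]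
  rw [← mul_add, mul_comm, ENNReal.div_eq_inv_mul, mul_comm, add_comm]

lemma expect_mono {p : PMF α} {f g : α → ℝ≥0∞} (h : ∀ a ∈ p.support, f a ≤ g a) :
    expect p f ≤ expect p g := by
  refine ENNReal.tsum_le_tsum fun a => ?_
  by_cases ha : a ∈ p.support
  · gcongr; exact h a ha
  · rw [(PMF.apply_eq_zero_iff p a).2 ha]; simp

open Classical in
lemma toOuterMeasure_eq_expect (p : PMF α) (s : Set α) :
    p.toOuterMeasure s = expect p fun a => if a ∈ s then 1 else 0 := by
  rw [PMF.toOuterMeasure_apply, expect]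
  refine tsum_congr fun a => ?_
  simp [Set.indicator_apply]

end Expect

namespace Prog

variable {α β : Type} (H : Hypergraph)

/-- The expected value of `Q` after a successful execution and of `r` after a failure. -/
noncomputable def ev : Prog α → (α → Mem → ℝ≥0∞) → (Mem → ℝ≥0∞) → Mem → ℝ≥0∞
  | ret a, Q, _, μ => Q a μ
  | fail, _, r, μ => r μ
  | degree v next, Q, r, μ => (next (H.incidentList v).length).ev Q r μ
  | incident v i next, Q, r, μ => (next ((H.incidentList v).getD i 0)).ev Q r μ
  | member e j next, Q, r, μ => (next ((H.memberList e).getD j 0)).ev Q r μ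
  | load c i next, Q, r, μ => (next (μ.cell c i)).ev Q r μ
  | store c i x next, Q, r, μ => next.ev Q r (μ.write c i x)
  | coin next, Q, r, μ => ((next true).ev Q r μ + (next false).ev Q r μ) / 2

/-- Whatever the coin tosses are, `Q` holds after a successful execution and `R` after a
failure. -/
def wp : Prog α → (α → Mem → Prop) → (Mem → Prop) → Mem → Prop
  | ret a, Q, _, μ => Q a μ
  | fail, _, R, μ => R μ
  | degree v next, Q, R, μ => (next (H.incidentList v).length).wp Q R μ
  | incident v i next, Q, R, μ => (next ((H.incidentList v).getD i 0)).wp Q R μ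
  | member e j next, Q, R, μ => (next ((H.memberList e).getD j 0)).wp Q R μ
  | load c i next, Q, R, μ => (next (μ.cell c i)).wp Q R μ
  | store c i x next, Q, R, μ => next.wp Q R (μ.write c i x)
  | coin next, Q, R, μ => ∀ b, (next b).wp Q R μ

/-- The execution does not toss coins; it ends successfully with the value `a` and the memory
`μ'`. -/
def Det : Prog α → Mem → α → Mem → Prop
  | ret b, μ, a, μ' => b = a ∧ μ = μ'
  | fail, _, _, _ => False
  | degree v next, μ, a, μ' => (next (H.incidentList v).length).Det μ a μ'
  | incident v i next, μ, a, μ' => (next ((H.incidentList v).getD i 0)).Det μ a μ'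
  | member e j next, μ, a, μ' => (next ((H.memberList e).getD j 0)).Det μ a μ'
  | load c i next, μ, a, μ' => (next (μ.cell c i)).Det μ a μ'
  | store c i x next, μ, a, μ' => next.Det (μ.write c i x) a μ'
  | coin _, _, _, _ => False

@[simp] lemma bind_def (p : Prog α) (g : α → Prog β) : p >>= g = p.bind g := rfl

variable {H}

lemma expect_exec (p : Prog α) (Q : α → Mem → ℝ≥0∞) (r : Mem → ℝ≥0∞) (μ : Mem) :
    expect (p.exec H μ) (fun x => match x.value with
      | some a => Q a x.mem
      | none => r x.mem) = p.ev H Q r μ := by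
  have hc : ∀ μ : Mem, ((fun x : Result α => match x.value with
      | some a => Q a x.mem
      | none => r x.mem) ∘ Result.charge μ) = fun x => match x.value with
      | some a => Q a x.mem
      | none => r x.mem := fun _ => rfl
  induction p generalizing μ with
  | ret a => simp only [exec, expect_pure, ev]
  | fail => simp only [exec, expect_pure, ev]
  | degree v next ih => rw [exec, expect_map, hc, ih, ev]
  | incident v i next ih => rw [exec, expect_map, hc, ih, ev]
  | member e j next ih => rw [exec, expect_map, hc, ih, ev]
  | load c i next ih => rw [exec, expect_map, hc, ih, ev]
  | store c i x next ih => rw [exec, expect_map, hc, ih, ev]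
  | coin next ih =>
    rw [exec, expect_bind, expect_coin, expect_map, expect_map, hc, ih, ih, ev]

lemma ev_bind (p : Prog α) (g : α → Prog β) (Q : β → Mem → ℝ≥0∞) (r : Mem → ℝ≥0∞) (μ : Mem) :
    (p.bind g).ev H Q r μ = p.ev H (fun a μ' => (g a).ev H Q r μ') r μ := by
  induction p generalizing μ with
  | ret a => rfl
  | fail => rfl
  | degree v next ih => exact ih _ _
  | incident v i next ih => exact ih _ _
  | member e j next ih => exact ih _ _
  | load c i next ih => exact ih _ _
  | store c i x next ih => exact ih _
  | coin next ih => simp only [bind, ev, ih]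

lemma wp_bind (p : Prog α) (g : α → Prog β) (Q : β → Mem → Prop) (R : Mem → Prop) (μ : Mem) :
    (p.bind g).wp H Q R μ ↔ p.wp H (fun a μ' => (g a).wp H Q R μ') R μ := by
  induction p generalizing μ with
  | ret a => rfl
  | fail => rfl
  | degree v next ih => exact ih _ _
  | incident v i next ih => exact ih _ _
  | member e j next ih => exact ih _ _
  | load c i next ih => exact ih _ _
  | store c i x next ih => exact ih _
  | coin next ih => exact forall_congr' fun b => ih _ _

lemma wp_mono {p : Prog α} {Q Q' : α → Mem → Prop} {R R' : Mem → Prop} {μ : Mem}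
    (h : p.wp H Q R μ) (hQ : ∀ a μ', Q a μ' → Q' a μ') (hR : ∀ μ', R μ' → R' μ') :
    p.wp H Q' R' μ := by
  induction p generalizing μ with
  | ret a => exact hQ _ _ h
  | fail => exact hR _ h
  | degree v next ih => exact ih _ h
  | incident v i next ih => exact ih _ h
  | member e j next ih => exact ih _ h
  | load c i next ih => exact ih _ h
  | store c i x next ih => exact ih h
  | coin next ih => exact fun b => ih _ (h b)

lemma wp_post {p : Prog α} {Q Q' : α → Mem → Prop} {R : Mem → Prop} {μ : Mem}
    (h : p.wp H Q R μ) (hQ : ∀ a μ', Q a μ' → Q' a μ') : p.wp H Q' R μ :=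
  wp_mono h hQ fun _ h => h

/-- Expectations are monotone on the outcomes that are possible according to `wp`. -/
lemma ev_le_ev {p : Prog α} {Q : α → Mem → Prop} {R : Mem → Prop} {f g : α → Mem → ℝ≥0∞}
    {r r' : Mem → ℝ≥0∞} {μ : Mem} (h : p.wp H Q R μ)
    (hQ : ∀ a μ', Q a μ' → f a μ' ≤ g a μ') (hR : ∀ μ', R μ' → r μ' ≤ r' μ') :
    p.ev H f r μ ≤ p.ev H g r' μ := by
  induction p generalizing μ with
  | ret a => exact hQ _ _ h
  | fail => exact hR _ h
  | degree v next ih => exact ih _ h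
  | incident v i next ih => exact ih _ h
  | member e j next ih => exact ih _ h
  | load c i next ih => exact ih _ h
  | store c i x next ih => exact ih h
  | coin next ih =>
    exact ENNReal.div_le_div_right (add_le_add (ih _ (h _)) (ih _ (h _))) _

lemma wp_true (p : Prog α) (μ : Mem) : p.wp H (fun _ _ => True) (fun _ => True) μ := by
  induction p generalizing μ with
  | ret a => trivial
  | fail => trivial
  | degree v next ih => exact ih _ _
  | incident v i next ih => exact ih _ _
  | member e j next ih => exact ih _ _
  | load c i next ih => exact ih _ _
  | store c i x next ih => exact ih _
  | coin next ih => exact fun b => ih _ _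

lemma ev_mono {p : Prog α} {f g : α → Mem → ℝ≥0∞} {r r' : Mem → ℝ≥0∞} {μ : Mem}
    (hQ : ∀ a μ', f a μ' ≤ g a μ') (hR : ∀ μ', r μ' ≤ r' μ') :
    p.ev H f r μ ≤ p.ev H g r' μ :=
  ev_le_ev (p.wp_true μ) (fun a μ' _ => hQ a μ') fun μ' _ => hR μ'

lemma ev_add_const_le (p : Prog α) (f : α → Mem → ℝ≥0∞) (r : Mem → ℝ≥0∞) (c : ℝ≥0∞) (μ : Mem) :
    p.ev H (fun a μ' => f a μ' + c) (fun μ' => r μ' + c) μ = p.ev H f r μ + c := by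
  induction p generalizing μ with
  | ret a => rfl
  | fail => rfl
  | degree v next ih => exact ih _ _
  | incident v i next ih => exact ih _ _
  | member e j next ih => exact ih _ _
  | load c i next ih => exact ih _ _
  | store c i x next ih => exact ih _
  | coin next ih =>
    simp only [ev, ih]
    rw [add_add_add_comm, ENNReal.add_div, ENNReal.add_div (a := c), ENNReal.add_halves]

lemma ev_mul_const (p : Prog α) (f : α → Mem → ℝ≥0∞) (r : Mem → ℝ≥0∞) (c : ℝ≥0∞) (μ : Mem) :
    p.ev H (fun a μ' => c * f a μ') (fun μ' => c * r μ') μ = c * p.ev H f r μ := by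
  induction p generalizing μ with
  | ret a => rfl
  | fail => rfl
  | degree v next ih => exact ih _ _
  | incident v i next ih => exact ih _ _
  | member e j next ih => exact ih _ _
  | load c i next ih => exact ih _ _
  | store c i x next ih => exact ih _
  | coin next ih => simp only [ev, ih]; rw [← mul_add, mul_div_assoc]

/-! ### Deterministic executions -/

lemma Det.bind {p : Prog α} {g : α → Prog β} {μ μ' μ'' : Mem} {a : α} {b : β}
    (h : p.Det H μ a μ') (h' : (g a).Det H μ' b μ'') : (p.bind g).Det H μ b μ'' := by
  induction p generalizing μ with
  | ret x => obtain ⟨rfl, rfl⟩ := h; exact h'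
  | fail => exact h.elim
  | degree v next ih => exact ih _ h
  | incident v i next ih => exact ih _ h
  | member e j next ih => exact ih _ h
  | load c i next ih => exact ih _ h
  | store c i x next ih => exact ih h
  | coin next ih => exact h.elim

lemma Det.ev_eq {p : Prog α} {μ μ' : Mem} {a : α} (h : p.Det H μ a μ') (Q : α → Mem → ℝ≥0∞)
    (r : Mem → ℝ≥0∞) : p.ev H Q r μ = Q a μ' := by
  induction p generalizing μ with
  | ret x => obtain ⟨rfl, rfl⟩ := h; rfl
  | fail => exact h.elim
  | degree v next ih => exact ih _ h
  | incident v i next ih => exact ih _ h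
  | member e j next ih => exact ih _ h
  | load c i next ih => exact ih _ h
  | store c i x next ih => exact ih h
  | coin next ih => exact h.elim

lemma Det.wp_iff {p : Prog α} {μ μ' : Mem} {a : α} (h : p.Det H μ a μ') {Q : α → Mem → Prop}
    {R : Mem → Prop} : p.wp H Q R μ ↔ Q a μ' := by
  induction p generalizing μ with
  | ret x => obtain ⟨rfl, rfl⟩ := h; rfl
  | fail => exact h.elim
  | degree v next ih => exact ih _ h
  | incident v i next ih => exact ih _ h
  | member e j next ih => exact ih _ h
  | load c i next ih => exact ih _ h
  | store c i x next ih => exact ih h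
  | coin next ih => exact h.elim

lemma Det.wp_bind {p : Prog α} {g : α → Prog β} {μ μ' : Mem} {a : α} (h : p.Det H μ a μ')
    {Q : β → Mem → Prop} {R : Mem → Prop} :
    (p.bind g).wp H Q R μ ↔ (g a).wp H Q R μ' := by
  rw [Prog.wp_bind, h.wp_iff]

lemma Det.ev_bind {p : Prog α} {g : α → Prog β} {μ μ' : Mem} {a : α} (h : p.Det H μ a μ')
    (Q : β → Mem → ℝ≥0∞) (r : Mem → ℝ≥0∞) :
    (p.bind g).ev H Q r μ = (g a).ev H Q r μ' := by
  rw [Prog.ev_bind, h.ev_eq]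

end Prog

/-! ### The input tape -/

namespace Hypergraph

variable (H : Hypergraph)

/-- The edges containing `v`. -/
def edgesAt (v : Fin H.n) : Finset (Fin H.m) := Finset.univ.filter fun e => v ∈ H.edge e

variable {H}

lemma mem_edgesAt {v : Fin H.n} {e : Fin H.m} : e ∈ H.edgesAt v ↔ v ∈ H.edge e := by
  simp [edgesAt]

lemma inc_iff {v : Fin H.n} {e : Fin H.m} : H.Inc v e ↔ v ∈ H.edge e := by
  constructor
  · rintro ⟨v', e', hv, he, h⟩
    rwa [Fin.ext hv, Fin.ext he] at h
  · exact fun h => ⟨v, e, rfl, rfl, h⟩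

/-- The list of edges on the input tape, as a list without repetitions of the edges at `v`. -/
lemma exists_incidentList (v : Fin H.n) : ∃ l : List (Fin H.m),
    l.Nodup ∧ l.toFinset = H.edgesAt v ∧ H.incidentList v = l.map Fin.val := by
  refine ⟨(List.finRange H.m).filter fun e => v ∈ H.edge e,
    (List.nodup_finRange _).filter _, ?_, ?_⟩
  · ext e; simp [mem_edgesAt]
  · rw [incidentList, ← List.map_coe_finRange_eq_range, List.filter_map]
    congr 1
    refine List.filter_congr fun e _ => ?_
    simp [inc_iff]

lemma exists_memberList (e : Fin H.m) : ∃ l : List (Fin H.n),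
    l.Nodup ∧ l.toFinset = H.edge e ∧ H.memberList e = l.map Fin.val := by
  refine ⟨(List.finRange H.n).filter fun v => v ∈ H.edge e,
    (List.nodup_finRange _).filter _, ?_, ?_⟩
  · ext e; simp
  · rw [memberList, ← List.map_coe_finRange_eq_range, List.filter_map]
    congr 1
    refine List.filter_congr fun e _ => ?_
    simp [inc_iff]

lemma incidentList_of_le {v : ℕ} (h : H.n ≤ v) : H.incidentList v = [] := by
  rw [incidentList, List.filter_eq_nil_iff]
  intro e _
  simp only [decide_eq_true_eq]
  rintro ⟨v', -, hv, -⟩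
  have := v'.2
  omega

lemma card_edgesAt_le (v : Fin H.n) : (H.edgesAt v).card ≤ H.maxEdgeDegree + 1 := by
  rcases (H.edgesAt v).eq_empty_or_nonempty with h | ⟨e, he⟩
  · simp [h]
  · have hsub : H.edgesAt v ⊆ insert e (H.nbrs e) := fun f hf => by
      rw [Finset.mem_insert, mem_nbrs, or_iff_not_imp_left]
      refine fun hne => ⟨hne, Finset.not_disjoint_iff.2 ⟨v, ?_, ?_⟩⟩
      · exact mem_edgesAt.1 he
      · exact mem_edgesAt.1 hf
    refine (Finset.card_le_card hsub).trans ((Finset.card_insert_le _ _).trans ?_)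
    exact Nat.succ_le_succ (card_nbrs_le e)

lemma length_incidentList_le (v : ℕ) : (H.incidentList v).length ≤ H.maxEdgeDegree + 1 := by
  by_cases h : v < H.n
  · obtain ⟨l, hl, hs, he⟩ := exists_incidentList (⟨v, h⟩ : Fin H.n)
    rw [show v = (⟨v, h⟩ : Fin H.n).val from rfl, he, List.length_map,
      ← List.toFinset_card_of_nodup hl, hs]
    exact card_edgesAt_le _
  · rw [incidentList_of_le (not_lt.1 h)]; simp

end Hypergraph

/-! ### The potential of a witness structure -/

namespace Hypergraph

variable {H : Hypergraph}

/-- The edge `e` contains accepted vertices of both colors. -/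
def Safe (s : Fin H.n → VStatus) (e : Fin H.m) : Prop :=
  (H.acceptedIn s e true).Nonempty ∧ (H.acceptedIn s e false).Nonempty

/-- The number of accepted vertices of `e`. -/
def numAcc (s : Fin H.n → VStatus) (e : Fin H.m) : ℕ :=
  (H.acceptedIn s e true).card + (H.acceptedIn s e false).card

lemma isBad_iff {r : ℕ} {s : Fin H.n → VStatus} {e : Fin H.m} :
    H.IsBad r s e ↔ r ≤ numAcc s e ∧ ¬ Safe s e := by
  rw [IsBad, numAcc, Safe, not_and_or, Finset.not_nonempty_iff_eq_empty,
    Finset.not_nonempty_iff_eq_empty]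

lemma acceptedIn_congr {s s' : Fin H.n → VStatus} {e : Fin H.m} (b : Bool)
    (h : ∀ v ∈ H.edge e, s v = .accepted b ↔ s' v = .accepted b) :
    H.acceptedIn s e b = H.acceptedIn s' e b :=
  Finset.filter_congr h

lemma mem_acceptedIn {s : Fin H.n → VStatus} {e : Fin H.m} {b : Bool} {v : Fin H.n} :
    v ∈ H.acceptedIn s e b ↔ v ∈ H.edge e ∧ s v = .accepted b := Finset.mem_filter

lemma acceptedIn_update_troubled {s : Fin H.n → VStatus} {v : Fin H.n} (hv : s v = .uncolored)
    (e : Fin H.m) (b : Bool) :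
    H.acceptedIn (Function.update s v .troubled) e b = H.acceptedIn s e b := by
  refine acceptedIn_congr b fun w _ => ?_
  rcases eq_or_ne w v with rfl | h
  · simp [hv]
  · simp [Function.update_of_ne h]

lemma acceptedIn_update_accepted {s : Fin H.n → VStatus} {v : Fin H.n} (hv : s v = .uncolored)
    (e : Fin H.m) (b c : Bool) :
    H.acceptedIn (Function.update s v (.accepted c)) e b =
      if v ∈ H.edge e ∧ c = b then insert v (H.acceptedIn s e b) else H.acceptedIn s e b := by
  ext w
  split_ifs with h
  · rcases eq_or_ne w v with rfl | hw
    · simp [mem_acceptedIn, h]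
    · simp [mem_acceptedIn, hw]
  · rcases eq_or_ne w v with rfl | hw
    · simp only [mem_acceptedIn, Function.update_self, VStatus.accepted.injEq, hv, h]
      simp
    · simp [mem_acceptedIn, Function.update_of_ne hw]

open Classical in
/-- An upper bound for the conditional probability that `e` becomes bad: a safe edge never does,
and otherwise each of the missing accepted vertices (but for the very first one) has to receive
the same color as its predecessors. -/
noncomputable def edgePot (r : ℕ) (s : Fin H.n → VStatus) (e : Fin H.m) : ℝ≥0∞ :=
  if Safe s e then 0 else min 1 (2 ^ max (numAcc s e) 1 / 2 ^ r)

lemma edgePot_congr {r : ℕ} {s s' : Fin H.n → VStatus} {e : Fin H.m}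
    (h : ∀ b, H.acceptedIn s e b = H.acceptedIn s' e b) : edgePot r s e = edgePot r s' e := by
  have hn : numAcc s e = numAcc s' e := by simp only [numAcc, h]
  have hs : Safe s e = Safe s' e := by simp only [Safe, h]
  by_cases hc : Safe s e
  · rw [edgePot, edgePot, if_pos hc, if_pos (hs ▸ hc)]
  · rw [edgePot, edgePot, if_neg hc, if_neg (hs ▸ hc), hn]

lemma two_pow_div_two_pow_le_one {i j : ℕ} (h : i ≤ j) : (2 : ℝ≥0∞) ^ i / 2 ^ j ≤ 1 := by
  rw [ENNReal.div_le_iff (by simp) (by simp), one_mul]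
  exact pow_le_pow_right₀ (by norm_num) h

lemma edgePot_of_isBad {r : ℕ} {s : Fin H.n → VStatus} {e : Fin H.m} (h : H.IsBad r s e) :
    edgePot r s e = 1 := by
  rw [isBad_iff] at h
  rw [edgePot, if_neg h.2, min_eq_left]
  rw [ENNReal.le_div_iff_mul_le (by simp) (by simp), one_mul]
  exact pow_le_pow_right₀ (by norm_num) (h.1.trans (le_max_left _ _))

lemma edgePot_le_of_numAcc_eq_zero {r : ℕ} {s : Fin H.n → VStatus} {e : Fin H.m}
    (h : numAcc s e = 0) : edgePot r s e ≤ 2 / 2 ^ r := by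
  rw [edgePot]
  split_ifs
  · exact zero_le
  · rw [h]; simp

/-- Accepting a vertex of a nonsafe edge that has accepted vertices already doubles its potential for
one color, and makes the edge safe for the other one. -/
lemma edgePot_step {r : ℕ} {s : Fin H.n → VStatus} {v : Fin H.n} (hv : s v = .uncolored)
    (e : Fin H.m) (hbad : v ∈ H.edge e → ¬ H.IsBad r s e) :
    (edgePot r (Function.update s v (.accepted true)) e +
      edgePot r (Function.update s v (.accepted false)) e) / 2 ≤ edgePot r s e := by
  classical
  by_cases hve : v ∈ H.edge e
  swap
  · have h : ∀ c, edgePot r (Function.update s v (.accepted c)) e = edgePot r s e := fun c =>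
      edgePot_congr fun b => by rw [acceptedIn_update_accepted hv, if_neg (by tauto)]
    rw [h, h, ENNReal.add_div, ENNReal.add_halves]
  specialize hbad hve
  rw [isBad_iff, not_and_not_right] at hbad
  have hvA : ∀ b, v ∉ H.acceptedIn s e b := fun b hb => by
    simp [mem_acceptedIn, hv] at hb
  have hself : ∀ c, H.acceptedIn (Function.update s v (.accepted c)) e c =
      insert v (H.acceptedIn s e c) := fun c => by
    rw [acceptedIn_update_accepted hv, if_pos ⟨hve, rfl⟩]
  have hother : ∀ c b, c ≠ b → H.acceptedIn (Function.update s v (.accepted c)) e b =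
      H.acceptedIn s e b := fun c b hcb => by
    rw [acceptedIn_update_accepted hv, if_neg (by tauto)]
  by_cases hsafe : Safe s e
  · have h : ∀ c, edgePot r (Function.update s v (.accepted c)) e = 0 := fun c => by
      rw [edgePot, if_pos]
      have hb : ∀ b, (H.acceptedIn s e b).Nonempty := fun b => by
        cases b
        · exact hsafe.2
        · exact hsafe.1
      have : ∀ b, (H.acceptedIn (Function.update s v (.accepted c)) e b).Nonempty := fun b => by
        rw [acceptedIn_update_accepted hv]
        split_ifs
        · exact Finset.insert_nonempty _ _
        · exact hb b
      exact ⟨this _, this _⟩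
    rw [h, h]; simp
  · have hlt : numAcc s e < r := by
      by_contra hc
      exact hsafe (hbad (not_lt.1 hc))
    have hnum : ∀ c, numAcc (Function.update s v (.accepted c)) e = numAcc s e + 1 := fun c => by
      cases c
      · rw [numAcc, hself, hother _ _ (by decide), Finset.card_insert_of_notMem (hvA _), numAcc]
        omega
      · rw [numAcc, hself, hother _ _ (by decide), Finset.card_insert_of_notMem (hvA _), numAcc]
        omega
    have hs : edgePot r s e = 2 ^ max (numAcc s e) 1 / 2 ^ r := by
      rw [edgePot, if_neg hsafe, min_eq_right]
      exact two_pow_div_two_pow_le_one (by omega)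
    have hle : ∀ c, edgePot r (Function.update s v (.accepted c)) e ≤
        2 ^ (numAcc s e + 1) / 2 ^ r := fun c => by
      rw [edgePot]
      split_ifs
      · exact zero_le
      · rw [hnum, max_eq_left (by omega)]
        exact min_le_right _ _
    rcases Nat.eq_zero_or_pos (numAcc s e) with h0 | h0
    · rw [hs, h0]
      rw [h0] at hle
      calc _ ≤ ((2 : ℝ≥0∞) ^ (0 + 1) / 2 ^ r + 2 ^ (0 + 1) / 2 ^ r) / 2 :=
            ENNReal.div_le_div_right (add_le_add (hle _) (hle _)) _
        _ = 2 ^ max 0 1 / 2 ^ r := by rw [ENNReal.add_div, ENNReal.add_halves]; simp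
    · -- one of the two colors makes the edge safe
      have hzero : ∃ c, edgePot r (Function.update s v (.accepted c)) e = 0 := by
        have hne : ∃ c, (H.acceptedIn s e c).Nonempty := by
          by_contra hc
          push Not at hc
          rw [numAcc, hc, hc] at h0
          simp at h0
        obtain ⟨c, hc⟩ := hne
        refine ⟨!c, ?_⟩
        rw [edgePot, if_pos]
        have h1 : (H.acceptedIn (Function.update s v (.accepted !c)) e c).Nonempty := by
          rw [hother _ _ (by cases c <;> decide)]; exact hc
        have h2 : (H.acceptedIn (Function.update s v (.accepted !c)) e !c).Nonempty := by
          rw [hself]; exact Finset.insert_nonempty _ _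
        cases c
        · exact ⟨h2, h1⟩
        · exact ⟨h1, h2⟩
      have hfin : (2 : ℝ≥0∞) ^ (numAcc s e + 1) / 2 ^ r / 2 = 2 ^ max (numAcc s e) 1 / 2 ^ r := by
        rw [max_eq_left (by omega), pow_succ, mul_comm, mul_div_assoc, mul_comm,
          ENNReal.mul_div_cancel_right (by simp) (by simp)]
      rw [hs, ← hfin]
      refine ENNReal.div_le_div_right ?_ _
      obtain ⟨c, hc⟩ := hzero
      cases c
      · rw [hc, add_zero]; exact hle _
      · rw [hc, zero_add]; exact hle _

/-- The product of the potentials of the edges of `T`. -/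
noncomputable def pot (r : ℕ) (T : Finset (Fin H.m)) (s : Fin H.n → VStatus) : ℝ≥0∞ :=
  ∏ e ∈ T, edgePot r s e

lemma pot_update_troubled {r : ℕ} (T : Finset (Fin H.m)) {s : Fin H.n → VStatus} {v : Fin H.n}
    (hv : s v = .uncolored) : pot r T (Function.update s v .troubled) = pot r T s :=
  Finset.prod_congr rfl fun e _ => edgePot_congr fun b => acceptedIn_update_troubled hv e b

/-- As the edges of `T` are pairwise disjoint, accepting `v` changes at most one of the factors. -/
lemma pot_step {r : ℕ} {T : Finset (Fin H.m)} (hT : ∀ e ∈ T, ∀ f ∈ T, f ∉ H.nbrs e)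
    {s : Fin H.n → VStatus} {v : Fin H.n} (hv : s v = .uncolored)
    (hbad : ∀ e, v ∈ H.edge e → ¬ H.IsBad r s e) :
    (pot r T (Function.update s v (.accepted true)) +
      pot r T (Function.update s v (.accepted false))) / 2 ≤ pot r T s := by
  classical
  have hout : ∀ e, v ∉ H.edge e → ∀ c,
      edgePot r (Function.update s v (.accepted c)) e = edgePot r s e := fun e he c =>
    edgePot_congr fun b => by rw [acceptedIn_update_accepted hv, if_neg (by tauto)]
  by_cases h : ∃ e ∈ T, v ∈ H.edge e
  · -- the edges of `T` are disjoint, so that only one factor changes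
    obtain ⟨e, he, hve⟩ := h
    have hrest : ∀ c, ∏ f ∈ T.erase e, edgePot r (Function.update s v (.accepted c)) f =
        ∏ f ∈ T.erase e, edgePot r s f := fun c => by
      refine Finset.prod_congr rfl fun f hf => hout f (fun hvf => ?_) c
      obtain ⟨hne, hfT⟩ := Finset.mem_erase.1 hf
      exact hT e he f hfT (mem_nbrs.2 ⟨hne, Finset.not_disjoint_iff.2 ⟨v, hve, hvf⟩⟩)
    simp only [pot]
    rw [← Finset.mul_prod_erase T _ he, ← Finset.mul_prod_erase T _ he,
      ← Finset.mul_prod_erase T _ he, hrest, hrest, ← add_mul, mul_comm, mul_div_assoc, mul_comm]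
    gcongr
    exact edgePot_step hv e (hbad e)
  · push Not at h
    have : ∀ c, pot r T (Function.update s v (.accepted c)) = pot r T s := fun c =>
      Finset.prod_congr rfl fun e he => hout e (h e he) c
    rw [this, this, ENNReal.add_div, ENNReal.add_halves]

open Classical in
/-- The sum of the potentials of all `(2,3)`-trees of size `u`. -/
noncomputable def treePot (r u : ℕ) (s : Fin H.n → VStatus) : ℝ≥0∞ :=
  ∑ T ∈ Finset.univ.filter fun T => H.IsTree u T, pot r T s

lemma treePot_update_troubled {r u : ℕ} {s : Fin H.n → VStatus} {v : Fin H.n}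
    (hv : s v = .uncolored) : treePot r u (Function.update s v .troubled) = treePot r u s :=
  Finset.sum_congr rfl fun _ _ => pot_update_troubled _ hv

/-- The sum of the potentials does not increase on average when a vertex outside of bad edges is
accepted. -/
lemma treePot_step {r u : ℕ} {s : Fin H.n → VStatus} {v : Fin H.n} (hv : s v = .uncolored)
    (hbad : ∀ e, v ∈ H.edge e → ¬ H.IsBad r s e) :
    (treePot r u (Function.update s v (.accepted true)) +
      treePot r u (Function.update s v (.accepted false))) / 2 ≤ treePot r u s := by
  classical
  simp only [treePot]
  rw [← Finset.sum_add_distrib, ENNReal.div_eq_inv_mul, Finset.mul_sum]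
  refine Finset.sum_le_sum fun T hT => ?_
  rw [← ENNReal.div_eq_inv_mul]
  exact pot_step (Finset.mem_filter.1 hT).2.2.1 hv hbad

/-- A single satisfied witness structure contributes one to the sum. -/
lemma one_le_treePot {r u : ℕ} {s : Fin H.n → VStatus} {T : Finset (Fin H.m)}
    (hT : H.IsTree u T) (hbad : ∀ e ∈ T, H.IsBad r s e) : 1 ≤ treePot r u s := by
  classical
  have h : pot r T s = 1 := Finset.prod_eq_one fun e he => edgePot_of_isBad (hbad e he)
  rw [← h]
  exact Finset.single_le_sum (f := fun T => pot r T s) (fun _ _ => zero_le)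
    (Finset.mem_filter.2 ⟨Finset.mem_univ _, hT⟩)

lemma treePot_initial_lt {r u : ℕ} (hm : 1 ≤ H.m) (hu : 2 ≤ u)
    (h : 16 * (H.maxEdgeDegree : ℝ) ^ 3 < 2 ^ r) :
    treePot (H := H) r u (fun _ => .uncolored) < ENNReal.ofReal (H.m * (1 / 2) ^ u) := by
  classical
  have h1 := card_isTree_mul_lt hm hu h (Finset.univ.filter fun T => H.IsTree u T)
    fun T hT => (Finset.mem_filter.1 hT).2
  have h2 : ∀ T : Finset (Fin H.m), H.IsTree u T →
      pot (H := H) r T (fun _ => .uncolored) ≤ ENNReal.ofReal ((2 / 2 ^ r) ^ u) := fun T hT => by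
    rw [ENNReal.ofReal_pow (by positivity), ENNReal.ofReal_div_of_pos (by positivity),
      ENNReal.ofReal_pow (by norm_num), ENNReal.ofReal_ofNat, ← hT.1, pot]
    refine Finset.prod_le_pow_card _ _ _ fun e _ => edgePot_le_of_numAcc_eq_zero ?_
    simp [numAcc, acceptedIn]
  refine lt_of_le_of_lt ?_ ((ENNReal.ofReal_lt_ofReal_iff (by positivity)).2 h1)
  rw [ENNReal.ofReal_mul (by positivity), ENNReal.ofReal_natCast, ← nsmul_eq_mul]
  exact Finset.sum_le_card_nsmul _ _ _ fun T hT => h2 T (Finset.mem_filter.1 hT).2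

/-! ### Witness structures of the global shattering phase -/

lemma expect_shatter_le (r u : ℕ) (σ : H.OnlineOrder) (fuel : ℕ) (s : Fin H.n → VStatus) :
    expect (H.shatter r σ fuel s) (treePot r u) ≤ treePot r u s := by
  induction fuel generalizing s with
  | zero => rw [shatter, expect_pure]
  | succ fuel ih =>
    rw [shatter]
    split_ifs with h
    · have hv := (σ s h).2
      dsimp only
      split_ifs with hb
      · exact (ih _).trans (treePot_update_troubled hv).le
      · rw [expect_bind, expect_coin]
        refine le_trans (ENNReal.div_le_div_right (add_le_add (ih _) (ih _)) _)
          (treePot_step hv fun e he hbad => hb ⟨e, he, hbad⟩)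
    · rw [expect_pure]

/-- The union bound over all witness structures. -/
theorem shattering_hasSatisfiedWitness_lt (r : ℕ) (c : ℝ) (σ : H.OnlineOrder) (hm : 1 ≤ H.m)
    (hc : 0 < c) (h : 16 * (H.maxEdgeDegree : ℝ) ^ 3 < 2 ^ r) :
    (H.shattering r σ).toOuterMeasure
        {st | H.HasSatisfiedWitness r ⌈(c + 1) * Real.logb 2 H.m⌉₊ st} <
      ENNReal.ofReal (1 / (H.m : ℝ) ^ c) := by
  classical
  set u := ⌈(c + 1) * Real.logb 2 H.m⌉₊ with hu
  rcases hm.eq_or_lt with h1 | h1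
  · -- for a single edge `u = 0`, but witness structures are nonempty
    have hu0 : u = 0 := by rw [hu, ← h1]; simp
    have : {st | H.HasSatisfiedWitness r u st} = ∅ := by
      rw [Set.eq_empty_iff_forall_notMem]
      rintro st ⟨T, hT, hcard, -⟩
      obtain ⟨-, -, e, he, -⟩ := hT.isTree
      rw [hu0, Finset.card_eq_zero] at hcard
      simp [hcard] at he
    rw [this, MeasureTheory.measure_empty, ← h1]
    simp
  · have hm2 : (2 : ℝ) ≤ H.m := by exact_mod_cast h1
    have hlog : 1 ≤ Real.logb 2 H.m := by
      rw [Real.le_logb_iff_rpow_le (by norm_num) (by linarith)]; simpa using hm2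
    have hu1 : (c + 1) * Real.logb 2 H.m ≤ u := Nat.le_ceil _
    have hu2 : 2 ≤ u := by
      have : (1 : ℝ) < u := by nlinarith
      exact_mod_cast this
    have hfin : (H.m : ℝ) * (1 / 2) ^ u ≤ 1 / (H.m : ℝ) ^ c := by
      have hpos : (0 : ℝ) < H.m := by linarith
      have h2 : (H.m : ℝ) ^ (c + 1) ≤ 2 ^ u := by
        rw [← Real.rpow_natCast 2 u]
        calc (H.m : ℝ) ^ (c + 1) = ((2 : ℝ) ^ Real.logb 2 H.m) ^ (c + 1) := by
              rw [Real.rpow_logb (by norm_num) (by norm_num) hpos]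
          _ = 2 ^ ((c + 1) * Real.logb 2 H.m) := by
              rw [← Real.rpow_mul (by norm_num), mul_comm]
          _ ≤ 2 ^ (u : ℝ) := Real.rpow_le_rpow_of_exponent_le (by norm_num) hu1
      rw [Real.rpow_add hpos, Real.rpow_one] at h2
      rw [one_div_pow, le_div_iff₀ (by positivity), mul_one_div, div_mul_eq_mul_div,
        div_le_one (by positivity), mul_comm]
      exact h2
    refine lt_of_le_of_lt ?_ ((treePot_initial_lt hm hu2 h).trans_le
      (ENNReal.ofReal_le_ofReal hfin))
    rw [toOuterMeasure_eq_expect]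
    refine le_trans (expect_mono fun st _ => ?_) (expect_shatter_le r u σ H.n _)
    split_ifs with hst
    · obtain ⟨T, hT, hcard, hbad⟩ := hst
      exact one_le_treePot (hcard ▸ hT.isTree) hbad
    · exact zero_le

end Hypergraph

/-! ### Resampling: the expected number of steps -/

namespace Resampling

set_option linter.unusedSectionVars false

section Average

variable {V : Type*} [Fintype V] [DecidableEq V]

/-- The expected value of `Z` when the colors in `S` are replaced by uniformly random ones. -/
noncomputable def rs (S : Finset V) (Z : (V → Bool) → ℝ≥0∞) (σ : V → Bool) : ℝ≥0∞ :=
  (∑ τ : V → Bool, Z (S.piecewise τ σ)) / 2 ^ Fintype.card V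

lemma card_colorings : ((Fintype.card (V → Bool) : ℕ) : ℝ≥0∞) = 2 ^ Fintype.card V := by
  simp

lemma two_pow_ne {n : ℕ} : (2 : ℝ≥0∞) ^ n ≠ 0 ∧ (2 : ℝ≥0∞) ^ n ≠ ⊤ := by
  constructor <;> simp

lemma rs_const (S : Finset V) (c : ℝ≥0∞) (σ : V → Bool) : rs S (fun _ => c) σ = c := by
  rw [rs, Finset.sum_const, nsmul_eq_mul, Finset.card_univ, card_colorings, mul_comm,
    ENNReal.mul_div_cancel_right two_pow_ne.1 two_pow_ne.2]

lemma rs_congr {S : Finset V} {Z : (V → Bool) → ℝ≥0∞} {σ : V → Bool}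
    (h : ∀ τ, Z (S.piecewise τ σ) = Z σ) : rs S Z σ = Z σ := by
  rw [← rs_const S (Z σ) σ]
  unfold rs
  congr 1
  refine Finset.sum_congr rfl fun τ _ => ?_
  rw [h]

lemma rs_tsum {ι : Type*} (S : Finset V) (Z : ι → (V → Bool) → ℝ≥0∞) (σ : V → Bool) :
    rs S (fun σ => ∑' i, Z i σ) σ = ∑' i, rs S (Z i) σ := by
  simp only [rs, div_eq_mul_inv, ENNReal.tsum_mul_right]
  rw [Summable.tsum_finsetSum fun _ _ => ENNReal.summable]

/-- Two independent colorings may exchange their colors in `S`. -/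
lemma sum_sum_swap (S : Finset V) (F : (V → Bool) → (V → Bool) → ℝ≥0∞) :
    ∑ σ, ∑ τ, F (S.piecewise τ σ) (S.piecewise σ τ) = ∑ σ, ∑ τ, F σ τ := by
  rw [← Fintype.sum_prod_type', ← Fintype.sum_prod_type']
  have hinv : Function.Involutive
      fun x : (V → Bool) × (V → Bool) => (S.piecewise x.2 x.1, S.piecewise x.1 x.2) := by
    rintro ⟨σ, τ⟩
    ext v <;> by_cases h : v ∈ S <;> simp [h]
  exact Fintype.sum_bijective _ hinv.bijective _ _ fun _ => rfl

/-- If `X` depends on the colors in `S` only, and the colors in `S` are renewed afterwards, then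
`X` is independent of the result. -/
lemma sum_mul_rs (S : Finset V) (X F : (V → Bool) → ℝ≥0∞)
    (hX : ∀ σ τ, X (S.piecewise σ τ) = X σ) :
    (∑ τ, X τ * rs S F τ) = rs Finset.univ X (fun _ => false) * ∑ τ, F τ := by
  have h1 : ∑ τ, X τ * rs S F τ =
      (∑ τ, ∑ τ', X (S.piecewise τ τ') * F (S.piecewise τ' τ)) / 2 ^ Fintype.card V := by
    rw [div_eq_mul_inv, Finset.sum_mul]
    refine Finset.sum_congr rfl fun τ _ => ?_
    simp only [hX]
    rw [rs, ← Finset.mul_sum, div_eq_mul_inv, mul_assoc]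
  have h2 := sum_sum_swap S fun σ τ => X τ * F σ
  rw [h1, h2, rs]
  simp only [Finset.piecewise_univ]
  rw [Finset.sum_comm]
  simp only [← Finset.mul_sum, ← Finset.sum_mul]
  simp only [div_eq_mul_inv]
  ring

lemma sum_rs (S : Finset V) (F : (V → Bool) → ℝ≥0∞) : ∑ τ, rs S F τ = ∑ τ, F τ := by
  have := sum_mul_rs S (fun _ => 1) F fun _ _ => rfl
  simpa [rs_const] using this

lemma piecewise_piecewise_union (S S' : Finset V) (τ τ' σ : V → Bool) :
    S'.piecewise τ' (S.piecewise τ σ) = (S ∪ S').piecewise (S'.piecewise τ' τ) σ := by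
  ext v
  by_cases h : v ∈ S <;> by_cases h' : v ∈ S' <;> simp [h, h']

lemma rs_rs (S S' : Finset V) (Z : (V → Bool) → ℝ≥0∞) (σ : V → Bool) :
    rs S (rs S' Z) σ = rs (S ∪ S') Z σ := by
  rw [rs, rs, ← sum_rs S' fun τ => Z ((S ∪ S').piecewise τ σ)]
  congr 1
  refine Finset.sum_congr rfl fun τ _ => ?_
  rw [rs, rs]
  simp only [piecewise_piecewise_union]

lemma rs_insert (S : Finset V) (v : V) (Z : (V → Bool) → ℝ≥0∞) (σ : V → Bool) :
    rs (insert v S) Z σ =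
      (rs S Z (Function.update σ v true) + rs S Z (Function.update σ v false)) / 2 := by
  rw [Finset.insert_eq, ← rs_rs, rs]
  have h1 : ∀ τ : V → Bool, ({v} : Finset V).piecewise τ σ = Function.update σ v (τ v) :=
    fun τ => by rw [Finset.piecewise_singleton]
  simp only [h1]
  have h2 : ∀ F : Bool → ℝ≥0∞,
      (∑ τ : V → Bool, F (τ v)) / 2 ^ Fintype.card V = (F true + F false) / 2 := fun F => by
    have hcard : ∀ b, (Finset.univ.filter fun τ : V → Bool => τ v = b).card * 2 =
        2 ^ Fintype.card V := fun b => by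
      have hb : (Finset.univ.filter fun τ : V → Bool => τ v = b).card =
          (Finset.univ.filter fun τ : V → Bool => τ v = !b).card := by
        refine Finset.card_bij' (fun τ _ => Function.update τ v !b)
          (fun τ _ => Function.update τ v b) ?_ ?_ ?_ ?_
        · intro τ hτ; simp
        · intro τ hτ; simp
        · intro τ hτ
          rw [← (Finset.mem_filter.1 hτ).2]; simp
        · intro τ hτ
          simp only [Finset.mem_filter, Finset.mem_univ, true_and] at hτ
          rw [Function.update_idem, ← hτ, Function.update_eq_self]
      have hsum := Finset.card_filter_add_card_filter_not (s := (Finset.univ : Finset (V → Bool)))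
        (fun τ => τ v = b)
      rw [Finset.card_univ, Fintype.card_fun, Fintype.card_bool] at hsum
      have hnot : (Finset.univ.filter fun τ : V → Bool => ¬ τ v = b) =
          Finset.univ.filter fun τ : V → Bool => τ v = !b := by
        refine Finset.filter_congr fun τ _ => ?_
        cases τ v <;> cases b <;> simp
      rw [hnot, ← hb] at hsum
      omega
    rw [← Finset.sum_fiberwise (s := Finset.univ) (g := fun τ : V → Bool => τ v), Fintype.sum_bool]
    have h3 : ∀ b, ∑ τ ∈ Finset.univ.filter (fun τ : V → Bool => τ v = b), F (τ v) =
        F b / 2 * 2 ^ Fintype.card V := fun b => by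
      rw [Finset.sum_congr rfl fun τ hτ => by rw [(Finset.mem_filter.1 hτ).2], Finset.sum_const,
        nsmul_eq_mul]
      have : (2 : ℝ≥0∞) ^ Fintype.card V =
          ((Finset.univ.filter fun τ : V → Bool => τ v = b).card : ℝ≥0∞) * 2 := by
        exact_mod_cast (hcard b).symm
      rw [this, mul_comm _ (2 : ℝ≥0∞), ← mul_assoc, ENNReal.div_mul_cancel (by simp) (by simp),
        mul_comm]
    rw [h3, h3, ← add_mul, ENNReal.mul_div_cancel_right two_pow_ne.1 two_pow_ne.2,
      ENNReal.add_div]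
  exact h2 fun b => rs S Z (Function.update σ v b)

/-- A fixed edge is monochromatic in a random coloring with probability at most `2 / 2 ^ a`. -/
lemma rs_mono_le (S : Finset V) (a : ℕ) (ha : a ≤ S.card) (P : (V → Bool) → Prop)
    [DecidablePred P] (hP : ∀ σ, P σ → ∃ b, ∀ v ∈ S, σ v = b) :
    rs Finset.univ (fun σ => if P σ then 1 else 0) (fun _ => false) ≤ 2 / 2 ^ a := by
  have hcard : ∀ b : Bool, (Finset.univ.filter fun σ : V → Bool => ∀ v ∈ S, σ v = b).card *
      2 ^ S.card = 2 ^ Fintype.card V := fun b => by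
    have : (Finset.univ.filter fun σ : V → Bool => ∀ v ∈ S, σ v = b) =
        Fintype.piFinset fun v => if v ∈ S then {b} else Finset.univ := by
      ext σ
      simp only [Finset.mem_filter, Finset.mem_univ, true_and, Fintype.mem_piFinset]
      refine forall_congr' fun v => ?_
      by_cases h : v ∈ S <;> simp [h]
    rw [this, Fintype.card_piFinset]
    have h2 : ∀ v, (if v ∈ S then ({b} : Finset Bool) else Finset.univ).card =
        if v ∈ S then 1 else 2 := fun v => by split_ifs <;> simp
    rw [Finset.prod_congr rfl fun v _ => h2 v, Finset.prod_ite]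
    simp only [Finset.prod_const, one_pow, one_mul]
    rw [← pow_add]
    congr 1
    have := Finset.card_filter_add_card_filter_not (s := (Finset.univ : Finset V)) (fun v => v ∈ S)
    simp only [Finset.filter_univ_mem, Finset.card_univ] at this
    omega
  simp only [rs, Finset.piecewise_univ]
  have h1 : (∑ σ : V → Bool, if P σ then (1 : ℝ≥0∞) else 0) ≤
      (((Finset.univ.filter fun σ : V → Bool => ∀ v ∈ S, σ v = true).card +
        (Finset.univ.filter fun σ : V → Bool => ∀ v ∈ S, σ v = false).card : ℕ) : ℝ≥0∞) := by
    rw [← Finset.sum_filter, Finset.sum_const, nsmul_eq_mul, mul_one, Nat.cast_le]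
    refine (Finset.card_le_card fun σ hσ => ?_).trans (Finset.card_union_le _ _)
    obtain ⟨b, hb⟩ := hP σ (Finset.mem_filter.1 hσ).2
    cases b
    · exact Finset.mem_union_right _ (by simpa using hb)
    · exact Finset.mem_union_left _ (by simpa using hb)
  refine (ENNReal.div_le_div_right h1 _).trans ?_
  rw [ENNReal.div_le_iff two_pow_ne.1 two_pow_ne.2]
  have h3 : (((Finset.univ.filter fun σ : V → Bool => ∀ v ∈ S, σ v = true).card +
        (Finset.univ.filter fun σ : V → Bool => ∀ v ∈ S, σ v = false).card : ℕ) : ℝ≥0∞) *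
        2 ^ S.card = 2 * 2 ^ Fintype.card V := by
    have : ((Finset.univ.filter fun σ : V → Bool => ∀ v ∈ S, σ v = true).card +
        (Finset.univ.filter fun σ : V → Bool => ∀ v ∈ S, σ v = false).card) *
        2 ^ S.card = 2 * 2 ^ Fintype.card V := by rw [add_mul, hcard, hcard]; ring
    exact_mod_cast this
  rw [div_eq_mul_inv, mul_right_comm, ← h3, ← div_eq_mul_inv,
    ENNReal.le_div_iff_mul_le (Or.inl two_pow_ne.1) (Or.inl two_pow_ne.2)]
  gcongr
  norm_num

end Average

section Witness

variable {V E : Type*} [Fintype V] [DecidableEq V] [DecidableEq E] (A : E → Finset V)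
  (N : E → Finset E)

/-- The edge `f` is monochromatic. -/
def Mono (f : E) (σ : V → Bool) : Prop := ∃ b, ∀ v ∈ A f, σ v = b

open Classical in
/-- The expected value of `Z` after a check that all edges of `L` are monochromatic, and a renewal of
their colors; it counts as zero if the check is not passed. -/
noncomputable def chk (L : Finset E) (Z : (V → Bool) → ℝ≥0∞) (σ : V → Bool) : ℝ≥0∞ :=
  if ∀ f ∈ L, Mono A f σ then rs (L.biUnion A) Z σ else 0

/-- The expected value of `Z` after checking a sequence of layers of edges, from the deepest (last)
layer to the first one. For `Z = 1` this is the probability that all checks are passed. -/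
noncomputable def passes : List (Finset E) → ((V → Bool) → ℝ≥0∞) → (V → Bool) → ℝ≥0∞
  | [], Z => Z
  | L :: ℓ, Z => passes ℓ (chk A L Z)

/-- Some edge in the layers `ℓ` is a neighbor of `f`. -/
def Touched (f : E) (ℓ : List (Finset E)) : Prop := ∃ L ∈ ℓ, ∃ g ∈ L, g ∈ N f

/-- The layers `ℓ` below the layer `S`: each of them consists of pairwise independent neighbors of
edges in the previous one. -/
def Layered : Finset E → List (Finset E) → Prop
  | _, [] => True
  | S, L :: ℓ => L.Nonempty ∧ L ⊆ S.biUnion N ∧ (∀ f ∈ L, ∀ g ∈ L, g ∈ N f → g = f) ∧ Layered L ℓ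

open Classical in
/-- Adds `f` in front of the steps recorded in the layers `ℓ`: it is put into the layer below the
deepest one that contains a neighbor of `f`. -/
noncomputable def ins (f : E) : List (Finset E) → List (Finset E)
  | [] => [{f}]
  | L :: ℓ => if Touched N f (L :: ℓ) then L :: ins f ℓ else insert f L :: ℓ

open Classical in
/-- Removes the deepest occurrence of `f`. -/
noncomputable def del (f : E) : List (Finset E) → List (Finset E)
  | [] => []
  | L :: ℓ => if ∃ L' ∈ ℓ, f ∈ L' then L :: del f ℓ else if L = {f} then ℓ else L.erase f :: ℓ

/-- The local structure of the resampled edges: `N f` consists of `f` and of the edges that may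
share a vertex with `f`. -/
structure IsNbhd : Prop where
  self_mem : ∀ f, f ∈ N f
  symm : ∀ f g, g ∈ N f → f ∈ N g
  disjoint : ∀ f g, g ∉ N f → Disjoint (A f) (A g)

variable {A N}

lemma mono_piecewise {f : E} {S : Finset V} (h : Disjoint (A f) S) (τ σ : V → Bool) :
    Mono A f (S.piecewise τ σ) ↔ Mono A f σ := by
  refine exists_congr fun b => forall₂_congr fun v hv => ?_
  rw [Finset.piecewise_eq_of_notMem _ _ _ (Finset.disjoint_left.1 h hv)]

lemma mono_piecewise_of_subset {f : E} {S : Finset V} (h : A f ⊆ S) (τ σ : V → Bool) :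
    Mono A f (S.piecewise τ σ) ↔ Mono A f τ := by
  refine exists_congr fun b => forall₂_congr fun v hv => ?_
  rw [Finset.piecewise_eq_of_mem _ _ _ (h hv)]

/-- Renewing colors commutes with a check of edges that are disjoint from them. -/
lemma rs_chk {S : Finset V} {L : Finset E} (h : ∀ f ∈ L, Disjoint (A f) S)
    (Z : (V → Bool) → ℝ≥0∞) : rs S (chk A L Z) = chk A L (rs S Z) := by
  classical
  funext σ
  have hiff : ∀ τ, (∀ f ∈ L, Mono A f (S.piecewise τ σ)) ↔ ∀ f ∈ L, Mono A f σ := fun τ =>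
    forall₂_congr fun f hf => mono_piecewise (h f hf) τ σ
  by_cases hm : ∀ f ∈ L, Mono A f σ
  · rw [chk, if_pos hm, rs_rs, Finset.union_comm, ← rs_rs, rs, rs]
    congr 1
    refine Finset.sum_congr rfl fun τ _ => ?_
    rw [chk, if_pos ((hiff τ).2 hm)]
  · rw [chk, if_neg hm, rs]
    rw [Finset.sum_eq_zero fun τ _ => ?_]
    · simp
    · rw [chk, if_neg (mt (hiff τ).1 hm)]

lemma chk_insert (hN : IsNbhd A N) {f : E} {L : Finset E} (h : ∀ g ∈ L, g ∉ N f)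
    (Z : (V → Bool) → ℝ≥0∞) : chk A (insert f L) Z = chk A {f} (chk A L Z) := by
  classical
  funext σ
  have hdis : ∀ g ∈ L, Disjoint (A g) (({f} : Finset E).biUnion A) := fun g hg => by
    rw [Finset.singleton_biUnion]; exact (hN.disjoint f g (h g hg)).symm
  have hsplit : (∀ g ∈ insert f L, Mono A g σ) ↔ Mono A f σ ∧ ∀ g ∈ L, Mono A g σ := by
    simp
  by_cases hf : Mono A f σ
  · rw [chk.eq_def A {f}, if_pos (by simpa using hf), rs_chk hdis, chk, chk]
    refine if_congr (hsplit.trans (and_iff_right hf)) ?_ rfl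
    rw [rs_rs, Finset.biUnion_insert, Finset.singleton_biUnion, Finset.union_comm]
  · rw [chk, chk, if_neg (fun hc => hf (hsplit.1 hc).1), if_neg (by simpa using hf)]

lemma chk_comm (hN : IsNbhd A N) {f : E} {L : Finset E} (h : ∀ g ∈ L, g ∉ N f)
    (Z : (V → Bool) → ℝ≥0∞) : chk A {f} (chk A L Z) = chk A L (chk A {f} Z) := by
  classical
  funext σ
  have hdis : ∀ g ∈ L, Disjoint (A g) (A f) := fun g hg => (hN.disjoint f g (h g hg)).symm
  have hLf : Disjoint (A f) (L.biUnion A) :=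
    (Finset.disjoint_biUnion_right _ _ _).2 fun g hg => (hdis g hg).symm
  have hl : chk A L (chk A {f} Z) σ =
      if ∀ g ∈ L, Mono A g σ then chk A {f} (rs (L.biUnion A) Z) σ else 0 := by
    rw [chk, rs_chk (by simpa using hLf)]
  rw [hl]
  by_cases hf : Mono A f σ
  · rw [chk.eq_def A {f}, if_pos (by simpa using hf), rs_chk (by simpa using hdis), chk]
    refine if_congr Iff.rfl ?_ rfl
    rw [chk, if_pos (by simpa using hf), rs_rs, rs_rs, Finset.union_comm]
  · have hz : ∀ Z, chk A {f} Z σ = 0 := fun Z => by rw [chk, if_neg (by simpa using hf)]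
    simp [hz]

lemma chk_passes_comm (hN : IsNbhd A N) {f : E} (ℓ : List (Finset E)) (h : ¬ Touched N f ℓ)
    (Z : (V → Bool) → ℝ≥0∞) : chk A {f} (passes A ℓ Z) = passes A ℓ (chk A {f} Z) := by
  induction ℓ generalizing Z with
  | nil => rfl
  | cons L ℓ ih =>
    rw [passes, passes, ih (fun ⟨L', h1, h2⟩ => h ⟨L', List.mem_cons_of_mem _ h1, h2⟩),
      chk_comm hN fun g hg hc => h ⟨L, List.mem_cons_self, g, hg, hc⟩]

lemma rs_passes_comm (hN : IsNbhd A N) {f : E} (ℓ : List (Finset E)) (h : ¬ Touched N f ℓ)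
    (Z : (V → Bool) → ℝ≥0∞) : rs (A f) (passes A ℓ Z) = passes A ℓ (rs (A f) Z) := by
  induction ℓ generalizing Z with
  | nil => rfl
  | cons L ℓ ih =>
    rw [passes, passes, ih (fun ⟨L', h1, h2⟩ => h ⟨L', List.mem_cons_of_mem _ h1, h2⟩),
      rs_chk fun g hg => (hN.disjoint f g fun hc => h ⟨L, List.mem_cons_self, g, hg, hc⟩).symm]

/-- To check `f` and then the layers is the same as to check the layers with `f` put in. -/
lemma passes_ins (hN : IsNbhd A N) {f : E} (ℓ : List (Finset E)) (Z : (V → Bool) → ℝ≥0∞) :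
    passes A (ins N f ℓ) Z = chk A {f} (passes A ℓ Z) := by
  classical
  induction ℓ generalizing Z with
  | nil => rfl
  | cons L ℓ ih =>
    rw [ins]
    split_ifs with ht
    · rw [passes, ih, passes]
    · rw [passes, passes, chk_insert hN fun g hg hc => ht ⟨L, List.mem_cons_self, g, hg, hc⟩,
        chk_passes_comm hN]
      exact fun ⟨L', h1, h2⟩ => ht ⟨L', List.mem_cons_of_mem _ h1, h2⟩

lemma layered_ins (hN : IsNbhd A N) {f : E} (ℓ : List (Finset E)) :
    ∀ S, Layered N S ℓ → Touched N f (S :: ℓ) → Layered N S (ins N f ℓ) := by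
  classical
  induction ℓ with
  | nil =>
    rintro S - ⟨L, hL, g, hg, hgf⟩
    obtain rfl := List.mem_singleton.1 hL
    refine ⟨Finset.singleton_nonempty f, ?_, by simp, trivial⟩
    rw [Finset.singleton_subset_iff]
    exact Finset.mem_biUnion.2 ⟨g, hg, hN.symm _ _ hgf⟩
  | cons L ℓ ih =>
    rintro S ⟨h1, h2, h3, h4⟩ ht
    rw [ins]
    split_ifs with ht'
    · exact ⟨h1, h2, h3, ih L h4 ht'⟩
    · have hS : ∃ g ∈ S, g ∈ N f := by
        obtain ⟨L', hL', h⟩ := ht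
        rcases List.mem_cons.1 hL' with rfl | hL'
        · exact h
        · exact absurd ⟨L', hL', h⟩ ht'
      have hL : ∀ g ∈ L, g ∉ N f := fun g hg hc => ht' ⟨L, List.mem_cons_self, g, hg, hc⟩
      refine ⟨Finset.insert_nonempty _ _, Finset.insert_subset ?_ h2, ?_, ?_⟩
      · obtain ⟨g, hg, hgf⟩ := hS
        exact Finset.mem_biUnion.2 ⟨g, hg, hN.symm _ _ hgf⟩
      · intro g hg g' hg' hgg
        rcases Finset.mem_insert.1 hg with hg | hg <;> rcases Finset.mem_insert.1 hg' with hg' | hg'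
        · rw [hg, hg']
        · rw [hg] at hgg
          exact absurd hgg (hL g' hg')
        · rw [hg'] at hgg
          exact absurd (hN.symm _ _ hgg) (hL g hg)
        · exact h3 g hg g' hg' hgg
      · cases ℓ with
        | nil => trivial
        | cons L' ℓ' =>
          obtain ⟨h5, h6, h7, h8⟩ := h4
          refine ⟨h5, h6.trans ?_, h7, h8⟩
          exact Finset.biUnion_subset_biUnion_of_subset_left _ (Finset.subset_insert _ _)

lemma exists_mem_ins (f : E) (ℓ : List (Finset E)) : ∃ L ∈ ins N f ℓ, f ∈ L := by
  classical
  induction ℓ with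
  | nil => exact ⟨{f}, List.mem_singleton.2 rfl, Finset.mem_singleton_self f⟩
  | cons L ℓ ih =>
    rw [ins]
    split_ifs
    · obtain ⟨L', h1, h2⟩ := ih
      exact ⟨L', List.mem_cons_of_mem _ h1, h2⟩
    · exact ⟨_, List.mem_cons_self, Finset.mem_insert_self _ _⟩

/-- The step `f` is recovered from the record as the deepest occurrence of `f`: the layers below it
contain no neighbor of `f`, in particular not `f` itself. -/
lemma del_ins (hN : IsNbhd A N) {f : E} (ℓ : List (Finset E)) :
    ∀ S, Layered N S ℓ → del f (ins N f ℓ) = ℓ := by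
  classical
  induction ℓ with
  | nil => intro S _; simp [ins, del]
  | cons L ℓ ih =>
    rintro S ⟨h1, h2, h3, h4⟩
    rw [ins]
    split_ifs with ht
    · rw [del, if_pos (exists_mem_ins f ℓ), ih L h4]
    · have hfL : f ∉ L := fun hc => ht ⟨L, List.mem_cons_self, f, hc, hN.self_mem f⟩
      rw [del, if_neg, if_neg, Finset.erase_insert hfL]
      · intro hc
        obtain ⟨g, hg⟩ := h1
        have : g ∈ insert f L := Finset.mem_insert_of_mem hg
        rw [hc, Finset.mem_singleton] at this
        exact hfL (this ▸ hg)
      · rintro ⟨L', hL', hf⟩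
        exact ht ⟨L', List.mem_cons_of_mem _ hL', f, hf, hN.self_mem f⟩

variable (N) in
/-- The possible records of the steps on which one resampling step depends: a single edge of `C` in
the first layer, and below it layers of neighbors. -/
abbrev Pyramid (C : Finset E) : Type _ :=
  {x : E × List (Finset E) // x.1 ∈ C ∧ Layered N {x.1} x.2}

variable (A N) in
/-- An upper bound for the expected number of resampling steps from the coloring `σ`. -/
noncomputable def stepPot (C : Finset E) (σ : V → Bool) : ℝ≥0∞ :=
  ∑' x : Pyramid N C, passes A ({x.1.1} :: x.1.2) (fun _ => 1) σ

/-- One step pays for itself. A record of later steps turns into a record of all steps when the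
present step is put in front of it, unless it does not depend on the present step. Different
records stay different, and none of them is the record that consists of the present step alone. -/
lemma one_add_rs_stepPot_le (hN : IsNbhd A N) {C : Finset E} {f : E} (hf : f ∈ C)
    {σ : V → Bool} (hm : Mono A f σ) :
    1 + rs (A f) (stepPot A N C) σ ≤ stepPot A N C σ := by
  classical
  have hchk : ∀ Z, chk A {f} Z σ = rs (A f) Z σ := fun Z => by
    rw [chk, if_pos (by simpa using hm), Finset.singleton_biUnion]
  let Φ : Unit ⊕ Pyramid N C → Pyramid N C := Sum.elim (fun _ => ⟨(f, []), hf, trivial⟩) fun x =>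
    if h : Touched N f ({x.1.1} :: x.1.2) then
      ⟨(x.1.1, ins N f x.1.2), x.2.1, layered_ins hN _ _ x.2.2 h⟩
    else x
  have hΦ1 : ∀ x : Pyramid N C, Touched N f ({x.1.1} :: x.1.2) →
      (Φ (.inr x)).1 = (x.1.1, ins N f x.1.2) := fun x h =>
    congrArg Subtype.val (dif_pos h)
  have hΦ2 : ∀ x : Pyramid N C, ¬ Touched N f ({x.1.1} :: x.1.2) → Φ (.inr x) = x :=
    fun x h => dif_neg h
  have htouch : ∀ x : Pyramid N C, Touched N f ({(Φ (.inr x)).1.1} :: (Φ (.inr x)).1.2) →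
      Touched N f ({x.1.1} :: x.1.2) := fun x h => by
    by_contra hc
    rw [hΦ2 x hc] at h
    exact hc h
  have hinsT : ∀ x : Pyramid N C, Touched N f ({x.1.1} :: ins N f x.1.2) := fun x => by
    obtain ⟨L, h1, h2⟩ := exists_mem_ins (N := N) f x.1.2
    exact ⟨L, List.mem_cons_of_mem _ h1, f, h2, hN.self_mem f⟩
  have hinsne : ∀ ℓ, ins N f ℓ ≠ [] := fun ℓ hc => by
    obtain ⟨L, h1, -⟩ := exists_mem_ins (N := N) f ℓ
    simp [hc] at h1
  have hinj : Function.Injective Φ := by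
    have hnone : ∀ x, Φ (.inl ()) ≠ Φ (.inr x) := fun x hc => by
      have h0 : (Φ (.inr x)).1 = (f, []) := by rw [← hc]; rfl
      have ht : Touched N f ({x.1.1} :: x.1.2) := htouch x (by
        rw [h0]
        exact ⟨{f}, List.mem_cons_self, f, Finset.mem_singleton_self f, hN.self_mem f⟩)
      rw [hΦ1 x ht] at h0
      exact hinsne _ (Prod.ext_iff.1 h0).2
    intro o o' hoo
    cases o with
    | inl _ => cases o' with
      | inl _ => rfl
      | inr x => exact absurd hoo (hnone x)
    | inr x => cases o' with
      | inl _ => exact absurd hoo.symm (hnone x)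
      | inr y =>
        refine congrArg Sum.inr ?_
        by_cases hx : Touched N f ({x.1.1} :: x.1.2)
        · have hy : Touched N f ({y.1.1} :: y.1.2) := htouch y (by
            rw [← hoo, hΦ1 x hx]; exact hinsT x)
          have h0 := congrArg Subtype.val hoo
          rw [hΦ1 x hx, hΦ1 y hy] at h0
          obtain ⟨h1, h2⟩ := Prod.ext_iff.1 h0
          refine Subtype.ext (Prod.ext h1 ?_)
          rw [← del_ins hN (f := f) _ _ x.2.2, ← del_ins hN (f := f) _ _ y.2.2]
          exact congrArg (del f) h2
        · have hy : ¬ Touched N f ({y.1.1} :: y.1.2) := fun hy => hx (htouch x (by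
            rw [hoo, hΦ1 y hy]; exact hinsT y))
          rwa [hΦ2 x hx, hΦ2 y hy] at hoo
  have hval : ∀ x : Pyramid N C, rs (A f) (passes A ({x.1.1} :: x.1.2) fun _ => 1) σ ≤
      passes A ({(Φ (.inr x)).1.1} :: (Φ (.inr x)).1.2) (fun _ => 1) σ := fun x => by
    by_cases hx : Touched N f ({x.1.1} :: x.1.2)
    · rw [hΦ1 x hx, passes]
      change _ ≤ passes A (ins N f x.1.2) (chk A {x.1.1} fun _ => 1) σ
      rw [passes_ins hN, hchk]
    · rw [hΦ2 x hx, rs_passes_comm hN _ hx, show rs (A f) (fun _ : V → Bool => 1) = fun _ => 1 from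
        funext fun σ => rs_const _ _ σ]
  have hnone : 1 ≤ passes A ({(Φ (.inl ())).1.1} :: (Φ (.inl ())).1.2) (fun _ => 1) σ := by
    change 1 ≤ passes A [{f}] (fun _ => 1) σ
    rw [passes, passes, hchk, rs_const]
  calc 1 + rs (A f) (stepPot A N C) σ
      = 1 + ∑' x : Pyramid N C, rs (A f) (passes A ({x.1.1} :: x.1.2) fun _ => 1) σ := by
        rw [← rs_tsum]; rfl
    _ ≤ passes A ({(Φ (.inl ())).1.1} :: (Φ (.inl ())).1.2) (fun _ => 1) σ +
          ∑' x, passes A ({(Φ (.inr x)).1.1} :: (Φ (.inr x)).1.2) (fun _ => 1) σ :=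
        add_le_add hnone (ENNReal.tsum_le_tsum hval)
    _ = ∑' o, passes A ({(Φ o).1.1} :: (Φ o).1.2) (fun _ => 1) σ := by
        rw [Summable.tsum_sum ENNReal.summable ENNReal.summable]
        simp
    _ ≤ stepPot A N C σ := ENNReal.tsum_comp_le_tsum_of_injective hinj _

/-- The number of edges in all layers. -/
def size (ℓ : List (Finset E)) : ℕ := (ℓ.map Finset.card).sum

/-- In a random coloring the edges of an independent layer are monochromatic independently of each
other, and of their renewed colors. -/
lemma rs_chk_le {S : Finset V} {q : ℝ≥0∞} (hN : IsNbhd A N) (L : Finset E)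
    (hind : ∀ f ∈ L, ∀ g ∈ L, g ∈ N f → g = f) (hS : ∀ f ∈ L, A f ⊆ S)
    (hq : ∀ f ∈ L, ∀ P : (V → Bool) → Prop, ∀ _ : DecidablePred P, (∀ σ, P σ → Mono A f σ) →
      rs Finset.univ (fun σ => if P σ then 1 else 0) (fun _ => false) ≤ q)
    (Z : (V → Bool) → ℝ≥0∞) (σ : V → Bool) :
    rs S (chk A L Z) σ ≤ q ^ L.card * rs S Z σ := by
  classical
  induction L using Finset.induction_on generalizing Z with
  | empty =>
    have : chk A (∅ : Finset E) Z = Z := by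
      funext σ
      rw [chk, if_pos (by simp)]
      refine rs_congr fun τ => congrArg Z ?_
      ext v
      exact Finset.piecewise_eq_of_notMem _ _ _ (by simp)
    simp [this]
  | insert f L hfL ih =>
    have hL : ∀ g ∈ L, g ∉ N f := fun g hg hc => by
      have := hind f (Finset.mem_insert_self _ _) g (Finset.mem_insert_of_mem hg) hc
      exact hfL (this ▸ hg)
    have hf1 : ∀ Z, rs S (chk A {f} Z) σ ≤ q * rs S Z σ := fun Z => by
      have hfS := hS f (Finset.mem_insert_self _ _)
      have h1 := sum_mul_rs (A f) (fun τ => if Mono A f τ then 1 else 0)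
        (fun τ => Z (S.piecewise τ σ)) fun τ τ' => by
          simp only [mono_piecewise_of_subset subset_rfl]
      have h2 : ∀ τ, chk A {f} Z (S.piecewise τ σ) = (if Mono A f τ then 1 else 0) *
          rs (A f) (fun τ => Z (S.piecewise τ σ)) τ := fun τ => by
        rw [chk]
        simp only [Finset.mem_singleton, forall_eq, mono_piecewise_of_subset hfS,
          Finset.singleton_biUnion]
        split_ifs
        · rw [one_mul, rs, rs]
          congr 1
          refine Finset.sum_congr rfl fun τ' _ => ?_
          rw [piecewise_piecewise_union, Finset.union_eq_left.2 hfS]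
        · rw [zero_mul]
      rw [rs, Finset.sum_congr rfl fun τ _ => h2 τ, h1, mul_div_assoc]
      refine mul_le_mul' ?_ le_rfl
      exact hq f (Finset.mem_insert_self _ _) _ _ fun _ h => h
    rw [chk_insert hN hL, Finset.card_insert_of_notMem hfL, pow_succ']
    refine (hf1 _).trans ?_
    rw [mul_assoc]
    gcongr
    exact ih (fun f hf g hg => hind f (Finset.mem_insert_of_mem hf) g (Finset.mem_insert_of_mem hg))
      (fun f hf => hS f (Finset.mem_insert_of_mem hf))
      (fun f hf => hq f (Finset.mem_insert_of_mem hf)) Z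

/-- The total weight of all layers below `S`; each layer contributes a binomial sum. -/
lemma sum_pow_size_le {q y : ℝ≥0∞} {D : ℕ} (hy : q * (1 + y) ^ D ≤ y)
    (hD : ∀ f, (N f).card ≤ D) (d : ℕ) :
    ∀ S : Finset E, ∀ F : Finset (List (Finset E)),
      (∀ ℓ ∈ F, ℓ.length ≤ d ∧ Layered N S ℓ) →
      q ^ S.card * ∑ ℓ ∈ F, q ^ size ℓ ≤ y ^ S.card := by
  induction d with
  | zero =>
    intro S F hF
    have h1 : F ⊆ {[]} := fun ℓ hℓ => by simpa using (hF ℓ hℓ).1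
    have h2 : ∑ ℓ ∈ F, q ^ size ℓ ≤ 1 :=
      (Finset.sum_le_sum_of_subset h1).trans (by simp [size])
    have h3 : q ≤ y := le_trans (le_mul_of_one_le_right zero_le
      (one_le_pow₀ (by simp))) hy
    calc _ ≤ q ^ S.card * 1 := by gcongr
      _ ≤ _ := by rw [mul_one]; gcongr
  | succ d ih =>
    intro S F hF
    classical
    have h2 : ∑ ℓ ∈ F, q ^ size ℓ ≤ (1 + y) ^ (S.biUnion N).card := by
      have h3 := Finset.sum_pow_mul_eq_add_pow y 1 (S.biUnion N)
      simp only [one_pow, mul_one] at h3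
      rw [add_comm, ← h3, ← Finset.sum_fiberwise_of_maps_to (t := (S.biUnion N).powerset)
        (g := fun ℓ : List (Finset E) => ℓ.headD ∅)]
      · refine Finset.sum_le_sum fun L _ => ?_
        rcases L.eq_empty_or_nonempty with rfl | hL
        · have h1 : (F.filter fun ℓ => ℓ.headD ∅ = ∅) ⊆ {[]} := fun ℓ hℓ => by
            obtain ⟨h4, h5⟩ := Finset.mem_filter.1 hℓ
            cases ℓ with
            | nil => simp
            | cons L ℓ => exact absurd h5 (hF _ h4).2.1.ne_empty
          exact (Finset.sum_le_sum_of_subset h1).trans (by simp [size])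
        · have hcons : ∀ ℓ ∈ F.filter fun ℓ => ℓ.headD ∅ = L, ℓ = L :: ℓ.tail := fun ℓ hℓ => by
            obtain ⟨h4, h5⟩ := Finset.mem_filter.1 hℓ
            cases ℓ with
            | nil => exact absurd h5.symm hL.ne_empty
            | cons L' ℓ =>
              rw [List.headD_cons] at h5
              rw [h5, List.tail_cons]
          have hinj : Set.InjOn List.tail
              (↑(F.filter fun ℓ => ℓ.headD ∅ = L) : Set (List (Finset E))) := by
            intro ℓ hℓ ℓ' hℓ' he
            rw [hcons ℓ hℓ, hcons ℓ' hℓ', he]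
          have hsz : ∀ ℓ ∈ F.filter fun ℓ => ℓ.headD ∅ = L,
              q ^ size ℓ = q ^ L.card * q ^ size ℓ.tail := fun ℓ hℓ => by
            conv_lhs => rw [hcons ℓ hℓ]
            rw [← pow_add]; simp [size]
          rw [Finset.sum_congr rfl hsz, ← Finset.mul_sum,
            ← Finset.sum_image (f := fun ℓ => q ^ size ℓ) hinj]
          refine ih L _ fun ℓ' hℓ' => ?_
          obtain ⟨ℓ, hℓ, rfl⟩ := Finset.mem_image.1 hℓ'
          have h6 := hF ℓ (Finset.mem_filter.1 hℓ).1
          rw [hcons ℓ hℓ] at h6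
          refine ⟨?_, h6.2.2.2.2⟩
          simpa using h6.1
      · intro ℓ hℓ
        rw [Finset.mem_powerset]
        cases ℓ with
        | nil => simp
        | cons L ℓ => exact (hF _ hℓ).2.2.1
    have h4 : (S.biUnion N).card ≤ D * S.card := by
      rw [mul_comm]
      exact Finset.card_biUnion_le_card_mul _ _ _ fun v _ => hD v
    calc q ^ S.card * ∑ ℓ ∈ F, q ^ size ℓ
        ≤ q ^ S.card * (1 + y) ^ (D * S.card) := by
          gcongr
          exact h2.trans (pow_le_pow_right₀ (by simp) h4)
      _ = (q * (1 + y) ^ D) ^ S.card := by rw [mul_pow, pow_mul]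
      _ ≤ y ^ S.card := by gcongr

lemma rs_passes_le {S : Finset V} {q : ℝ≥0∞} (hN : IsNbhd A N) (hS : ∀ f, A f ⊆ S)
    (hq : ∀ f, ∀ P : (V → Bool) → Prop, ∀ _ : DecidablePred P, (∀ σ, P σ → Mono A f σ) →
      rs Finset.univ (fun σ => if P σ then 1 else 0) (fun _ => false) ≤ q)
    (ℓ : List (Finset E)) : ∀ (S₀ : Finset E) (_ : Layered N S₀ ℓ)
    (Z : (V → Bool) → ℝ≥0∞) (σ : V → Bool),
    rs S (passes A ℓ Z) σ ≤ q ^ size ℓ * rs S Z σ := by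
  induction ℓ with
  | nil => intro S₀ _ Z σ; simp [passes, size]
  | cons L ℓ ih =>
    rintro S₀ ⟨-, -, h3, h4⟩ Z σ
    rw [passes]
    refine (ih L h4 _ σ).trans ?_
    have : size (L :: ℓ) = size ℓ + L.card := by simp [size, add_comm]
    rw [this, pow_add, mul_assoc]
    gcongr
    exact rs_chk_le hN L h3 (fun f _ => hS f) (fun f _ => hq f) Z σ

/-- The expected number of resampling steps from a random coloring is at most `y` per edge of
`C`. -/
lemma rs_stepPot_le {S : Finset V} {q y : ℝ≥0∞} {D : ℕ} (hN : IsNbhd A N) (hS : ∀ f, A f ⊆ S)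
    (hq : ∀ f, ∀ P : (V → Bool) → Prop, ∀ _ : DecidablePred P, (∀ σ, P σ → Mono A f σ) →
      rs Finset.univ (fun σ => if P σ then 1 else 0) (fun _ => false) ≤ q)
    (hy : q * (1 + y) ^ D ≤ y) (hD : ∀ f, (N f).card ≤ D) (C : Finset E) (σ : V → Bool) :
    rs S (stepPot A N C) σ ≤ C.card * y := by
  classical
  have h1 : rs S (stepPot A N C) σ ≤ ∑' x : Pyramid N C, q * q ^ size x.1.2 := by
    have h2 : rs S (stepPot A N C) σ =
        ∑' x : Pyramid N C, rs S (passes A ({x.1.1} :: x.1.2) fun _ => 1) σ := by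
      rw [← rs_tsum]; rfl
    rw [h2]
    refine ENNReal.tsum_le_tsum fun x => ?_
    rw [passes]
    refine (rs_passes_le hN hS hq _ _ x.2.2 _ σ).trans ?_
    rw [mul_comm q]
    gcongr
    refine (rs_chk_le hN {x.1.1} (by simp) (fun f _ => hS f) (fun f _ => hq f) _ σ).trans ?_
    rw [rs_const]; simp
  refine h1.trans ?_
  rw [ENNReal.tsum_eq_iSup_sum]
  refine iSup_le fun F => ?_
  rw [← Finset.sum_fiberwise_of_maps_to (t := C) (g := fun x : Pyramid N C => x.1.1)
    fun x _ => x.2.1, ← nsmul_eq_mul]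
  refine Finset.sum_le_card_nsmul _ _ _ fun f _ => ?_
  have hinj : Set.InjOn (fun x : Pyramid N C => x.1.2)
      (↑(F.filter fun x : Pyramid N C => x.1.1 = f) : Set (Pyramid N C)) := by
    intro x hx y hy he
    refine Subtype.ext (Prod.ext ?_ he)
    rw [(Finset.mem_filter.1 hx).2, (Finset.mem_filter.1 hy).2]
  rw [← Finset.mul_sum, ← Finset.sum_image (f := fun ℓ => q ^ size ℓ) hinj]
  have h3 := sum_pow_size_le hy hD (F.sup fun x : Pyramid N C => x.1.2.length) {f}
    ((F.filter fun x : Pyramid N C => x.1.1 = f).image fun x => x.1.2) fun ℓ hℓ => by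
      obtain ⟨x, hx, rfl⟩ := Finset.mem_image.1 hℓ
      obtain ⟨hx, hf⟩ := Finset.mem_filter.1 hx
      refine ⟨Finset.le_sup (f := fun x : Pyramid N C => x.1.2.length) hx, ?_⟩
      rw [← hf]
      exact x.2.2
  simpa using h3

end Witness

end Resampling

/-! ### Time and space -/

/-- Bounds on the numbers of vertices and edges, on the degrees of vertices, and on the lengths of
the arrays. -/
structure Sizes where
  n : ℕ
  m : ℕ
  D : ℕ
  L : ℕ

/-- The addresses that may be used in the regions of the memory. -/
def Sizes.Idx (S : Sizes) : Region → ℕ → Prop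
  | .status, i | .color, i => i < S.n
  | .explored, i | .inComp, i => i < S.m
  | _, i => i < S.L

/-- The contents that the cells of the regions of the memory may have. -/
def Sizes.Val (S : Sizes) : Region → ℕ → Prop
  | .status, x | .color, x | .explored, x | .inComp, x => x ≤ 2
  | _, x => x < S.m

/-- All used addresses and all contents of the memory are admissible. -/
def Sizes.MemOK (S : Sizes) (μ : Mem) : Prop :=
  (∀ p ∈ μ.used, S.Idx p.1 p.2) ∧ ∀ c i, S.Val c (μ.cell c i)

/-- An upper bound for the space of an admissible memory: the two regions for vertices and the two
regions for flags of edges take at most three bits per cell, and there are six arrays. -/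
def Sizes.space (S : Sizes) : ℕ := 6 * S.n + 6 * S.m + 6 * (S.L * (1 + Nat.size S.m))

lemma Sizes.MemOK.bits_le {S : Sizes} {μ : Mem} (h : S.MemOK μ) : μ.bits ≤ S.space := by
  classical
  let W : Finset (Region × ℕ) :=
    (({.status, .color} : Finset Region) ×ˢ Finset.range S.n) ∪
      (({.explored, .inComp} : Finset Region) ×ˢ Finset.range S.m) ∪
      (({.arrB, .arrU, .arrQ, .arrC, .arrW, .arrX} : Finset Region) ×ˢ Finset.range S.L)
  have hW : μ.used ⊆ W := by
    rintro ⟨c, i⟩ hp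
    have := h.1 _ hp
    cases c <;> simp_all [W, Sizes.Idx]
  have hsmall : ∀ x, x ≤ 2 → Nat.size x ≤ 2 := fun x hx => by
    rw [Nat.size_le]; omega
  calc μ.bits ≤ ∑ p ∈ W, (1 + Nat.size (μ.cell p.1 p.2)) := Finset.sum_le_sum_of_subset hW
    _ ≤ (∑ p ∈ ({.status, .color} : Finset Region) ×ˢ Finset.range S.n,
          (1 + Nat.size (μ.cell p.1 p.2)) +
        ∑ p ∈ ({.explored, .inComp} : Finset Region) ×ˢ Finset.range S.m,
          (1 + Nat.size (μ.cell p.1 p.2))) +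
        ∑ p ∈ ({.arrB, .arrU, .arrQ, .arrC, .arrW, .arrX} : Finset Region) ×ˢ Finset.range S.L,
          (1 + Nat.size (μ.cell p.1 p.2)) := by
        have hle : ∀ A B : Finset (Region × ℕ), ∑ p ∈ A ∪ B, (1 + Nat.size (μ.cell p.1 p.2)) ≤
            ∑ p ∈ A, (1 + Nat.size (μ.cell p.1 p.2)) +
              ∑ p ∈ B, (1 + Nat.size (μ.cell p.1 p.2)) := fun A B => by
          rw [← Finset.sum_union_inter]; exact Nat.le_add_right _ _
        exact (hle _ _).trans (Nat.add_le_add_right (hle _ _) _)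
    _ ≤ (2 * S.n * 3 + 2 * S.m * 3) + 6 * S.L * (1 + Nat.size S.m) := by
        refine Nat.add_le_add (Nat.add_le_add ?_ ?_) ?_
        · refine (Finset.sum_le_card_nsmul _ _ 3 ?_).trans ?_
          · rintro ⟨c, i⟩ hp
            have := h.2 c i
            simp only [Finset.mem_product, Finset.mem_insert, Finset.mem_singleton] at hp
            rcases hp.1 with rfl | rfl <;> have := hsmall _ this <;> simp only at this ⊢ <;> omega
          · rw [Finset.card_product, Finset.card_range, smul_eq_mul,
              show ({.status, .color} : Finset Region).card = 2 from rfl]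
        · refine (Finset.sum_le_card_nsmul _ _ 3 ?_).trans ?_
          · rintro ⟨c, i⟩ hp
            have := h.2 c i
            simp only [Finset.mem_product, Finset.mem_insert, Finset.mem_singleton] at hp
            rcases hp.1 with rfl | rfl <;> have := hsmall _ this <;> simp only at this ⊢ <;> omega
          · rw [Finset.card_product, Finset.card_range, smul_eq_mul,
              show ({.explored, .inComp} : Finset Region).card = 2 from rfl]
        · refine (Finset.sum_le_card_nsmul _ _ (1 + Nat.size S.m) ?_).trans ?_
          · rintro ⟨c, i⟩ hp
            have := h.2 c i
            simp only [Finset.mem_product, Finset.mem_insert, Finset.mem_singleton] at hp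
            have hx : μ.cell c i < S.m := by
              rcases hp.1 with rfl | rfl | rfl | rfl | rfl | rfl <;> exact this
            have := Nat.size_le_size hx.le
            simp only
            omega
          · rw [Finset.card_product, Finset.card_range, smul_eq_mul,
              show ({.arrB, .arrU, .arrQ, .arrC, .arrW, .arrX} : Finset Region).card = 6 from rfl]
    _ = S.space := by rw [Sizes.space]; ring

namespace Prog

variable {α β : Type}

/-- Every execution makes at most `t` operations and writes only admissible contents to admissible
addresses; `Q a t'` holds when it returns `a` and `t'` operations are left over. The answers of the
input tape and of the memory may be any admissible ones. -/
def Cost (S : Sizes) : Prog α → ℕ → (α → ℕ → Prop) → Prop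
  | ret a, t, Q => Q a t
  | fail, _, _ => True
  | degree _ next, t, Q => 1 ≤ t ∧ ∀ x ≤ S.D, (next x).Cost S (t - 1) Q
  | incident _ _ next, t, Q => 1 ≤ t ∧ ∀ x < S.m, (next x).Cost S (t - 1) Q
  | member _ _ next, t, Q => 1 ≤ t ∧ ∀ x < S.n, (next x).Cost S (t - 1) Q
  | load c _ next, t, Q => 1 ≤ t ∧ ∀ x, S.Val c x → (next x).Cost S (t - 1) Q
  | store c i x next, t, Q => 1 ≤ t ∧ S.Idx c i ∧ S.Val c x ∧ next.Cost S (t - 1) Q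
  | coin next, t, Q => 1 ≤ t ∧ ∀ b, (next b).Cost S (t - 1) Q

/-- Every execution makes at most `T` operations, keeps the memory admissible, and returns a value
with the property `Q`, unless it fails. -/
def Within (S : Sizes) (p : Prog α) (T : ℕ) (Q : α → Prop) : Prop :=
  ∀ t, T ≤ t → p.Cost S t fun a t' => t ≤ t' + T ∧ Q a

variable {S : Sizes}

lemma cost_mono {p : Prog α} {t : ℕ} {Q Q' : α → ℕ → Prop} (h : p.Cost S t Q)
    (hQ : ∀ a t, Q a t → Q' a t) : p.Cost S t Q' := by
  induction p generalizing t with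
  | ret a => exact hQ _ _ h
  | fail => trivial
  | degree v next ih => exact ⟨h.1, fun x hx => ih _ (h.2 x hx)⟩
  | incident v i next ih => exact ⟨h.1, fun x hx => ih _ (h.2 x hx)⟩
  | member e j next ih => exact ⟨h.1, fun x hx => ih _ (h.2 x hx)⟩
  | load c i next ih => exact ⟨h.1, fun x hx => ih _ (h.2 x hx)⟩
  | store c i x next ih => exact ⟨h.1, h.2.1, h.2.2.1, ih h.2.2.2⟩
  | coin next ih => exact ⟨h.1, fun b => ih _ (h.2 b)⟩

lemma cost_bind {p : Prog α} {g : α → Prog β} {t : ℕ} {Q : β → ℕ → Prop}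
    (h : p.Cost S t fun a t' => (g a).Cost S t' Q) : (p.bind g).Cost S t Q := by
  induction p generalizing t with
  | ret a => exact h
  | fail => trivial
  | degree v next ih => exact ⟨h.1, fun x hx => ih _ (h.2 x hx)⟩
  | incident v i next ih => exact ⟨h.1, fun x hx => ih _ (h.2 x hx)⟩
  | member e j next ih => exact ⟨h.1, fun x hx => ih _ (h.2 x hx)⟩
  | load c i next ih => exact ⟨h.1, fun x hx => ih _ (h.2 x hx)⟩
  | store c i x next ih => exact ⟨h.1, h.2.1, h.2.2.1, ih h.2.2.2⟩
  | coin next ih => exact ⟨h.1, fun b => ih _ (h.2 b)⟩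

/-- The sizes are correct for the input `H`. -/
structure _root_.HypergraphLCA.Sizes.Fits (S : Sizes) (H : Hypergraph) : Prop where
  n_eq : S.n = H.n
  m_eq : S.m = H.m
  n_pos : 0 < S.n
  m_pos : 0 < S.m
  degree_le : H.maxEdgeDegree + 1 ≤ S.D

lemma getD_map_val_lt {N : ℕ} (l : List (Fin N)) (i : ℕ) (h : 0 < N) :
    (l.map Fin.val).getD i 0 < N := by
  rw [List.getD_eq_getElem?_getD, List.getElem?_map]
  cases l[i]? with
  | none => simpa
  | some x => simp

lemma _root_.HypergraphLCA.Sizes.Fits.incident_lt {H : Hypergraph} (hS : S.Fits H) (v i : ℕ) :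
    (H.incidentList v).getD i 0 < S.m := by
  have h0 := hS.m_pos
  rw [hS.m_eq] at h0 ⊢
  by_cases h : v < H.n
  · obtain ⟨l, -, -, he⟩ := Hypergraph.exists_incidentList (⟨v, h⟩ : Fin H.n)
    rw [show v = (⟨v, h⟩ : Fin H.n).val from rfl, he]
    exact getD_map_val_lt _ _ h0
  · rw [Hypergraph.incidentList_of_le (not_lt.1 h)]; simpa

lemma _root_.HypergraphLCA.Sizes.Fits.member_lt {H : Hypergraph} (hS : S.Fits H) (e j : ℕ) :
    (H.memberList e).getD j 0 < S.n := by
  have h0 := hS.n_pos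
  rw [hS.n_eq] at h0 ⊢
  rw [List.getD_eq_getElem?_getD]
  rcases h : (H.memberList e)[j]? with - | x
  · simpa
  · have hx := List.mem_of_getElem? h
    rw [Hypergraph.memberList, List.mem_filter, List.mem_range] at hx
    exact hx.1

lemma write_memOK {μ : Mem} (h : S.MemOK μ) {c : Region} {i x : ℕ} (hi : S.Idx c i)
    (hx : S.Val c x) : S.MemOK (μ.write c i x) := by
  refine ⟨fun p hp => ?_, fun c' i' => ?_⟩
  · rcases Finset.mem_insert.1 hp with rfl | hp
    · exact hi
    · exact h.1 p hp
  · simp only [Mem.write]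
    split_ifs with hc
    · rw [hc.1]; exact hx
    · exact h.2 _ _

/-- The accounting of `Cost` is correct. -/
lemma exec_of_cost {H : Hypergraph} (hS : S.Fits H) {p : Prog α} {t : ℕ} {Q : α → ℕ → Prop}
    (h : p.Cost S t Q) {μ : Mem} (hμ : S.MemOK μ) {r : Result α}
    (hr : r ∈ (p.exec H μ).support) :
    r.time ≤ t + 1 ∧ r.space ≤ S.space ∧ S.MemOK r.mem := by
  have hcharge : ∀ (μ : Mem) (hμ : S.MemOK μ) (t : ℕ), 1 ≤ t → ∀ x : Result α,
      x.time ≤ t - 1 + 1 ∧ x.space ≤ S.space ∧ S.MemOK x.mem →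
      (x.charge μ).time ≤ t + 1 ∧ (x.charge μ).space ≤ S.space ∧ S.MemOK (x.charge μ).mem := by
    intro μ hμ t ht x hx
    refine ⟨?_, max_le hμ.bits_le hx.2.1, hx.2.2⟩
    have := hx.1
    simp only [Result.charge]
    omega
  induction p generalizing t μ r with
  | ret a =>
    rw [exec, PMF.support_pure, Set.mem_singleton_iff] at hr
    subst hr
    exact ⟨by simp, hμ.bits_le, hμ⟩
  | fail =>
    rw [exec, PMF.support_pure, Set.mem_singleton_iff] at hr
    subst hr
    exact ⟨by simp, hμ.bits_le, hμ⟩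
  | degree v next ih =>
    rw [exec, PMF.support_map] at hr
    obtain ⟨x, hx, rfl⟩ := hr
    exact hcharge μ hμ t h.1 x
      (ih _ (h.2 _ ((Hypergraph.length_incidentList_le v).trans hS.degree_le)) hμ hx)
  | incident v i next ih =>
    rw [exec, PMF.support_map] at hr
    obtain ⟨x, hx, rfl⟩ := hr
    exact hcharge μ hμ t h.1 x (ih _ (h.2 _ (hS.incident_lt v i)) hμ hx)
  | member e j next ih =>
    rw [exec, PMF.support_map] at hr
    obtain ⟨x, hx, rfl⟩ := hr
    exact hcharge μ hμ t h.1 x (ih _ (h.2 _ (hS.member_lt e j)) hμ hx)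
  | load c i next ih =>
    rw [exec, PMF.support_map] at hr
    obtain ⟨x, hx, rfl⟩ := hr
    exact hcharge μ hμ t h.1 x (ih _ (h.2 _ (hμ.2 c i)) hμ hx)
  | store c i y next ih =>
    rw [exec, PMF.support_map] at hr
    obtain ⟨x, hx, rfl⟩ := hr
    exact hcharge μ hμ t h.1 x (ih h.2.2.2 (write_memOK hμ h.2.1 h.2.2.1) hx)
  | coin next ih =>
    rw [exec, PMF.support_bind] at hr
    simp only [Set.mem_iUnion, PMF.support_map] at hr
    obtain ⟨b, -, x, hx, rfl⟩ := hr
    exact hcharge μ hμ t h.1 x (ih _ (h.2 b) hμ hx)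

lemma Within.mono {p : Prog α} {T T' : ℕ} {Q Q' : α → Prop} (h : p.Within S T Q) (hT : T ≤ T')
    (hQ : ∀ a, Q a → Q' a) : p.Within S T' Q' := fun t ht =>
  cost_mono (h t (hT.trans ht)) fun a t' h' => ⟨by omega, hQ a h'.2⟩

lemma Within.le {p : Prog α} {T T' : ℕ} {Q : α → Prop} (h : p.Within S T Q) (hT : T ≤ T') :
    p.Within S T' Q := h.mono hT fun _ h => h

lemma within_ret {a : α} {Q : α → Prop} (h : Q a) (T : ℕ) : (ret a).Within S T Q :=
  fun t _ => ⟨Nat.le_add_right t T, h⟩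

lemma within_fail {Q : α → Prop} (T : ℕ) : (fail : Prog α).Within S T Q := fun _ _ => trivial

lemma within_step {p : Prog α} {Q : α → Prop} {T t : ℕ} (h : p.Within S T Q) (ht : T + 1 ≤ t) :
    p.Cost S (t - 1) fun a t' => t ≤ t' + (T + 1) ∧ Q a :=
  cost_mono (h (t - 1) (by omega)) fun a t' h' => ⟨by have := h'.1; omega, h'.2⟩

lemma within_degree {v : ℕ} {next : ℕ → Prog α} {Q : α → Prop} {T : ℕ}
    (h : ∀ x ≤ S.D, (next x).Within S T Q) : (degree v next).Within S (T + 1) Q :=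
  fun _ ht => ⟨by omega, fun x hx => within_step (h x hx) ht⟩

lemma within_incident {v i : ℕ} {next : ℕ → Prog α} {Q : α → Prop} {T : ℕ}
    (h : ∀ x < S.m, (next x).Within S T Q) : (incident v i next).Within S (T + 1) Q :=
  fun _ ht => ⟨by omega, fun x hx => within_step (h x hx) ht⟩

lemma within_member {e j : ℕ} {next : ℕ → Prog α} {Q : α → Prop} {T : ℕ}
    (h : ∀ x < S.n, (next x).Within S T Q) : (member e j next).Within S (T + 1) Q :=
  fun _ ht => ⟨by omega, fun x hx => within_step (h x hx) ht⟩

lemma within_load {c : Region} {i : ℕ} {next : ℕ → Prog α} {Q : α → Prop} {T : ℕ}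
    (h : ∀ x, S.Val c x → (next x).Within S T Q) : (load c i next).Within S (T + 1) Q :=
  fun _ ht => ⟨by omega, fun x hx => within_step (h x hx) ht⟩

lemma within_store {c : Region} {i x : ℕ} {next : Prog α} {Q : α → Prop} {T : ℕ}
    (hi : S.Idx c i) (hx : S.Val c x) (h : next.Within S T Q) :
    (store c i x next).Within S (T + 1) Q :=
  fun _ ht => ⟨by omega, hi, hx, within_step h ht⟩

lemma within_coin {next : Bool → Prog α} {Q : α → Prop} {T : ℕ}
    (h : ∀ b, (next b).Within S T Q) : (coin next).Within S (T + 1) Q :=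
  fun _ ht => ⟨by omega, fun b => within_step (h b) ht⟩

lemma Within.bind {p : Prog α} {g : α → Prog β} {Q : α → Prop} {Q' : β → Prop} {T T' : ℕ}
    (h : p.Within S T Q) (h' : ∀ a, Q a → (g a).Within S T' Q') :
    (p.bind g).Within S (T + T') Q' := fun t ht =>
  cost_bind (cost_mono (h t (by omega)) fun a t' ha =>
    cost_mono (h' a ha.2 t' (by have := ha.1; omega)) fun b t'' hb =>
      ⟨by have := ha.1; have := hb.1; omega, hb.2⟩)

end Prog

/-! ### Time bounds for the parts of the base algorithm -/

namespace Base

open Prog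

variable {S : Sizes} {p : Params} {σ : Type}

/-- The invariant `I` of a loop has a counter; each execution of the body increases it by at most `g`,
and it never exceeds `B`. -/
lemma within_forMembers {e : ℕ} {body : σ → ℕ → Prog σ} {T B : ℕ} {I : ℕ → σ → Prop} (g : ℕ)
    (h : ∀ i x v, i + g ≤ B → v < S.n → I i x → (body x v).Within S T (I (i + g))) (j : ℕ) :
    ∀ i x, i + j * g ≤ B → I i x →
      (forMembers e body j x).Within S (j * (1 + T)) (I (i + j * g)) := by
  induction j with
  | zero => intro i x _ hx; exact within_ret (by simpa using hx) _
  | succ j ih =>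
    intro i x hB hx
    have e1 : i + (j + 1) * g = i + g + j * g := by ring
    rw [e1] at hB ⊢
    rw [forMembers]
    exact (within_member fun v hv => (h i x v (by omega) hv hx).bind fun y hy =>
      ih _ y hB hy).le (by ring_nf; omega)

lemma within_forIncident {v : ℕ} {body : σ → ℕ → Prog σ} {T B : ℕ} {I : ℕ → σ → Prop}
    (h : ∀ i x e, i + 1 ≤ B → e < S.m → I i x → (body x e).Within S T (I (i + 1))) (j : ℕ) :
    ∀ i x, i + j ≤ B → I i x → (forIncident v body j x).Within S (j * (1 + T)) (I (i + j)) := by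
  induction j with
  | zero => intro i x _ hx; exact within_ret (by simpa using hx) _
  | succ j ih =>
    intro i x hB hx
    have e1 : i + (j + 1) = i + 1 + j := by ring
    rw [e1] at hB ⊢
    rw [forIncident]
    exact (within_incident fun e he => (h i x e (by omega) he hx).bind fun y hy =>
      ih _ y hB hy).le (by ring_nf; omega)

lemma within_forNeighbors {f : ℕ} {body : σ → ℕ → Prog σ} {T : ℕ} {I : ℕ → σ → Prop} (g i : ℕ)
    (hmono : ∀ i j x, i ≤ j → I i x → I j x)
    (h : ∀ j x e, j + g ≤ i + p.k * S.D * g → e < S.m → I j x →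
      (body x e).Within S T (I (j + g))) (x : σ)
    (hx : I i x) :
    (forNeighbors p f body x).Within S (p.k * (2 + S.D * (1 + T))) (I (i + p.k * S.D * g)) := by
  have h1 := within_forMembers (S := S) (e := f) (T := S.D * (1 + T) + 1) (I := I)
    (body := fun y v => .degree v fun d => forIncident v body d y) (S.D * g)
    (B := i + p.k * S.D * g) (fun i' x v hB _ hx => by
      refine within_degree fun d hd => ?_
      have hdg : d * g ≤ S.D * g := Nat.mul_le_mul_right _ hd
      have h2 := within_forIncident (S := S) (v := v) (body := body) (T := T) (B := d)
        (I := fun j x => I (i' + j * g) x) (fun j x e hj he hx => by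
          have h3 : (j + 1) * g ≤ d * g := Nat.mul_le_mul_right _ hj
          have h4 : (j + 1) * g = j * g + g := by ring
          rw [h4, ← add_assoc]
          exact h _ x e (by omega) he hx) d 0 x (by omega) (by simpa using hx)
      exact h2.mono (Nat.mul_le_mul_right _ hd) fun y hy => hmono _ _ _ (by rw [zero_add]; omega) hy)
    p.k i x (by rw [mul_assoc]) hx
  rw [mul_assoc p.k]
  exact h1.le (le_of_eq (by ring))

lemma within_forArray {c : Region} {body : σ → ℕ → Prog σ} {T B : ℕ} {I : ℕ → σ → Prop} (g : ℕ)
    (h : ∀ i x e, i + g ≤ B → S.Val c e → I i x → (body x e).Within S T (I (i + g))) (j : ℕ) :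
    ∀ i x, i + j * g ≤ B → I i x →
      (forArray c body j x).Within S (j * (1 + T)) (I (i + j * g)) := by
  induction j with
  | zero => intro i x _ hx; exact within_ret (by simpa using hx) _
  | succ j ih =>
    intro i x hB hx
    have e1 : i + (j + 1) * g = i + g + j * g := by ring
    rw [e1] at hB ⊢
    rw [forArray]
    exact (within_load fun e he => (h i x e (by omega) he hx).bind fun y hy =>
      ih _ y hB hy).le (by ring_nf; omega)

lemma within_countColors (st g : ℕ) :
    (countColors p st g).Within S (3 * p.k) fun _ => True := by
  refine (within_forMembers (T := 2) (I := fun _ _ => True) (B := 0) 0 (fun _ x v _ _ _ => ?_) p.k 0 (0, 0)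
    (by simp) trivial).le (le_of_eq (by ring))
  refine within_load fun s _ => ?_
  split_ifs
  · exact within_load (T := 0) fun b _ => within_ret trivial _
  · exact within_ret trivial _

lemma within_kindOf (g : ℕ) : (kindOf p g).Within S (3 * p.k) fun _ => True := by
  refine ((within_countColors accepted g).bind (T' := 0) (Q' := fun _ => True) fun x _ => ?_).le
    le_rfl
  split_ifs <;> exact within_ret trivial _

/-- A bound for the time that it takes to find a bad edge at a vertex. -/
def findTime (k D : ℕ) : ℕ := 1 + D * (1 + 3 * k)

lemma within_findBad (v : ℕ) : (findBad p v).Within S (findTime p.k S.D) fun _ => True := by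
  refine (within_degree fun d hd => (within_forIncident (T := 3 * p.k) (I := fun _ _ => True) (B := d)
    (fun _ x e _ _ _ => ?_) d 0 none (by simp) trivial).le (Nat.mul_le_mul_right _ hd)).le
    (le_of_eq (add_comm _ _))
  exact ((within_kindOf e).bind (T' := 0) fun κ _ => within_ret trivial _).le le_rfl

lemma within_randomColor {v : ℕ} (hv : v < S.n) :
    (randomColor v).Within S 2 fun _ => True := by
  refine within_coin (T := 1) fun b => within_store (T := 0) (show S.Idx .color v from hv) ?_
    (within_ret trivial _)
  cases b <;> simp [Sizes.Val]

lemma within_processVertex {v : ℕ} (hv : v < S.n) :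
    (processVertex p v).Within S (findTime p.k S.D + 3) fun _ => True := by
  refine (within_findBad v).bind fun o _ => ?_
  split_ifs
  · exact (within_store (T := 0) (show S.Idx .status v from hv) (by simp [Sizes.Val])
        (within_ret trivial _)).le (by norm_num)
  · exact (within_randomColor hv).bind (T' := 1) fun _ _ =>
      within_store (T := 0) (show S.Idx .status v from hv) (by simp [Sizes.Val])
        (within_ret trivial _)

/-- A bound for the time that it takes to determine the status of an edge. -/
def statusTime (k D : ℕ) : ℕ := k * (5 + 3 * k + findTime k D) + 3 * k

lemma within_determineEdgeStatus (g : ℕ) :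
    (determineEdgeStatus p g).Within S (statusTime p.k S.D) fun _ => True := by
  refine ((within_forMembers (T := 4 + 3 * p.k + findTime p.k S.D) (I := fun _ _ => True) (B := 0)
    0 (fun _ x v _ hv _ => ?_) p.k 0 () (by simp) trivial).bind fun _ _ => within_kindOf g).le
    (le_of_eq (by rw [statusTime]; ring))
  refine (within_load (T := 3 * p.k + (findTime p.k S.D + 3)) fun s _ => ?_).le (by omega)
  split_ifs
  · refine (within_kindOf g).bind fun κ _ => ?_
    split_ifs
    · exact within_ret trivial _
    · exact within_processVertex hv
  · exact within_ret trivial _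

/-- The arrays `U`, `Q` and `X` have at most `M` elements, and `B` obeys its bound. -/
def SmallCounters (p : Params) (M : ℕ) (c : Counters) : Prop :=
  c.b ≤ p.compBound ∧ c.u ≤ M ∧ c.q ≤ M ∧ c.x ≤ M

lemma SmallCounters.mono {M M' : ℕ} {c : Counters} (h : SmallCounters p M c) (hM : M ≤ M') :
    SmallCounters p M' c :=
  ⟨h.1, h.2.1.trans hM, h.2.2.1.trans hM, h.2.2.2.trans hM⟩

lemma within_visitNeighbor {M : ℕ} (hM : M < S.L) {c : Counters} (hc : SmallCounters p M c)
    {g : ℕ} (hg : g < S.m) :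
    (visitNeighbor p c g).Within S (statusTime p.k S.D + 4) (SmallCounters p (M + 1)) := by
  obtain ⟨h1, h2, h3, h4⟩ := hc
  refine within_load (T := statusTime p.k S.D + 3) fun x _ => ?_
  split_ifs
  · exact within_ret ⟨h1, by omega, by omega, by omega⟩ _
  · refine within_store (T := statusTime p.k S.D + 2) hg (by simp [Sizes.Val]) ?_
    refine within_store (T := statusTime p.k S.D + 1) (h4.trans_lt hM) hg ?_
    refine (within_determineEdgeStatus g).bind fun κ _ => ?_
    cases κ
    · exact within_ret ⟨h1, by dsimp only; omega, by dsimp only; omega, by dsimp only; omega⟩ _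
    · exact within_store (T := 0) (h3.trans_lt hM) hg
        (within_ret ⟨h1, by dsimp only; omega, by dsimp only; omega, by dsimp only; omega⟩ _)
    · exact within_store (T := 0) (h2.trans_lt hM) hg
        (within_ret ⟨h1, by dsimp only; omega, by dsimp only; omega, by dsimp only; omega⟩ _)

/-- A bound for the time that it takes to visit all neighbors of a bad edge. -/
def visitTime (k D : ℕ) : ℕ := 2 + k * (2 + D * (5 + statusTime k D))

lemma within_expandBadComp (hβ : p.compBound < S.L) (fuel : ℕ) :
    ∀ {M : ℕ} (_ : M + fuel * (p.k * S.D) < S.L) {c : Counters} (_ : SmallCounters p M c),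
    (expandBadComp p fuel c).Within S (fuel * visitTime p.k S.D)
      (SmallCounters p (M + fuel * (p.k * S.D))) := by
  induction fuel with
  | zero => intro M _ c _; exact within_fail _
  | succ fuel ih =>
    intro M hM c hc
    have hM' : M + (fuel + 1) * (p.k * S.D) = M + p.k * S.D + fuel * (p.k * S.D) := by ring
    rw [hM'] at hM ⊢
    rw [expandBadComp]
    have hT : (fuel + 1) * visitTime p.k S.D =
        p.k * (2 + S.D * (1 + (statusTime p.k S.D + 4))) + fuel * visitTime p.k S.D + 1 + 1 := by
      rw [visitTime]; ring
    rw [hT]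
    split_ifs with h0 hb
    · exact within_ret (hc.mono (by omega)) _
    · exact within_load fun f hf => within_store (hc.1.trans_lt hβ) hf (within_fail _)
    · refine within_load fun f hf => within_store (hc.1.trans_lt hβ) hf ?_
      · refine (within_forNeighbors 1 M (I := SmallCounters p) (fun i j c hij h => h.mono hij)
          (fun j x e hj he hx => within_visitNeighbor (by omega) hx he) _ ?_).bind
            fun c' hc' => ih hM (by simpa using hc')
        obtain ⟨h1, h2, h3, h4⟩ := hc
        exact ⟨by dsimp only; omega, h2, by dsimp only; omega, h4⟩

/-- The number of elements that the arrays gain when a bad-component is expanded. -/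
def growth (p : Params) (D : ℕ) : ℕ := 1 + p.badFuel * (p.k * D)

lemma within_startBadComp (hβ : p.compBound < S.L) {M : ℕ} (hM : M + growth p S.D < S.L)
    {c : Counters} (hc : SmallCounters p M c) {g : ℕ} (hg : g < S.m) :
    (startBadComp p c g).Within S (3 + p.badFuel * visitTime p.k S.D)
      (SmallCounters p (M + growth p S.D)) := by
  obtain ⟨h1, h2, h3, h4⟩ := hc
  rw [growth] at hM ⊢
  rw [add_comm 3, ← add_assoc M]
  refine within_store hg (by simp [Sizes.Val]) <| within_store (?_ : c.x < S.L) hg <|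
    within_store (?_ : 0 < S.L) hg <| within_expandBadComp hβ _ (by omega)
      ⟨h1, by dsimp only; omega, by dsimp only; omega, by dsimp only; omega⟩
  · omega
  · omega

/-- A bound for the time that it takes to visit a neighbor of an unsafe edge. -/
def visitViaTime (p : Params) (D : ℕ) : ℕ :=
  4 + statusTime p.k D + p.badFuel * visitTime p.k D

lemma within_visitViaUnsafe (hβ : p.compBound < S.L) {M : ℕ} (hM : M + growth p S.D < S.L)
    {c : Counters} (hc : SmallCounters p M c) {g : ℕ} (hg : g < S.m) :
    (visitViaUnsafe p c g).Within S (visitViaTime p S.D)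
      (SmallCounters p (M + growth p S.D)) := by
  refine (within_load (T := statusTime p.k S.D + (3 + p.badFuel * visitTime p.k S.D))
    fun x _ => ?_).le (by rw [visitViaTime]; omega)
  split_ifs
  · exact within_ret (hc.mono (by omega)) _
  · refine (within_determineEdgeStatus g).bind fun κ _ => ?_
    split_ifs
    · exact within_startBadComp hβ hM hc hg
    · exact within_ret (hc.mono (by omega)) _

lemma within_expandViaUnsafe (hβ : p.compBound < S.L) (fuel : ℕ) :
    ∀ {M : ℕ} (_ : M + fuel * (p.k * S.D * growth p S.D) < S.L) {c : Counters}
      (_ : SmallCounters p M c),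
    (expandViaUnsafe p fuel c).Within S
      (fuel * (1 + p.k * (2 + S.D * (1 + visitViaTime p S.D))))
      (SmallCounters p (M + fuel * (p.k * S.D * growth p S.D))) := by
  induction fuel with
  | zero => intro M _ c _; exact within_fail _
  | succ fuel ih =>
    intro M hM c hc
    have hM' : M + (fuel + 1) * (p.k * S.D * growth p S.D) =
        M + p.k * S.D * growth p S.D + fuel * (p.k * S.D * growth p S.D) := by ring
    rw [hM'] at hM ⊢
    rw [expandViaUnsafe]
    split_ifs with h0
    · exact within_ret (hc.mono (by omega)) _
    · refine (within_load (T := p.k * (2 + S.D * (1 + visitViaTime p S.D)) +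
        fuel * (1 + p.k * (2 + S.D * (1 + visitViaTime p S.D)))) fun f _ => ?_).le
        (le_of_eq (by ring))
      refine (within_forNeighbors (growth p S.D) M (I := SmallCounters p)
        (fun i j c hij h => h.mono hij)
        (fun j x e hj he hx => within_visitViaUnsafe hβ (by omega) hx he) _ ?_).bind
          fun c' hc' => ih hM hc'
      obtain ⟨h1, h2, h3, h4⟩ := hc
      exact ⟨h1, by dsimp only; omega, h3, h4⟩

/-- A bound for the lengths of the arrays of edges while the final component is built. -/
def maxExplored (p : Params) (D : ℕ) : ℕ :=
  growth p D + p.unsafeFuel * (p.k * D * growth p D)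

/-- A bound for the time that it takes to build a final component. -/
def buildTime (p : Params) (D : ℕ) : ℕ :=
  findTime p.k D + (statusTime p.k D + (3 + p.badFuel * visitTime p.k D +
    p.unsafeFuel * (1 + p.k * (2 + D * (1 + visitViaTime p D)))))

lemma within_buildFinalComponent (hβ : p.compBound < S.L) (hL : maxExplored p S.D < S.L)
    (v : ℕ) :
    (buildFinalComponent p v).Within S (buildTime p S.D)
      (SmallCounters p (maxExplored p S.D)) := by
  rw [maxExplored] at hL ⊢
  have hfind : (findBad p v).Within S (findTime p.k S.D) fun o => ∀ g ∈ o, g < S.m := by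
    refine (within_degree fun d hd => (within_forIncident (T := 3 * p.k)
      (I := fun _ o => ∀ g ∈ o, g < S.m) (B := d)
      (fun _ x e _ he hx => ?_) d 0 none (by simp) (by simp)).le (Nat.mul_le_mul_right _ hd)).le
      (le_of_eq (add_comm _ _))
    refine ((within_kindOf e).bind (T' := 0) fun κ _ => within_ret ?_ _).le le_rfl
    split_ifs
    · simpa using he
    · exact hx
  refine hfind.bind fun o ho => ?_
  cases o with
  | none => exact within_fail _
  | some e =>
    refine (within_determineEdgeStatus e).bind fun _ _ => ?_
    refine (within_startBadComp hβ (M := 0) (by omega)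
      ⟨by simp, le_rfl, le_rfl, le_rfl⟩ (ho e rfl)).bind fun c hc => ?_
    rw [zero_add] at hc
    exact within_expandViaUnsafe hβ _ hL hc

/-- A bound for the number of edges of a final component. -/
def maxComp (p : Params) (D : ℕ) : ℕ := p.compBound * (1 + p.k * D)

lemma within_addToComp {c g : ℕ} (hc : c < S.L) (hg : g < S.m) :
    (addToComp c g).Within S 2 fun c' => c' = c + 1 :=
  within_store (T := 1) (show S.Idx .inComp g from hg) (by simp [Sizes.Val]) <|
    within_store (T := 0) (show S.Idx .arrC c from hc) (show S.Val .arrC g from hg) <|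
      within_ret (S := S) (Q := fun c' => c' = c + 1) rfl _

lemma within_collectEdges (hL : maxComp p S.D < S.L) {b : ℕ} (hb : b ≤ p.compBound) :
    (collectEdges p b).Within S (p.compBound * (3 + p.k * (2 + S.D * (4 + 3 * p.k))))
      fun c => c ≤ maxComp p S.D := by
  have hb' : b * (1 + p.k * S.D) ≤ maxComp p S.D := Nat.mul_le_mul_right _ hb
  refine (within_forArray (T := 2 + p.k * (2 + S.D * (1 + (3 + 3 * p.k))))
    (I := fun i c => c ≤ i) (B := maxComp p S.D) (1 + p.k * S.D) (fun i c f hi hf hc => ?_) b 0 0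
    (by simpa using hb') le_rfl).mono ?_ fun c hc => ?_
  · refine (within_addToComp (by omega) hf).bind fun c' hc' => ?_
    have h1 := within_forNeighbors (S := S) (p := p) (f := f) 1 (i + 1) (I := fun i c => c ≤ i)
      (body := fun c g => .load .inComp g fun flag =>
        if flag ≠ 0 then .ret c
        else do
          let κ ← kindOf p g
          if κ = .unsf then addToComp c g else .ret c) (T := 3 + 3 * p.k)
      (fun i j c hij h => h.trans hij) (fun j x e hj he hx => ?_) c' (by omega)
    · exact h1.mono le_rfl fun y hy => by simp only [mul_one] at hy; omega
    · simp only [mul_one] at hj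
      refine (within_load (T := 3 * p.k + 2) fun flag _ => ?_).le (by omega)
      split_ifs
      · exact within_ret (S := S) (Q := fun c => c ≤ j + 1) (by omega) _
      · refine (within_kindOf e).bind fun κ _ => ?_
        split_ifs
        · exact (within_addToComp (by omega) he).mono le_rfl fun y hy => by omega
        · exact within_ret (S := S) (Q := fun c => c ≤ j + 1) (by omega) _
  · exact (Nat.mul_le_mul_right _ hb).trans (le_of_eq (by ring))
  · rw [zero_add] at hc
    exact hc.trans hb'

lemma within_resampleEdge (f : ℕ) :
    (resampleEdge p f).Within S (4 * p.k) fun _ => True := by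
  refine (within_forMembers (T := 3) (I := fun _ _ => True) (B := 0)
    0 (fun _ x v _ hv _ => ?_) p.k 0 () (by simp) trivial).le (le_of_eq (by ring))
  refine within_load (T := 2) fun s _ => ?_
  split_ifs
  · exact within_randomColor hv
  · exact within_ret trivial _

/-- The time is charged to the entries that are removed from the list. -/
lemma cost_findMonochromatic (w : ℕ) : ∀ t, (1 + 3 * p.k) * w ≤ t →
    (findMonochromatic p w).Cost S t fun o t' => t ≤ t' + (1 + 3 * p.k) * w ∧ ∀ x ∈ o,
      x.2 < w ∧ x.1 < S.m ∧ t ≤ t' + (1 + 3 * p.k) * (w - x.2) := by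
  induction w with
  | zero => intro t _; exact ⟨by simp, fun x hx => by simp at hx⟩
  | succ w ih =>
    intro t ht
    rw [mul_add, mul_one] at ht ⊢
    refine ⟨by omega, fun f hf => ?_⟩
    refine cost_bind (cost_mono (within_countColors (p := p) troubled f _ (by omega)) ?_)
    rintro x t' ⟨ht', -⟩
    split_ifs
    · refine ⟨by omega, ?_⟩
      rintro y hy
      obtain rfl := Option.mem_some.1 hy
      refine ⟨Nat.lt_succ_self w, hf, ?_⟩
      rw [show w + 1 - w = 1 by omega]
      omega
    · refine cost_mono (ih t' (by omega)) fun o t'' h => ⟨by have := h.1; omega, fun y hy => ?_⟩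
      obtain ⟨h1, h2, h3⟩ := h.2 y hy
      refine ⟨by omega, h2, ?_⟩
      rw [show w + 1 - y.2 = w - y.2 + 1 by omega, mul_add, mul_one]
      omega

/-- A bound for the time of a resampling step, without the search for the edge but including the
later search among the new entries of the list. -/
def stepTime (k D : ℕ) : ℕ := 4 * k + k * (2 + 3 * D) + (1 + 3 * k) * (k * D)

lemma within_resample (s : ℕ) : ∀ w, w + s * (p.k * S.D) < S.L →
    (resample p s w).Within S (stepTime p.k S.D * s + (1 + 3 * p.k) * w) fun _ => True := by
  induction s with
  | zero => intro w _; exact within_ret trivial _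
  | succ s ih =>
    intro w hw t ht
    rw [add_mul, one_mul] at hw
    rw [mul_add, mul_one] at ht ⊢
    refine cost_bind (cost_mono (cost_findMonochromatic w t (by omega)) ?_)
    rintro (- | ⟨f, w'⟩) t' ⟨ho, ho'⟩
    · exact ⟨by omega, trivial⟩
    · obtain ⟨h1, h2, h3⟩ := ho' _ rfl
      dsimp only at h1 h2 h3
      have h4 : (1 + 3 * p.k) * (w - w') + (1 + 3 * p.k) * w' = (1 + 3 * p.k) * w := by
        rw [← mul_add, Nat.sub_add_cancel h1.le]
      have h5 : (1 + 3 * p.k) * (w' + p.k * S.D) =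
          (1 + 3 * p.k) * w' + (1 + 3 * p.k) * (p.k * S.D) := mul_add _ _ _
      have h6 : stepTime p.k S.D =
        4 * p.k + p.k * (2 + 3 * S.D) + (1 + 3 * p.k) * (p.k * S.D) := rfl
      have h7 : p.k * (2 + S.D * (1 + 2)) = p.k * (2 + 3 * S.D) := by ring
      have hn : ((forNeighbors p f (fun w g => .load .inComp g fun flag =>
          if flag ≠ 0 then .store .arrW w g (.ret (w + 1)) else .ret w) w').bind
          fun w'' => resample p s w'').Within S (p.k * (2 + S.D * (1 + 2)) +
            (stepTime p.k S.D * s + (1 + 3 * p.k) * (w' + p.k * S.D))) fun _ => True := by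
        refine (within_forNeighbors 1 w' (I := fun i w => w ≤ i) (fun i j c hij h => h.trans hij)
          (fun j x e hj he hx => ?_) w' le_rfl).bind fun w'' hw'' => ?_
        · refine within_load (T := 1) fun flag _ => ?_
          split_ifs
          · exact within_store (T := 0) (show S.Idx .arrW x by
              simp only [mul_one] at hj
              change x < S.L
              omega) (show S.Val .arrW e from he) (within_ret (S := S) (by omega) _)
          · exact within_ret (S := S) (Q := fun c => c ≤ j + 1) (by omega) _
        · simp only [mul_one] at hw''
          refine (ih w'' (by omega)).le ?_
          exact Nat.add_le_add_left (Nat.mul_le_mul_left _ hw'') _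
      refine cost_mono (((within_resampleEdge f).bind fun _ _ => hn) t' (by omega)) ?_
      rintro b t'' ⟨h8, -⟩
      exact ⟨by omega, trivial⟩

/-- A bound for the time of a trial for `c` edges and `s` steps. -/
def trialTime (k D c s : ℕ) : ℕ := c * (3 + 7 * k) + stepTime k D * s

lemma within_trial {c : ℕ} (hL : c + p.steps c * (p.k * S.D) < S.L) :
    (trial p c).Within S (trialTime p.k S.D c (p.steps c)) fun _ => True := by
  have h1 : (forArray .arrC (fun w f => do
      resampleEdge p f
      .store .arrW w f (.ret (w + 1))) c 0).Within S (c * (1 + (4 * p.k + 1)))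
      fun w => w = 0 + c * 1 := by
    refine within_forArray (I := fun i w => w = i) (B := c) 1 (fun i w f hi hf hw => ?_) c 0 0
      (by simp) rfl
    refine (within_resampleEdge f).bind fun _ _ => ?_
    refine within_store (T := 0) (show S.Idx .arrW w by change w < S.L; omega)
      (show S.Val .arrW f from hf) (within_ret (S := S) (by omega) _)
  refine (h1.bind fun w hw => ?_).le
    (?_ : _ + (stepTime p.k S.D * p.steps c + (1 + 3 * p.k) * c) ≤ _)
  · obtain rfl : w = c := by omega
    exact within_resample _ _ hL
  · rw [trialTime]
    exact le_of_eq (by ring)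

lemma steps_le (p : Params) (c : ℕ) : p.steps c ≤ 2 * c := by
  rw [Params.steps, Nat.ceil_le]
  have h1 : (1 : ℚ) ≤ (max p.Δ 1 : ℕ) := by exact_mod_cast le_max_right _ _
  rw [div_le_iff₀ (by linarith)]
  push_cast at h1 ⊢
  have h2 : (0 : ℚ) ≤ 2 * c := by positivity
  nlinarith

lemma within_trialLoop {c T : ℕ} (hT : (trial p c).Within S T fun _ => True) (i : ℕ) :
    (trialLoop p c i).Within S (i * T) fun _ => True := by
  induction i with
  | zero => exact within_fail _
  | succ i ih =>
    refine (hT.bind (T' := i * T) fun b _ => ?_).le (le_of_eq (by ring))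
    split_ifs
    · exact within_ret trivial _
    · exact ih

/-- A bound for the time that it takes to color a final component. -/
def colorTime (p : Params) (D : ℕ) : ℕ :=
  p.compBound * (3 + p.k * (2 + D * (4 + 3 * p.k))) +
    (p.trials * trialTime p.k D (maxComp p D) (2 * maxComp p D) +
      (maxComp p D * (2 + 3 * p.k) + maxExplored p D * 2))

lemma within_colorFinalComponent
    (hL : maxComp p S.D + 2 * maxComp p S.D * (p.k * S.D) < S.L) {c : Counters}
    (hc : SmallCounters p (maxExplored p S.D) c) :
    (colorFinalComponent p c).Within S (colorTime p S.D) fun _ => True := by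
  refine (within_collectEdges (by omega) hc.1).bind fun l hl => ?_
  have hs : p.steps l ≤ 2 * maxComp p S.D := (steps_le p l).trans (Nat.mul_le_mul_left _ hl)
  have ht : (trial p l).Within S (trialTime p.k S.D (maxComp p S.D) (2 * maxComp p S.D))
      fun _ => True := by
    refine (within_trial ?_).le ?_
    · have := Nat.mul_le_mul_right (p.k * S.D) hs
      omega
    · exact Nat.add_le_add (Nat.mul_le_mul_right _ hl) (Nat.mul_le_mul_left _ hs)
  refine (within_trialLoop ht _).bind fun _ _ => ?_
  refine Within.bind (Q := fun _ => True) ?_ fun _ _ => ?_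
  · refine (within_forArray (T := 1 + 3 * p.k) (I := fun _ _ => True) (B := 0) 0
      (fun _ _ f _ hf _ => ?_) l 0 () (by simp) trivial).le ?_
    · refine (within_store (T := 3 * p.k) (show S.Idx .inComp f from hf) (by simp [Sizes.Val])
        ((within_forMembers (T := 2) (I := fun _ _ => True) (B := 0) 0 (fun _ x v _ hv _ => ?_)
          p.k 0 () (by simp) trivial).le (le_of_eq (by ring)))).le (le_of_eq (by ring))
      refine within_load (T := 1) fun s _ => ?_
      split_ifs
      · exact within_store (T := 0) (show S.Idx .status v from hv) (by simp [Sizes.Val])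
          (within_ret trivial _)
      · exact within_ret trivial _
    · refine (Nat.mul_le_mul_right _ hl).trans (le_of_eq (by ring))
  · refine (within_forArray (T := 1) (I := fun _ _ => True) (B := 0) 0
      (fun _ _ f _ hf _ => ?_) c.x 0 () (by simp) trivial).le (Nat.mul_le_mul_right _ hc.2.2.2)
    exact within_store (T := 0) (show S.Idx .explored f from hf) (by simp [Sizes.Val])
      (within_ret trivial _)

lemma bind_assoc {α β γ : Type} (q : Prog α) (g : α → Prog β) (h : β → Prog γ) :
    (q.bind g).bind h = q.bind fun a => (g a).bind h := by
  induction q with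
  | ret a => rfl
  | fail => rfl
  | degree v next ih => exact congrArg _ (funext fun x => ih x)
  | incident v i next ih => exact congrArg _ (funext fun x => ih x)
  | member e j next ih => exact congrArg _ (funext fun x => ih x)
  | load c i next ih => exact congrArg _ (funext fun x => ih x)
  | store c i x next ih => exact congrArg _ ih
  | coin next ih => exact congrArg _ (funext fun x => ih x)

/-- The main function without the join points of the `do` notation. -/
lemma query_eq (p : Params) (v : ℕ) : query p v = .load .status v fun s =>
    (if s = uncolored then processVertex p v else .ret ()).bind fun _ =>
      .load .status v fun s' =>
        (if s' = troubled then (buildFinalComponent p v).bind (colorFinalComponent p)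
          else .ret ()).bind fun _ => .load .color v fun b => .ret (decide (b ≠ 0)) := by
  rw [query]
  congr 1
  funext s
  have h : ∀ s', (if s' = troubled then
      (buildFinalComponent p v).bind fun n => (colorFinalComponent p n).bind fun _ =>
        .load .color v fun b => .ret (decide (b ≠ 0))
      else (.ret () : Prog Unit).bind fun _ => .load .color v fun b => .ret (decide (b ≠ 0))) =
      (if s' = troubled then (buildFinalComponent p v).bind (colorFinalComponent p)
        else .ret ()).bind fun _ => .load .color v fun b => .ret (decide (b ≠ 0)) := fun s' => by
    split_ifs
    · rw [bind_assoc]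
    · rfl
  simp only [Prog.bind_def, h]
  split_ifs <;> rfl

/-- A bound for the time of a query. -/
def queryTime (p : Params) (D : ℕ) : ℕ :=
  findTime p.k D + 6 + buildTime p D + colorTime p D

lemma within_query (hβ : p.compBound < S.L) (hL : maxExplored p S.D < S.L)
    (hL' : maxComp p S.D + 2 * maxComp p S.D * (p.k * S.D) < S.L) {v : ℕ} (hv : v < S.n) :
    (query p v).Within S (queryTime p S.D) fun _ => True := by
  rw [query_eq]
  refine (within_load (T := findTime p.k S.D + 3 + (buildTime p S.D + colorTime p S.D + 1 + 1))
    fun s _ => ?_).le (by rw [queryTime]; omega)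
  refine Within.bind (Q := fun _ => True) ?_ fun _ _ => ?_
  · split_ifs
    · exact within_processVertex hv
    · exact within_ret trivial _
  · refine within_load fun s' _ => Within.bind (Q := fun _ => True) ?_ fun _ _ =>
      within_load (T := 0) fun b _ => within_ret trivial _
    split_ifs
    · exact (within_buildFinalComponent hβ hL v).bind fun c hc =>
        within_colorFinalComponent hL' hc
    · exact within_ret trivial _

/-- The constant in the bound for the time of a query. -/
def timeConst (k D : ℕ) : ℕ :=
  findTime k D + 6 + (findTime k D + statusTime k D + 3 + visitTime k D +
    D * (1 + k * (2 + D * (5 + statusTime k D + visitTime k D)))) +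
  ((3 + k * (2 + D * (4 + 3 * k))) + (1 + k * D) * (3 + 7 * k + 2 * stepTime k D) +
    (1 + k * D) * (2 + 3 * k) + 2 * ((1 + k * D) * (1 + D * (k * D))))

/-- The constant in the bound for the lengths of the arrays. -/
def lengthConst (k D : ℕ) : ℕ :=
  (1 + k * D) * (1 + D * (k * D)) + (1 + k * D) * (1 + 2 * (k * D)) + 1

section Constants

variable {b D : ℕ}

lemma growth_le (hb : p.compBound + 2 ≤ b) : growth p D ≤ b * (1 + p.k * D) := by
  have := Nat.mul_le_mul_right (p.k * D) (show p.badFuel ≤ b from hb)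
  rw [growth, mul_add]
  omega

lemma unsafeFuel_le (hb : p.compBound + 2 ≤ b) (hD : p.Δ + 1 ≤ D) : p.unsafeFuel ≤ D * b :=
  calc p.Δ * p.compBound + 2 ≤ p.Δ * b + b :=
        Nat.add_le_add (Nat.mul_le_mul_left _ (by omega)) (by omega)
    _ = (p.Δ + 1) * b := by ring
    _ ≤ D * b := Nat.mul_le_mul_right _ hD

lemma maxComp_le (hb : p.compBound + 2 ≤ b) : maxComp p D ≤ b * (1 + p.k * D) :=
  Nat.mul_le_mul_right _ (by omega)

lemma maxExplored_le (hb : p.compBound + 2 ≤ b) (hD : p.Δ + 1 ≤ D) :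
    maxExplored p D ≤ (1 + p.k * D) * (1 + D * (p.k * D)) * b ^ 2 := by
  have hb1 : b ≤ b ^ 2 := Nat.le_self_pow (by norm_num) b
  calc maxExplored p D ≤ b * (1 + p.k * D) + D * b * (p.k * D * (b * (1 + p.k * D))) := by
        rw [maxExplored]
        have := growth_le (D := D) hb
        have := unsafeFuel_le hb hD
        gcongr
    _ ≤ b ^ 2 * (1 + p.k * D) + D * b * (p.k * D * (b * (1 + p.k * D))) := by gcongr
    _ = _ := by ring

lemma buildTime_le (hb : p.compBound + 2 ≤ b) (hD : p.Δ + 1 ≤ D) :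
    buildTime p D ≤ (findTime p.k D + statusTime p.k D + 3 + visitTime p.k D +
      D * (1 + p.k * (2 + D * (5 + statusTime p.k D + visitTime p.k D)))) * b ^ 2 := by
  have hb1 : b ≤ b ^ 2 := Nat.le_self_pow (by norm_num) b
  have hb0 : 1 ≤ b := by omega
  have hb2 : 1 ≤ b ^ 2 := hb0.trans hb1
  have hfuel : p.badFuel ≤ b := hb
  have hv : visitViaTime p D ≤ b * (4 + statusTime p.k D + visitTime p.k D) := by
    rw [visitViaTime]
    calc 4 + statusTime p.k D + p.badFuel * visitTime p.k D
        ≤ (4 + statusTime p.k D) * b + b * visitTime p.k D :=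
          Nat.add_le_add (Nat.le_mul_of_pos_right _ hb0) (Nat.mul_le_mul_right _ hfuel)
      _ = _ := by ring
  have hu : p.unsafeFuel * (1 + p.k * (2 + D * (1 + visitViaTime p D))) ≤
      D * (1 + p.k * (2 + D * (5 + statusTime p.k D + visitTime p.k D))) * b ^ 2 :=
    calc p.unsafeFuel * (1 + p.k * (2 + D * (1 + visitViaTime p D)))
        ≤ D * b * (1 * b + p.k * (2 * b + D * (1 * b +
            b * (4 + statusTime p.k D + visitTime p.k D)))) := by
          have h1 := unsafeFuel_le hb hD
          gcongr
          all_goals omega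
      _ = _ := by ring
  rw [buildTime]
  calc findTime p.k D + (statusTime p.k D + (3 + p.badFuel * visitTime p.k D +
        p.unsafeFuel * (1 + p.k * (2 + D * (1 + visitViaTime p D)))))
      ≤ findTime p.k D * b ^ 2 + (statusTime p.k D * b ^ 2 + (3 * b ^ 2 +
        b ^ 2 * visitTime p.k D +
        D * (1 + p.k * (2 + D * (5 + statusTime p.k D + visitTime p.k D))) * b ^ 2)) := by
        gcongr
        · exact Nat.le_mul_of_pos_right _ hb2
        · exact Nat.le_mul_of_pos_right _ hb2
        · omega
        · omega
    _ = _ := by ring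

lemma colorTime_le (hb : p.compBound + 2 ≤ b) (ht : p.trials ≤ b) (hD : p.Δ + 1 ≤ D) :
    colorTime p D ≤ ((3 + p.k * (2 + D * (4 + 3 * p.k))) +
      (1 + p.k * D) * (3 + 7 * p.k + 2 * stepTime p.k D) + (1 + p.k * D) * (2 + 3 * p.k) +
      2 * ((1 + p.k * D) * (1 + D * (p.k * D)))) * b ^ 2 := by
  have hb1 : b ≤ b ^ 2 := Nat.le_self_pow (by norm_num) b
  have hc := maxComp_le (D := D) hb
  have hX := maxExplored_le hb hD
  have hβ : p.compBound ≤ b ^ 2 := by omega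
  have hc2 : maxComp p D ≤ b ^ 2 * (1 + p.k * D) := hc.trans (Nat.mul_le_mul_right _ hb1)
  have htr : trialTime p.k D (maxComp p D) (2 * maxComp p D) ≤
      b * (1 + p.k * D) * (3 + 7 * p.k + 2 * stepTime p.k D) := by
    calc trialTime p.k D (maxComp p D) (2 * maxComp p D)
        = maxComp p D * (3 + 7 * p.k + 2 * stepTime p.k D) := by rw [trialTime]; ring
      _ ≤ _ := by gcongr
  rw [colorTime]
  calc p.compBound * (3 + p.k * (2 + D * (4 + 3 * p.k))) +
        (p.trials * trialTime p.k D (maxComp p D) (2 * maxComp p D) +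
          (maxComp p D * (2 + 3 * p.k) + maxExplored p D * 2))
      ≤ b ^ 2 * (3 + p.k * (2 + D * (4 + 3 * p.k))) +
        (b * (b * (1 + p.k * D) * (3 + 7 * p.k + 2 * stepTime p.k D)) +
          (b ^ 2 * (1 + p.k * D) * (2 + 3 * p.k) +
            (1 + p.k * D) * (1 + D * (p.k * D)) * b ^ 2 * 2)) := by gcongr
    _ = _ := by ring

lemma queryTime_le (hb : p.compBound + 2 ≤ b) (ht : p.trials ≤ b) (hD : p.Δ + 1 ≤ D) :
    queryTime p D ≤ timeConst p.k D * b ^ 2 := by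
  have hb2 : 1 ≤ b ^ 2 := Nat.one_le_pow _ _ (by omega)
  have h1 := buildTime_le hb hD
  have h2 := colorTime_le hb ht hD
  have h3 : findTime p.k D + 6 ≤ (findTime p.k D + 6) * b ^ 2 := Nat.le_mul_of_pos_right _ hb2
  rw [queryTime, timeConst, add_mul, add_mul]
  omega

lemma lt_lengthConst (hb : p.compBound + 2 ≤ b) (hD : p.Δ + 1 ≤ D) :
    p.compBound < lengthConst p.k D * b ^ 2 ∧ maxExplored p D < lengthConst p.k D * b ^ 2 ∧
      maxComp p D + 2 * maxComp p D * (p.k * D) < lengthConst p.k D * b ^ 2 := by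
  have hb1 : b ≤ b ^ 2 := Nat.le_self_pow (by norm_num) b
  have hX := maxExplored_le hb hD
  have hc := maxComp_le (D := D) hb
  have hC : maxComp p D + 2 * maxComp p D * (p.k * D) ≤
      (1 + p.k * D) * (1 + 2 * (p.k * D)) * b ^ 2 :=
    calc maxComp p D + 2 * maxComp p D * (p.k * D)
        = maxComp p D * (1 + 2 * (p.k * D)) := by ring
      _ ≤ b ^ 2 * (1 + p.k * D) * (1 + 2 * (p.k * D)) := by
          gcongr
          exact hc.trans (Nat.mul_le_mul_right _ hb1)
      _ = _ := by ring
  rw [lengthConst, add_mul, add_mul, one_mul]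
  exact ⟨by omega, by omega, by omega⟩

end Constants

end Base

/-! ### Loops over vertices and edges -/

namespace Prog

variable {α σ : Type} {H : Hypergraph}

/-- A deterministic execution with the postcondition `Q`. -/
def DetPost (H : Hypergraph) (p : Prog α) (Q : α → Mem → Prop) (μ : Mem) : Prop :=
  ∃ a μ', p.Det H μ a μ' ∧ Q a μ'

/-- The laws of a predicate transformer `W` on which the rules for loops rest. -/
structure LoopLogic (H : Hypergraph) (W : Prog σ → (σ → Mem → Prop) → Mem → Prop) : Prop where
  ret : ∀ {a Q μ}, Q a μ → W (ret a) Q μ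
  degree : ∀ {v next Q μ}, W (next (H.incidentList v).length) Q μ → W (degree v next) Q μ
  incident : ∀ {v i next Q μ}, W (next ((H.incidentList v).getD i 0)) Q μ →
    W (incident v i next) Q μ
  member : ∀ {e j next Q μ}, W (next ((H.memberList e).getD j 0)) Q μ → W (member e j next) Q μ
  load : ∀ {c i next Q μ}, W (next (μ.cell c i)) Q μ → W (load c i next) Q μ
  bind : ∀ {p : Prog σ} {g : σ → Prog σ} {Q μ}, W p (fun a μ' => W (g a) Q μ') μ →
    W (p.bind g) Q μ
  mono : ∀ {p : Prog σ} {Q Q' : σ → Mem → Prop} {μ}, W p Q μ → (∀ a μ', Q a μ' → Q' a μ') →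
    W p Q' μ

lemma loopLogic_detPost : LoopLogic H fun (p : Prog σ) Q μ => p.DetPost H Q μ where
  ret h := ⟨_, _, ⟨rfl, rfl⟩, h⟩
  degree h := h
  incident h := h
  member h := h
  load h := h
  bind := by
    rintro p g Q μ ⟨a, μ', h, b, μ'', h', hQ⟩
    exact ⟨b, μ'', h.bind h', hQ⟩
  mono := by
    rintro p Q Q' μ ⟨a, μ', h, hQ⟩ hmono
    exact ⟨a, μ', h, hmono _ _ hQ⟩

lemma DetPost.wp_bind {β : Type} {p : Prog α} {g : α → Prog β} {Q : α → Mem → Prop}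
    {Q' : β → Mem → Prop} {R : Mem → Prop} {μ : Mem} (h : p.DetPost H Q μ)
    (h' : ∀ a μ', Q a μ' → (g a).wp H Q' R μ') : (p.bind g).wp H Q' R μ := by
  obtain ⟨a, μ', h1, h2⟩ := h
  exact h1.wp_bind.2 (h' a μ' h2)

lemma DetPost.wp {p : Prog α} {Q : α → Mem → Prop} {R : Mem → Prop} {μ : Mem}
    (h : p.DetPost H Q μ) : p.wp H Q R μ := by
  obtain ⟨a, μ', h1, h2⟩ := h
  exact h1.wp_iff.2 h2

lemma DetPost.bind {β : Type} {p : Prog α} {g : α → Prog β} {Q : α → Mem → Prop}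
    {Q' : β → Mem → Prop} {μ : Mem} (h : p.DetPost H Q μ)
    (h' : ∀ a μ', Q a μ' → (g a).DetPost H Q' μ') : (p.bind g).DetPost H Q' μ := by
  obtain ⟨a, μ', h1, h2⟩ := h
  obtain ⟨b, μ'', h3, h4⟩ := h' a μ' h2
  exact ⟨b, μ'', h1.bind h3, h4⟩

lemma DetPost.mono {p : Prog α} {Q Q' : α → Mem → Prop} {μ : Mem} (h : p.DetPost H Q μ)
    (h' : ∀ a μ', Q a μ' → Q' a μ') : p.DetPost H Q' μ := by
  obtain ⟨a, μ', h1, h2⟩ := h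
  exact ⟨a, μ', h1, h' _ _ h2⟩

lemma detPost_ret {a : α} {Q : α → Mem → Prop} {μ : Mem} (h : Q a μ) :
    (ret a).DetPost H Q μ := ⟨a, μ, ⟨rfl, rfl⟩, h⟩

end Prog

namespace Hypergraph

variable {H : Hypergraph}

/-- The edges that intersect `f`, including `f` itself. -/
def nbhd (f : Fin H.m) : Finset (Fin H.m) :=
  Finset.univ.filter fun g => ¬ Disjoint (H.edge f) (H.edge g)

lemma mem_nbhd {f g : Fin H.m} : g ∈ nbhd f ↔ ¬ Disjoint (H.edge f) (H.edge g) := by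
  simp [nbhd]

lemma mem_nbhd_comm {f g : Fin H.m} : g ∈ nbhd f ↔ f ∈ nbhd g := by
  rw [mem_nbhd, mem_nbhd, disjoint_comm]

lemma mem_nbhd_of_mem {f g : Fin H.m} {v : Fin H.n} (hf : v ∈ H.edge f) (hg : v ∈ H.edge g) :
    g ∈ nbhd f := mem_nbhd.2 (Finset.not_disjoint_iff.2 ⟨v, hf, hg⟩)

lemma mem_nbrs_of_mem_nbhd {f g : Fin H.m} (h : g ∈ nbhd f) (hne : g ≠ f) : g ∈ H.nbrs f :=
  mem_nbrs.2 ⟨hne, mem_nbhd.1 h⟩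

lemma nbhd_eq_biUnion (f : Fin H.m) : nbhd f = (H.edge f).biUnion H.edgesAt := by
  ext g
  simp only [mem_nbhd, Finset.not_disjoint_iff, Finset.mem_biUnion, mem_edgesAt]

end Hypergraph

namespace Base

open Prog HypergraphLCA.Hypergraph

variable {H : Hypergraph} {p : Params} {σ : Type}
  {W : Prog σ → (σ → Mem → Prop) → Mem → Prop}

lemma getD_map_val {N : ℕ} (l : List (Fin N)) {i : ℕ} (h : i < l.length) :
    (l.map Fin.val).getD i 0 = (l[i] : ℕ) := by
  simp [List.getD_eq_getElem?_getD, h]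

/-- The invariant `I A` holds when the vertices in `A` have been visited. -/
lemma forMembers_rule (hW : LoopLogic H W) (hk : H.Uniform p.k) (e : Fin H.m)
    {body : σ → ℕ → Prog σ} (I : Finset (Fin H.n) → σ → Mem → Prop)
    (h : ∀ A x μ, ∀ v ∈ H.edge e, v ∉ A → I A x μ → W (body x v) (I (insert v A)) μ)
    {x : σ} {μ : Mem} (hx : I ∅ x μ) :
    W (forMembers e body p.k x) (I (H.edge e)) μ := by
  obtain ⟨l, hl, hs, he⟩ := exists_memberList e
  have hlen : l.length = p.k := by rw [← List.toFinset_card_of_nodup hl, hs, hk e]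
  have key : ∀ j, j ≤ l.length → ∀ x μ, I (l.drop j).toFinset x μ →
      W (forMembers e body j x) (I (H.edge e)) μ := by
    intro j
    induction j with
    | zero =>
      intro _ x μ hx
      rw [List.drop_zero, hs] at hx
      exact hW.ret hx
    | succ j ih =>
      intro hj x μ hx
      rw [forMembers]
      refine hW.member ?_
      rw [he, getD_map_val l (by omega)]
      have hd : l.drop j = l[j] :: l.drop (j + 1) := List.drop_eq_getElem_cons (by omega)
      have hnd : (l.drop j).Nodup := hl.sublist (List.drop_sublist _ _)
      rw [hd, List.nodup_cons] at hnd
      refine hW.bind ?_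
      have h1 := h _ x μ l[j] (by rw [← hs]; simp) (by simpa using hnd.1) hx
      have h2 : I (insert l[j] (l.drop (j + 1)).toFinset) = I (l.drop j).toFinset := by
        rw [hd, List.toFinset_cons]
      rw [h2] at h1
      exact hW.mono h1 fun y μ' hy => ih (by omega) y μ' hy
  rw [← hlen]
  exact key l.length le_rfl x μ (by simpa using hx)

/-- The invariant `I A` holds when the edges in `A` have been visited. -/
lemma forIncident_rule (hW : LoopLogic H W) (v : Fin H.n) {body : σ → ℕ → Prog σ}
    (I : Finset (Fin H.m) → σ → Mem → Prop)
    (h : ∀ A x μ, ∀ g ∈ H.edgesAt v, I A x μ → W (body x g) (I (insert g A)) μ)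
    {x : σ} {μ : Mem} (hx : I ∅ x μ) :
    W (.degree v fun d => forIncident v body d x) (I (H.edgesAt v)) μ := by
  obtain ⟨l, hl, hs, he⟩ := exists_incidentList v
  have key : ∀ j, j ≤ l.length → ∀ x μ, I (l.drop j).toFinset x μ →
      W (forIncident v body j x) (I (H.edgesAt v)) μ := by
    intro j
    induction j with
    | zero =>
      intro _ x μ hx
      rw [List.drop_zero, hs] at hx
      exact hW.ret hx
    | succ j ih =>
      intro hj x μ hx
      rw [forIncident]
      refine hW.incident ?_
      rw [he, getD_map_val l (by omega)]
      have hd : l.drop j = l[j] :: l.drop (j + 1) := List.drop_eq_getElem_cons (by omega)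
      refine hW.bind ?_
      have h1 := h _ x μ l[j] (by rw [← hs]; simp) hx
      have h2 : I (insert l[j] (l.drop (j + 1)).toFinset) = I (l.drop j).toFinset := by
        rw [hd, List.toFinset_cons]
      rw [h2] at h1
      exact hW.mono h1 fun y μ' hy => ih (by omega) y μ' hy
  refine hW.degree ?_
  rw [he, List.length_map]
  exact key l.length le_rfl x μ (by simpa using hx)

/-- The invariant `I A` holds when the edges in `A` have been visited. An edge may be visited more than
once. -/
lemma forNeighbors_rule (hW : LoopLogic H W) (hk : H.Uniform p.k) (f : Fin H.m)
    {body : σ → ℕ → Prog σ} (I : Finset (Fin H.m) → σ → Mem → Prop)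
    (h : ∀ A x μ, ∀ g ∈ nbhd f, I A x μ → W (body x g) (I (insert g A)) μ)
    {x : σ} {μ : Mem} (hx : I ∅ x μ) :
    W (forNeighbors p f body x) (I (nbhd f)) μ := by
  rw [nbhd_eq_biUnion]
  refine forMembers_rule hW hk f (fun A => I (A.biUnion H.edgesAt)) ?_ (by simpa using hx)
  intro A x μ v hv _ hx
  have := forIncident_rule hW v (body := body) (fun B => I (B ∪ A.biUnion H.edgesAt)) (x := x)
    (μ := μ) (fun B x μ g hg hx => by
      rw [Finset.insert_union]
      exact h _ x μ g (mem_nbhd_of_mem hv (mem_edgesAt.1 hg)) hx) (by simpa using hx)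
  rwa [Finset.biUnion_insert]

/-! ### The coloring stored in the memory -/

/-- The statuses and colors of the vertices that are stored in the memory. -/
def decode (H : Hypergraph) (μ : Mem) : Fin H.n → VStatus := fun v =>
  if μ.cell .status v = 0 then .uncolored
  else if μ.cell .status v = 1 then .accepted (decide (μ.cell .color v ≠ 0)) else .troubled

lemma decode_eq_uncolored {μ : Mem} {v : Fin H.n} :
    decode H μ v = .uncolored ↔ μ.cell .status v = 0 := by
  rw [decode]; split_ifs <;> simp_all

lemma decode_eq_accepted {μ : Mem} {v : Fin H.n} {b : Bool} :
    decode H μ v = .accepted b ↔ μ.cell .status v = 1 ∧ b = decide (μ.cell .color v ≠ 0) := by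
  rw [decode]
  split_ifs with h1 h2
  · simp [h1]
  · simp [h2, eq_comm]
  · simp [h2]

lemma decode_congr {μ μ' : Mem} (h1 : ∀ v : Fin H.n, μ'.cell .status v = μ.cell .status v)
    (h2 : ∀ v : Fin H.n, μ'.cell .color v = μ.cell .color v) : decode H μ' = decode H μ := by
  funext v; simp only [decode, h1, h2]

@[simp] lemma cell_write (μ : Mem) (c c' : Region) (i i' x : ℕ) :
    (μ.write c i x).cell c' i' = if c' = c ∧ i' = i then x else μ.cell c' i' := rfl

lemma decode_write {μ : Mem} {c : Region} (hs : c ≠ .status) (hc : c ≠ .color) (i x : ℕ) :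
    decode H (μ.write c i x) = decode H μ :=
  decode_congr (fun v => by simp [hs.symm]) (fun v => by simp [hc.symm])

lemma decode_write_troubled (μ : Mem) (v : Fin H.n) :
    decode H (μ.write .status v troubled) = Function.update (decode H μ) v .troubled := by
  funext w
  rcases eq_or_ne w v with rfl | h
  · simp [decode]
  · simp [decode, h, Fin.val_inj]

lemma decode_write_accepted (μ : Mem) (v : Fin H.n) (b : Bool) :
    decode H ((μ.write .color v b.toNat).write .status v accepted) =
      Function.update (decode H μ) v (.accepted b) := by
  funext w
  rcases eq_or_ne w v with rfl | h
  · simp [decode]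
  · simp [decode, h, Fin.val_inj]

lemma countColors_detPost (hk : H.Uniform p.k) (st : ℕ) (g : Fin H.m) (μ : Mem) :
    (countColors p st g).DetPost H (fun x μ' => μ' = μ ∧
      x.1 = ((H.edge g).filter fun v : Fin H.n =>
        μ.cell .status v = st ∧ μ.cell .color v = 0).card ∧
      x.2 = ((H.edge g).filter fun v : Fin H.n =>
        μ.cell .status v = st ∧ μ.cell .color v ≠ 0).card) μ := by
  refine forMembers_rule loopLogic_detPost hk g (fun A (x : ℕ × ℕ) μ' => μ' = μ ∧
      x.1 = (A.filter fun v : Fin H.n => μ.cell .status v = st ∧ μ.cell .color v = 0).card ∧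
      x.2 = (A.filter fun v : Fin H.n => μ.cell .status v = st ∧ μ.cell .color v ≠ 0).card) ?_
      ⟨rfl, by simp⟩
  rintro A x μ' v - hv ⟨rfl, hx1, hx2⟩
  refine LoopLogic.load loopLogic_detPost ?_
  have hn1 : ∀ P : Fin H.n → Prop, [DecidablePred P] → v ∉ A.filter P := fun P _ hc =>
    hv (Finset.mem_filter.1 hc).1
  simp only [Finset.filter_insert]
  by_cases h1 : μ'.cell .status v = st
  · rw [if_pos h1]
    refine LoopLogic.load loopLogic_detPost ?_
    by_cases h2 : μ'.cell .color v = 0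
    · simp only [h1, h2, if_true, true_and, not_true, if_false, ne_eq]
      refine detPost_ret ⟨rfl, ?_, ?_⟩
      · rw [Finset.card_insert_of_notMem (hn1 _), hx1]
      · rw [hx2]
    · simp only [h1, h2, if_true, true_and, not_false_eq_true, if_false, ne_eq]
      refine detPost_ret ⟨rfl, ?_, ?_⟩
      · rw [hx1]
      · rw [Finset.card_insert_of_notMem (hn1 _), hx2]
  · rw [if_neg h1]
    simp only [h1, false_and, if_false]
    exact detPost_ret ⟨rfl, hx1, hx2⟩

open Classical in
/-- The type of an edge for given statuses of the vertices. -/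
noncomputable def kindS (r : ℕ) (s : Fin H.n → VStatus) (e : Fin H.m) : Kind :=
  if Safe s e then .safe else if H.IsBad r s e then .bad else .unsf

lemma kindS_eq_safe {r : ℕ} {s : Fin H.n → VStatus} {e : Fin H.m} :
    kindS r s e = .safe ↔ Safe s e := by
  rw [kindS]; split_ifs <;> simp_all

lemma kindS_eq_bad {r : ℕ} {s : Fin H.n → VStatus} {e : Fin H.m} :
    kindS r s e = .bad ↔ H.IsBad r s e := by
  rw [kindS]; split_ifs <;> simp_all [isBad_iff]

lemma kindS_eq_unsf {r : ℕ} {s : Fin H.n → VStatus} {e : Fin H.m} :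
    kindS r s e = .unsf ↔ ¬ Safe s e ∧ ¬ H.IsBad r s e := by
  rw [kindS]; split_ifs <;> simp_all

lemma kindOf_detPost (hk : H.Uniform p.k) (g : Fin H.m) (μ : Mem) :
    (kindOf p g).DetPost H (fun κ μ' => μ' = μ ∧ κ = kindS p.threshold (decode H μ) g) μ := by
  rw [kindOf, Prog.bind_def]
  refine (countColors_detPost hk accepted g μ).bind ?_
  rintro x μ' ⟨rfl, h1, h2⟩
  have e1 : x.1 = (H.acceptedIn (decode H μ') g false).card := by
    rw [h1]; congr 1; ext v
    simp only [Finset.mem_filter, mem_acceptedIn, decode_eq_accepted]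
    simp
  have e2 : x.2 = (H.acceptedIn (decode H μ') g true).card := by
    rw [h2]; congr 1; ext v
    simp only [Finset.mem_filter, mem_acceptedIn, decode_eq_accepted]
    simp
  have hs : (0 < x.1 ∧ 0 < x.2) ↔ Safe (decode H μ') g := by
    rw [Safe, e1, e2, Finset.card_pos, Finset.card_pos, and_comm]
  have hb : x.1 + x.2 = numAcc (decode H μ') g := by rw [numAcc, e1, e2, add_comm]
  rw [hb]
  split_ifs with h3 h4
  · exact detPost_ret ⟨rfl, (kindS_eq_safe.2 (hs.1 h3)).symm⟩
  · exact detPost_ret ⟨rfl, (kindS_eq_bad.2 (isBad_iff.2 ⟨h4, fun h => h3 (hs.2 h)⟩)).symm⟩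
  · exact detPost_ret ⟨rfl, (kindS_eq_unsf.2 ⟨fun h => h3 (hs.2 h),
      fun h => h4 (isBad_iff.1 h).1⟩).symm⟩

lemma findBad_detPost (hk : H.Uniform p.k) (v : Fin H.n) (μ : Mem) :
    (findBad p v).DetPost H (fun o μ' => μ' = μ ∧
      (o = none → ∀ g ∈ H.edgesAt v, ¬ H.IsBad p.threshold (decode H μ) g) ∧
      ∀ g, o = some g → ∃ e : Fin H.m, e = g ∧ v ∈ H.edge e ∧
        H.IsBad p.threshold (decode H μ) e) μ := by
  refine forIncident_rule loopLogic_detPost v (fun A (o : Option ℕ) μ' => μ' = μ ∧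
      (o = none → ∀ g ∈ A, ¬ H.IsBad p.threshold (decode H μ) g) ∧
      ∀ g, o = some g → ∃ e : Fin H.m, e = g ∧ v ∈ H.edge e ∧
        H.IsBad p.threshold (decode H μ) e) ?_ ⟨rfl, by simp, by simp⟩
  rintro A o _ g hg ⟨rfl, h1, h2⟩
  rw [Prog.bind_def]
  refine (kindOf_detPost hk g _).bind ?_
  rintro κ _ ⟨rfl, hκ⟩
  refine detPost_ret ⟨rfl, ?_, ?_⟩
  · split_ifs with h
    · simp
    · intro ho e he
      rcases Finset.mem_insert.1 he with rfl | he
      · rwa [hκ, kindS_eq_bad] at h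
      · exact h1 ho e he
  · intro g' hg'
    split_ifs at hg' with h
    · obtain rfl : (g : ℕ) = g' := by simpa using hg'
      exact ⟨g, rfl, mem_edgesAt.1 hg, by rwa [hκ, kindS_eq_bad] at h⟩
    · exact h2 g' hg'

end Base

/-! ### The shattering phase of the base algorithm -/

namespace Base

open Prog HypergraphLCA.Hypergraph

variable {H : Hypergraph} {p : Params} {u : ℕ} {α β : Type}

/-- There is a satisfied witness structure of size `u + 1`. -/
def Overflow (H : Hypergraph) (p : Params) (u : ℕ) (μ : Mem) : Prop :=
  ∃ T, H.IsTree (u + 1) T ∧ ∀ e ∈ T, H.IsBad p.threshold (decode H μ) e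

/-- The potential of the current statuses of the vertices. -/
noncomputable def memPot (H : Hypergraph) (p : Params) (u : ℕ) (μ : Mem) : ℝ≥0∞ :=
  treePot p.threshold (u + 1) (decode H μ)

lemma Overflow.one_le {μ : Mem} (h : Overflow H p u μ) : 1 ≤ memPot H p u μ := by
  obtain ⟨T, hT, hbad⟩ := h
  exact one_le_treePot hT hbad

/-- Whatever the coin tosses are, `q` either ends successfully with the postcondition `Q`, or it
fails with a satisfied witness structure. Moreover the potential does not grow on average. -/
def Holds (H : Hypergraph) (p : Params) (u : ℕ) (q : Prog α) (Q : α → Mem → Prop) (μ : Mem) :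
    Prop :=
  q.wp H Q (Overflow H p u) μ ∧
    q.ev H (fun _ => memPot H p u) (memPot H p u) μ ≤ memPot H p u μ

lemma Holds.mono {q : Prog α} {Q Q' : α → Mem → Prop} {μ : Mem} (h : Holds H p u q Q μ)
    (h' : ∀ a μ', Q a μ' → Q' a μ') : Holds H p u q Q' μ := ⟨wp_post h.1 h', h.2⟩

lemma Holds.bind {q : Prog α} {g : α → Prog β} {Q : β → Mem → Prop} {μ : Mem}
    (h : Holds H p u q (fun a μ' => Holds H p u (g a) Q μ') μ) : Holds H p u (q.bind g) Q μ := by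
  refine ⟨(wp_bind _ _ _ _ _).2 (wp_post h.1 fun a μ' h => h.1), ?_⟩
  rw [ev_bind]
  exact (ev_le_ev h.1 (fun a μ' h => h.2) fun μ' _ => le_rfl).trans h.2

lemma holds_ret {a : α} {Q : α → Mem → Prop} {μ : Mem} (h : Q a μ) :
    Holds H p u (.ret a) Q μ := ⟨h, le_rfl⟩

lemma holds_store {q : Prog α} {Q : α → Mem → Prop} {μ : Mem} {c : Region} {i x : ℕ}
    (hs : c ≠ .status) (hc : c ≠ .color) (h : Holds H p u q Q (μ.write c i x)) :
    Holds H p u (.store c i x q) Q μ := by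
  refine ⟨h.1, h.2.trans_eq ?_⟩
  rw [memPot, memPot, decode_write hs hc]

lemma loopLogic_holds : LoopLogic H fun (q : Prog α) Q μ => Holds H p u q Q μ where
  ret := holds_ret
  degree h := h
  incident h := h
  member h := h
  load h := h
  bind := Holds.bind
  mono := Holds.mono

lemma holds_of_detPost {q : Prog α} {Q : α → Mem → Prop} {μ : Mem} (h : q.DetPost H Q μ)
    (hQ : ∀ a μ', Q a μ' → μ' = μ) : Holds H p u q Q μ := by
  refine ⟨h.wp, ?_⟩
  obtain ⟨a, μ', h1, h2⟩ := h
  rw [h1.ev_eq, hQ a μ' h2]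

/-- How the statuses can change while the algorithm processes vertices in the shattering phase: only
uncolored vertices change, and bad edges stay bad. -/
def Evo (r : ℕ) (s s' : Fin H.n → VStatus) : Prop :=
  (∀ v, s v ≠ .uncolored → s' v = s v) ∧ ∀ e, H.IsBad r s e → H.IsBad r s' e

lemma Evo.refl (r : ℕ) (s : Fin H.n → VStatus) : Evo r s s := ⟨fun _ _ => rfl, fun _ h => h⟩

lemma Evo.trans {r : ℕ} {s s' s'' : Fin H.n → VStatus} (h : Evo r s s') (h' : Evo r s' s'') :
    Evo r s s'' :=
  ⟨fun v hv => (h'.1 v (by rwa [h.1 v hv])).trans (h.1 v hv), fun e he => h'.2 e (h.2 e he)⟩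

/-- The status of `e` is determined: it is safe, or has no uncolored vertices. -/
def Settled (s : Fin H.n → VStatus) (e : Fin H.m) : Prop :=
  Safe s e ∨ ∀ v ∈ H.edge e, s v ≠ .uncolored

lemma Evo.safe {r : ℕ} {s s' : Fin H.n → VStatus} (h : Evo r s s') {e : Fin H.m}
    (he : Safe s e) : Safe s' e := by
  have key : ∀ b, (H.acceptedIn s e b).Nonempty → (H.acceptedIn s' e b).Nonempty := by
    rintro b ⟨v, hv⟩
    rw [mem_acceptedIn] at hv
    exact ⟨v, mem_acceptedIn.2 ⟨hv.1, by rw [h.1 v (by simp [hv.2]), hv.2]⟩⟩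
  exact ⟨key _ he.1, key _ he.2⟩

lemma Evo.acceptedIn {r : ℕ} {s s' : Fin H.n → VStatus} (h : Evo r s s') {e : Fin H.m}
    (he : ∀ v ∈ H.edge e, s v ≠ .uncolored) (b : Bool) :
    H.acceptedIn s' e b = H.acceptedIn s e b :=
  acceptedIn_congr b fun v hv => by rw [h.1 v (he v hv)]

lemma Evo.settled {r : ℕ} {s s' : Fin H.n → VStatus} (h : Evo r s s') {e : Fin H.m}
    (he : Settled s e) : Settled s' e :=
  he.imp h.safe fun hu v hv => by rw [h.1 v (hu v hv)]; exact hu v hv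

lemma Evo.safe_iff {r : ℕ} {s s' : Fin H.n → VStatus} (h : Evo r s s') {e : Fin H.m}
    (he : Settled s e) : Safe s' e ↔ Safe s e := by
  refine ⟨fun hs => ?_, h.safe⟩
  rcases he with he | he
  · exact he
  · simpa only [Safe, h.acceptedIn he] using hs

lemma Evo.isBad_iff {r : ℕ} {s s' : Fin H.n → VStatus} (h : Evo r s s') {e : Fin H.m}
    (he : Settled s e) : H.IsBad r s' e ↔ H.IsBad r s e := by
  refine ⟨fun hb => ?_, h.2 e⟩
  rcases he with he | he
  · exact absurd (h.safe he) (Hypergraph.isBad_iff.1 hb).2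
  · simpa only [IsBad, h.acceptedIn he] using hb

/-- Troubled vertices lie in bad edges, and edges that are not safe have at most `r` accepted
vertices. -/
structure Abs (r : ℕ) (s : Fin H.n → VStatus) : Prop where
  troubled : ∀ v, s v = .troubled → ∃ e, v ∈ H.edge e ∧ H.IsBad r s e
  numAcc_le : ∀ e, ¬ Safe s e → numAcc s e ≤ r

/-- Regions other than those for statuses and colors are unchanged. -/
def Same (μ μ' : Mem) : Prop :=
  ∀ c i, c ≠ .status → c ≠ .color → μ'.cell c i = μ.cell c i

/-- A memory that encodes a valid state of the shattering phase. -/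
def Good (H : Hypergraph) (p : Params) (μ : Mem) : Prop :=
  Abs p.threshold (decode H μ) ∧ ∀ v : Fin H.n, μ.cell .status v ≤ 2

/-- Possible effects of the shattering phase on the memory. -/
def Next (H : Hypergraph) (p : Params) (μ μ' : Mem) : Prop :=
  Good H p μ' ∧ Same μ μ' ∧ Evo p.threshold (decode H μ) (decode H μ')

lemma Next.refl {μ : Mem} (h : Good H p μ) : Next H p μ μ :=
  ⟨h, fun _ _ _ _ => rfl, Evo.refl _ _⟩

lemma Next.trans {μ μ' μ'' : Mem} (h : Next H p μ μ') (h' : Next H p μ' μ'') : Next H p μ μ'' :=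
  ⟨h'.1, fun c i hs hc => (h'.2.1 c i hs hc).trans (h.2.1 c i hs hc), h.2.2.trans h'.2.2⟩

lemma Evo.update_troubled {r : ℕ} {s : Fin H.n → VStatus} {v : Fin H.n} (hv : s v = .uncolored) :
    Evo r s (Function.update s v .troubled) := by
  refine ⟨fun w hw => Function.update_of_ne (by rintro rfl; exact hw hv) _ _, fun e he => ?_⟩
  simpa only [IsBad, acceptedIn_update_troubled hv] using he

lemma Abs.update_troubled {r : ℕ} {s : Fin H.n → VStatus} {v : Fin H.n} (h : Abs r s)
    (hv : s v = .uncolored) {e : Fin H.m} (hve : v ∈ H.edge e) (he : H.IsBad r s e) :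
    Abs r (Function.update s v .troubled) := by
  refine ⟨fun w hw => ?_, fun f hf => ?_⟩
  · rcases eq_or_ne w v with rfl | hne
    · exact ⟨e, hve, (Evo.update_troubled hv).2 e he⟩
    · rw [Function.update_of_ne hne] at hw
      obtain ⟨f, hf, hb⟩ := h.troubled w hw
      exact ⟨f, hf, (Evo.update_troubled hv).2 f hb⟩
  · simp only [Safe, numAcc, acceptedIn_update_troubled hv] at hf ⊢
    exact h.numAcc_le f hf

lemma Evo.update_accepted {r : ℕ} {s : Fin H.n → VStatus} {v : Fin H.n} (hv : s v = .uncolored)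
    (hbad : ∀ e, v ∈ H.edge e → ¬ H.IsBad r s e) (b : Bool) :
    Evo r s (Function.update s v (.accepted b)) := by
  refine ⟨fun w hw => Function.update_of_ne (by rintro rfl; exact hw hv) _ _, fun e he => ?_⟩
  have : v ∉ H.edge e := fun h => hbad e h he
  simpa only [IsBad, acceptedIn_update_accepted hv, this, false_and, if_false] using he

lemma Abs.update_accepted {r : ℕ} {s : Fin H.n → VStatus} {v : Fin H.n} (h : Abs r s)
    (hv : s v = .uncolored) (hbad : ∀ e, v ∈ H.edge e → ¬ H.IsBad r s e) (b : Bool) :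
    Abs r (Function.update s v (.accepted b)) := by
  have hevo := Evo.update_accepted hv hbad b
  refine ⟨fun w hw => ?_, fun f hf => ?_⟩
  · rcases eq_or_ne w v with rfl | hne
    · simp at hw
    · rw [Function.update_of_ne hne] at hw
      obtain ⟨f, hf, hb⟩ := h.troubled w hw
      exact ⟨f, hf, hevo.2 f hb⟩
  · have hf' : ¬ Safe s f := fun hs => hf (hevo.safe hs)
    by_cases hvf : v ∈ H.edge f
    · have hlt : numAcc s f < r := by
        by_contra hc
        exact hbad f hvf (Hypergraph.isBad_iff.2 ⟨not_lt.1 hc, hf'⟩)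
      have hvA : ∀ b, v ∉ H.acceptedIn s f b := fun b hb => by
        simp [mem_acceptedIn, hv] at hb
      simp only [numAcc, acceptedIn_update_accepted hv, hvf, true_and] at hlt ⊢
      cases b
      · simp only [Bool.false_eq_true, if_false, if_true, Finset.card_insert_of_notMem (hvA _)]
        omega
      · simp only [Bool.true_eq_false, if_false, if_true, Finset.card_insert_of_notMem (hvA _)]
        omega
    · simp only [numAcc, acceptedIn_update_accepted hv, hvf, false_and, if_false]
      exact h.numAcc_le f hf'

lemma processVertex_holds (hk : H.Uniform p.k) (v : Fin H.n) {μ : Mem} (hμ : Good H p μ)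
    (hv : decode H μ v = .uncolored) :
    Holds H p u (processVertex p v)
      (fun _ μ' => Next H p μ μ' ∧ decode H μ' v ≠ .uncolored) μ := by
  rw [processVertex, Prog.bind_def]
  refine Holds.bind ((holds_of_detPost (findBad_detPost hk v μ) fun _ _ h => h.1).mono ?_)
  rintro o μ' ⟨hμ', h1, h2⟩
  subst hμ'
  cases o with
  | some g =>
    obtain ⟨e, -, hve, he⟩ := h2 g rfl
    have hd := decode_write_troubled (H := H) μ' v
    refine ⟨⟨⟨⟨?_, fun w => ?_⟩, fun c i hs hc => ?_, ?_⟩, ?_⟩, ?_⟩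
    · rw [hd]; exact hμ.1.update_troubled hv hve he
    · simp only [cell_write]
      split_ifs
      exacts [le_rfl, hμ.2 w]
    · simp [hs]
    · rw [hd]; exact Evo.update_troubled hv
    · rw [hd]; simp
    · change memPot H p u (μ'.write .status v Base.troubled) ≤ _
      rw [memPot, memPot, hd, treePot_update_troubled hv]
  | none =>
    have hbad : ∀ e, v ∈ H.edge e → ¬ H.IsBad p.threshold (decode H μ') e := fun e he =>
      h1 rfl e (mem_edgesAt.2 he)
    have hd := fun b => decode_write_accepted (H := H) μ' v b
    refine ⟨fun b => ⟨⟨⟨?_, fun w => ?_⟩, fun c i hs hc => ?_, ?_⟩, ?_⟩, ?_⟩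
    · rw [hd]; exact hμ.1.update_accepted hv hbad b
    · simp only [cell_write]
      split_ifs
      · exact one_le_two
      · simp_all
      · exact hμ.2 w
    · simp [hs, hc]
    · rw [hd]; exact Evo.update_accepted hv hbad b
    · rw [hd]; simp
    · change (memPot H p u _ + memPot H p u _) / 2 ≤ _
      simp only [memPot]
      have hdt := hd true
      have hdf := hd false
      rw [hdt, hdf]
      exact treePot_step hv hbad

lemma determineEdgeStatus_holds (hk : H.Uniform p.k) (g : Fin H.m) {μ : Mem} (hμ : Good H p μ) :
    Holds H p u (determineEdgeStatus p g) (fun κ μ' => Next H p μ μ' ∧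
      κ = kindS p.threshold (decode H μ') g ∧ Settled (decode H μ') g) μ := by
  rw [determineEdgeStatus, Prog.bind_def]
  refine Holds.bind (Holds.mono (Q := fun _ μ' => Next H p μ μ' ∧
    (Safe (decode H μ') g ∨ ∀ v ∈ H.edge g, decode H μ' v ≠ .uncolored)) ?_ ?_)
  · refine forMembers_rule loopLogic_holds hk g (fun A (_ : Unit) μ' => Next H p μ μ' ∧
      (Safe (decode H μ') g ∨ ∀ v ∈ A, decode H μ' v ≠ .uncolored)) ?_ ⟨Next.refl hμ, by simp⟩
    rintro A ⟨⟩ ν v - - ⟨hν, hA⟩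
    refine loopLogic_holds.load ?_
    split_ifs with h0
    · rw [Prog.bind_def]
      refine Holds.bind ((holds_of_detPost (kindOf_detPost hk g ν) fun _ _ h => h.1).mono ?_)
      rintro κ ν' ⟨hν', hκ⟩
      subst hν'
      split_ifs with hs
      · exact holds_ret ⟨hν, Or.inl (kindS_eq_safe.1 (hκ ▸ hs))⟩
      · refine (processVertex_holds hk v hν.1 (decode_eq_uncolored.2 h0)).mono ?_
        rintro ⟨⟩ ν'' ⟨hν'', hv⟩
        refine ⟨hν.trans hν'', hA.imp hν''.2.2.safe fun hA w hw => ?_⟩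
        rcases Finset.mem_insert.1 hw with rfl | hw
        · exact hv
        · rw [hν''.2.2.1 w (hA w hw)]; exact hA w hw
    · refine holds_ret ⟨hν, hA.imp_right fun hA w hw => ?_⟩
      rcases Finset.mem_insert.1 hw with rfl | hw
      · exact fun h => h0 (decode_eq_uncolored.1 h)
      · exact hA w hw
  · rintro ⟨⟩ ν ⟨hν, hset⟩
    refine (holds_of_detPost (kindOf_detPost hk g ν) fun _ _ h => h.1).mono ?_
    rintro κ ν' ⟨hν', hκ⟩
    subst hν'
    exact ⟨hν, hκ, hset⟩

end Base

/-! ### Exploring a final component -/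

namespace Base

open Prog HypergraphLCA.Hypergraph

variable {H : Hypergraph} {p : Params} {u : ℕ}

/-- The first `len` cells of the region `c` contain the elements of `A`, each of them once. -/
def Lists (μ : Mem) (c : Region) : ℕ → Finset (Fin H.m) → Prop
  | 0, A => A = ∅
  | len + 1, A => ∃ g ∈ A, μ.cell c len = g ∧ Lists μ c len (A.erase g)

lemma Lists.congr {μ μ' : Mem} {c : Region} {len : ℕ} {A : Finset (Fin H.m)}
    (h : Lists μ c len A) (h' : ∀ i < len, μ'.cell c i = μ.cell c i) : Lists μ' c len A := by
  induction len generalizing A with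
  | zero => exact h
  | succ len ih =>
    obtain ⟨g, hg, h1, h2⟩ := h
    exact ⟨g, hg, by rw [h' _ (by omega), h1], ih h2 fun i hi => h' i (by omega)⟩

lemma Lists.card {μ : Mem} {c : Region} {len : ℕ} {A : Finset (Fin H.m)} (h : Lists μ c len A) :
    A.card = len := by
  induction len generalizing A with
  | zero => rw [show A = ∅ from h]; rfl
  | succ len ih =>
    obtain ⟨g, hg, -, h2⟩ := h
    rw [← Finset.card_erase_add_one hg, ih h2]

lemma Lists.push {μ μ' : Mem} {c : Region} {len : ℕ} {A : Finset (Fin H.m)} (h : Lists μ c len A)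
    {g : Fin H.m} (hg : g ∉ A) (h' : ∀ i < len, μ'.cell c i = μ.cell c i)
    (h'' : μ'.cell c len = g) : Lists μ' c (len + 1) (insert g A) :=
  ⟨g, Finset.mem_insert_self _ _, h'', by rw [Finset.erase_insert hg]; exact h.congr h'⟩

/-- The arrays and flags in the memory represent the sets `B`, `Q`, `U` and `X`. -/
structure Arr (c : Counters) (B Q U X : Finset (Fin H.m)) (μ : Mem) : Prop where
  inComp : ∀ g : Fin H.m, μ.cell .inComp g = 0
  flag : ∀ g : Fin H.m, μ.cell .explored g ≠ 0 ↔ g ∈ X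
  listB : Lists μ .arrB c.b B
  listQ : Lists μ .arrQ c.q Q
  listU : Lists μ .arrU c.u U
  listX : Lists μ .arrX c.x X

/-- The state of the exploration of the final component that contains the bad edge `e₀`: the bad
edges `B ∪ Q` of the component found so far, those in `B` being processed already, the unsafe
edges `U ∪ P` that intersect edges of `B`, those in `P` being processed already, the set `X` of
edges marked as explored, and a set `K` of edges whose status has been determined. -/
structure St (p : Params) (e₀ : Fin H.m) (B Q U P K X : Finset (Fin H.m))
    (s : Fin H.n → VStatus) : Prop where
  bad : ∀ f ∈ B ∪ Q, f ∈ X ∧ H.IsBad p.threshold s f ∧ Settled s f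
  unsf : ∀ f ∈ U ∪ P, f ∈ X ∧ ¬ H.IsBad p.threshold s f ∧ ¬ Safe s f ∧ Settled s f ∧
    ∃ h ∈ B, f ∈ nbhd h
  explored : ∀ f ∈ X, Safe s f ∨ f ∈ B ∪ Q ∨ f ∈ U ∪ P
  checked : ∀ f ∈ K, Settled s f ∧ (H.IsBad p.threshold s f → f ∈ B ∪ Q)
  disjoint : Disjoint B Q
  disjoint' : Disjoint U P
  conn : B ∪ Q = ∅ ∨ CutConn H.Near {e₀} (B ∪ Q)
  card_le : B.card ≤ p.compBound

/-- The state of the exploration and its representation in the memory. The exploration started with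
the statuses `s₀`. -/
structure Inv (p : Params) (s₀ : Fin H.n → VStatus) (e₀ : Fin H.m) (c : Counters)
    (B Q U P K X : Finset (Fin H.m)) (μ : Mem) : Prop where
  good : Good H p μ
  evo : Evo p.threshold s₀ (decode H μ)
  arr : Arr c B Q U X μ
  st : St p e₀ B Q U P K X (decode H μ)

variable {s₀ s s' : Fin H.n → VStatus} {e₀ : Fin H.m} {c : Counters}
  {B Q U P K X : Finset (Fin H.m)} {μ μ' : Mem}

lemma St.evo (h : St p e₀ B Q U P K X s) (h' : Evo p.threshold s s') :
    St p e₀ B Q U P K X s' :=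
  { h with
    bad := fun f hf => by
      obtain ⟨h1, h2, h3⟩ := h.bad f hf
      exact ⟨h1, h'.2 f h2, h'.settled h3⟩
    unsf := fun f hf => by
      obtain ⟨h1, h2, h3, h4, h5⟩ := h.unsf f hf
      exact ⟨h1, by rwa [h'.isBad_iff h4], by rwa [h'.safe_iff h4], h'.settled h4, h5⟩
    explored := fun f hf => (h.explored f hf).imp_left h'.safe
    checked := fun f hf => by
      obtain ⟨h1, h2⟩ := h.checked f hf
      exact ⟨h'.settled h1, by rwa [h'.isBad_iff h1]⟩ }

/-- An explored edge is settled, and it belongs to the component if it is bad. -/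
lemma St.of_mem (h : St p e₀ B Q U P K X s) {g : Fin H.m} (hg : g ∈ X) :
    Settled s g ∧ (H.IsBad p.threshold s g → g ∈ B ∪ Q) := by
  rcases h.explored g hg with h1 | h1 | h1
  · exact ⟨Or.inl h1, fun hb => absurd h1 (Hypergraph.isBad_iff.1 hb).2⟩
  · exact ⟨(h.bad g h1).2.2, fun _ => h1⟩
  · obtain ⟨-, h2, -, h3, -⟩ := h.unsf g h1
    exact ⟨h3, fun hb => absurd hb h2⟩

lemma St.insert_checked (h : St p e₀ B Q U P K X s) {g : Fin H.m}
    (hg : Settled s g ∧ (H.IsBad p.threshold s g → g ∈ B ∪ Q)) :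
    St p e₀ B Q U P (insert g K) X s :=
  { h with
    checked := fun f hf => by
      rcases Finset.mem_insert.1 hf with rfl | hf
      · exact hg
      · exact h.checked f hf }

lemma St.insert_safe (h : St p e₀ B Q U P K X s) {g : Fin H.m} (hg : Safe s g) :
    St p e₀ B Q U P K (insert g X) s :=
  { h with
    bad := fun f hf => (h.bad f hf).imp_left (Finset.mem_insert_of_mem)
    unsf := fun f hf => (h.unsf f hf).imp_left (Finset.mem_insert_of_mem)
    explored := fun f hf => by
      rcases Finset.mem_insert.1 hf with rfl | hf
      · exact Or.inl hg
      · exact h.explored f hf }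

/-- A new bad edge near to the component is added to `Q`. -/
lemma St.insert_bad (h : St p e₀ B Q U P K X s) {g : Fin H.m} (hX : g ∉ X)
    (hg : H.IsBad p.threshold s g) (hset : Settled s g)
    (hc : (B ∪ Q = ∅ ∧ g = e₀) ∨ ∃ f ∈ B ∪ Q, H.Near f g) :
    St p e₀ B (insert g Q) U P K (insert g X) s :=
  { h with
    bad := fun f hf => by
      rw [Finset.union_insert, Finset.mem_insert] at hf
      rcases hf with rfl | hf
      · exact ⟨Finset.mem_insert_self _ _, hg, hset⟩
      · exact (h.bad f hf).imp_left (Finset.mem_insert_of_mem)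
    unsf := fun f hf => (h.unsf f hf).imp_left (Finset.mem_insert_of_mem)
    explored := fun f hf => by
      rw [Finset.union_insert, Finset.mem_insert (a := f) (s := B ∪ Q)]
      rcases Finset.mem_insert.1 hf with rfl | hf
      · exact Or.inr (Or.inl (Or.inl rfl))
      · exact (h.explored f hf).imp_right (Or.imp_left Or.inr)
    checked := fun f hf => by
      rw [Finset.union_insert, Finset.mem_insert]
      exact (h.checked f hf).imp_right fun h1 h2 => Or.inr (h1 h2)
    disjoint := by
      rw [Finset.disjoint_insert_right]
      exact ⟨fun hB => hX (h.bad g (Finset.mem_union_left _ hB)).1, h.disjoint⟩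
    conn := by
      rw [Finset.union_insert]
      rcases hc with ⟨h0, rfl⟩ | ⟨f, hf, hfg⟩
      · rw [h0]; exact Or.inr (CutConn.refl _ _)
      · rcases h.conn with h0 | h1
        · simp [h0] at hf
        · exact Or.inr (h1.insert hf hfg) }

/-- A new unsafe edge that intersects the component is added to `U`. -/
lemma St.insert_unsf (h : St p e₀ B Q U P K X s) {f g : Fin H.m} (hX : g ∉ X)
    (hg : ¬ H.IsBad p.threshold s g) (hs : ¬ Safe s g) (hset : Settled s g) (hf : f ∈ B)
    (hfg : g ∈ nbhd f) : St p e₀ B Q (insert g U) P K (insert g X) s :=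
  { h with
    bad := fun f hf => (h.bad f hf).imp_left (Finset.mem_insert_of_mem)
    unsf := fun f' hf' => by
      rw [Finset.insert_union, Finset.mem_insert] at hf'
      rcases hf' with rfl | hf'
      · exact ⟨Finset.mem_insert_self _ _, hg, hs, hset, f, hf, hfg⟩
      · exact (h.unsf f' hf').imp_left (Finset.mem_insert_of_mem)
    explored := fun f hf => by
      rw [Finset.insert_union, Finset.mem_insert (a := f) (s := U ∪ P)]
      rcases Finset.mem_insert.1 hf with rfl | hf
      · exact Or.inr (Or.inr (Or.inl rfl))
      · exact (h.explored f hf).imp_right (Or.imp_right Or.inr)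
    disjoint' := by
      rw [Finset.disjoint_insert_left]
      exact ⟨fun hP => hX (h.unsf g (Finset.mem_union_right _ hP)).1, h.disjoint'⟩ }

/-- An edge is moved from `Q` to `B`. -/
lemma St.pop_bad (h : St p e₀ B Q U P K X s) {f : Fin H.m} (hf : f ∈ Q)
    (hcard : B.card + 1 ≤ p.compBound) : St p e₀ (insert f B) (Q.erase f) U P K X s := by
  have hBQ : insert f B ∪ Q.erase f = B ∪ Q := by
    rw [Finset.insert_union, ← Finset.union_insert, Finset.insert_erase hf]
  constructor
  · rw [hBQ]; exact h.bad
  · refine fun g hg => ?_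
    obtain ⟨h1, h2, h3, h4, b, hb, hgb⟩ := h.unsf g hg
    exact ⟨h1, h2, h3, h4, b, Finset.mem_insert_of_mem hb, hgb⟩
  · rw [hBQ]; exact h.explored
  · rw [hBQ]; exact h.checked
  · rw [Finset.disjoint_insert_left]
    exact ⟨Finset.notMem_erase _ _, h.disjoint.mono_right (Finset.erase_subset _ _)⟩
  · exact h.disjoint'
  · rw [hBQ]; exact h.conn
  · exact (Finset.card_insert_le _ _).trans hcard

/-- An edge is moved from `U` to `P`. -/
lemma St.pop_unsf (h : St p e₀ B Q U P K X s) {f : Fin H.m} (hf : f ∈ U) :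
    St p e₀ B Q (U.erase f) (insert f P) K X s := by
  have hUP : U.erase f ∪ insert f P = U ∪ P := by
    rw [Finset.union_insert, ← Finset.insert_union, Finset.insert_erase hf]
  constructor
  · exact h.bad
  · rw [hUP]; exact h.unsf
  · rw [hUP]; exact h.explored
  · exact h.checked
  · exact h.disjoint
  · rw [Finset.disjoint_insert_right]
    exact ⟨Finset.notMem_erase _ _, h.disjoint'.mono_left (Finset.erase_subset _ _)⟩
  · exact h.conn
  · exact h.card_le

/-- If the component becomes too large, there is a satisfied witness structure. -/
lemma Inv.overflow (h : Inv p s₀ e₀ c B Q U P K X μ)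
    (hu : (H.maxEdgeDegree + 1) * u ≤ p.compBound) {f : Fin H.m} (hf : f ∈ Q)
    (hcard : p.compBound < B.card + 1) : Overflow H p u μ := by
  have hlt : (H.maxEdgeDegree + 1) * u < (B ∪ Q).card := by
    rw [Finset.card_union_of_disjoint h.st.disjoint]
    have := Finset.card_pos.2 ⟨f, hf⟩
    omega
  rcases h.st.conn with h0 | h1
  · rw [h0] at hlt; simp at hlt
  · obtain ⟨T, hT, hT'⟩ := exists_isTree h1 u hlt
    exact ⟨T, hT', fun e he => (h.st.bad e (hT he)).2.1⟩

lemma Arr.same (h : Arr c B Q U X μ) (h' : Same μ μ') : Arr c B Q U X μ' where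
  inComp i := by rw [h' _ _ (by decide) (by decide)]; exact h.inComp i
  flag g := by rw [h' _ _ (by decide) (by decide)]; exact h.flag g
  listB := h.listB.congr fun i _ => h' _ _ (by decide) (by decide)
  listQ := h.listQ.congr fun i _ => h' _ _ (by decide) (by decide)
  listU := h.listU.congr fun i _ => h' _ _ (by decide) (by decide)
  listX := h.listX.congr fun i _ => h' _ _ (by decide) (by decide)

lemma Arr.mark (h : Arr c B Q U X μ) {g : Fin H.m} (hg : g ∉ X) :
    Arr { c with x := c.x + 1 } B Q U (insert g X)
      ((μ.write .explored g 1).write .arrX c.x g) where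
  inComp i := by simpa using h.inComp i
  flag f := by
    rw [Finset.mem_insert, ← h.flag f]
    rcases eq_or_ne f g with rfl | hne
    · simp
    · simp [hne, Fin.val_inj]
  listB := h.listB.congr fun i _ => by simp
  listQ := h.listQ.congr fun i _ => by simp
  listU := h.listU.congr fun i _ => by simp
  listX := h.listX.push hg (fun i hi => by simp [hi.ne]) (by simp)

lemma Arr.push_bad (h : Arr c B Q U X μ) {g : Fin H.m} (hg : g ∉ Q) :
    Arr { c with q := c.q + 1 } B (insert g Q) U X (μ.write .arrQ c.q g) where
  inComp i := by simpa using h.inComp i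
  flag f := by simpa using h.flag f
  listB := h.listB.congr fun i _ => by simp
  listQ := h.listQ.push hg (fun i hi => by simp [hi.ne]) (by simp)
  listU := h.listU.congr fun i _ => by simp
  listX := h.listX.congr fun i _ => by simp

lemma Arr.push_unsf (h : Arr c B Q U X μ) {g : Fin H.m} (hg : g ∉ U) :
    Arr { c with u := c.u + 1 } B Q (insert g U) X (μ.write .arrU c.u g) where
  inComp i := by simpa using h.inComp i
  flag f := by simpa using h.flag f
  listB := h.listB.congr fun i _ => by simp
  listQ := h.listQ.congr fun i _ => by simp
  listU := h.listU.push hg (fun i hi => by simp [hi.ne]) (by simp)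
  listX := h.listX.congr fun i _ => by simp

lemma Arr.push_comp (h : Arr c B Q U X μ) {f : Fin H.m} (hf : f ∉ B) :
    Arr { c with b := c.b + 1 } (insert f B) Q U X (μ.write .arrB c.b f) where
  inComp i := by simpa using h.inComp i
  flag f := by simpa using h.flag f
  listB := h.listB.push hf (fun i hi => by simp [hi.ne]) (by simp)
  listQ := h.listQ.congr fun i _ => by simp
  listU := h.listU.congr fun i _ => by simp
  listX := h.listX.congr fun i _ => by simp

lemma near_of_mem_nbhd {f g : Fin H.m} (h : g ∈ nbhd f) (hne : g ≠ f) : H.Near f g :=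
  Or.inl (mem_nbrs_of_mem_nbhd h hne)

lemma cell_write_of_ne {c c' : Region} (h : c' ≠ c) (μ : Mem) (i x i' : ℕ) :
    (μ.write c i x).cell c' i' = μ.cell c' i' := by simp [h]

lemma cell_write_self (μ : Mem) (c : Region) (i x : ℕ) : (μ.write c i x).cell c i = x := by simp

lemma Good.write (h : Good H p μ) {c : Region} (hs : c ≠ .status) (hc : c ≠ .color) (i x : ℕ) :
    Good H p (μ.write c i x) := by
  refine ⟨by rw [decode_write hs hc]; exact h.1, fun v => ?_⟩
  rw [cell_write_of_ne hs.symm]; exact h.2 v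

lemma decode_mark (μ : Mem) (g x : ℕ) :
    decode H ((μ.write .explored g 1).write .arrX x g) = decode H μ := by
  rw [decode_write (by decide) (by decide), decode_write (by decide) (by decide)]

lemma visitNeighbor_holds (hk : H.Uniform p.k) (h : Inv p s₀ e₀ c B Q U P K X μ)
    {f g : Fin H.m} (hf : f ∈ B) (hg : g ∈ nbhd f) :
    Holds H p u (visitNeighbor p c g) (fun c' μ' => ∃ Q' U' X',
      Inv p s₀ e₀ c' B Q' U' P K X' μ' ∧ B ∪ Q ⊆ B ∪ Q' ∧ insert g X ⊆ X') μ := by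
  refine loopLogic_holds.load ?_
  split_ifs with h0
  · exact holds_ret ⟨Q, U, X, h, subset_rfl, Finset.insert_subset ((h.arr.flag g).1 h0) subset_rfl⟩
  have hgX : g ∉ X := fun hc => h0 ((h.arr.flag g).2 hc)
  have hgQ : g ∉ Q := fun hc => hgX (h.st.bad g (Finset.mem_union_right _ hc)).1
  have hgU : g ∉ U := fun hc => hgX (h.st.unsf g (Finset.mem_union_left _ hc)).1
  have hgf : g ≠ f := by
    rintro rfl
    exact hgX (h.st.bad g (Finset.mem_union_left _ hf)).1
  refine holds_store (by decide) (by decide) (holds_store (by decide) (by decide) ?_)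
  have harr := h.arr.mark hgX
  have hd := decode_mark (H := H) μ g c.x
  rw [Prog.bind_def]
  refine Holds.bind ((determineEdgeStatus_holds hk g
    ((h.good.write (by decide) (by decide) _ _).write (by decide) (by decide) _ _)).mono ?_)
  rintro κ ν ⟨⟨hgood, hsame, hevo⟩, rfl, hset⟩
  rw [hd] at hevo
  have hst := h.st.evo hevo
  have harr' := harr.same hsame
  have hevo' := h.evo.trans hevo
  split
  · rename_i hκ
    rw [kindS_eq_bad] at hκ
    refine holds_store (by decide) (by decide) (holds_ret ⟨insert g Q, U, insert g X,
      ⟨hgood.write (by decide) (by decide) _ _, ?_, harr'.push_bad hgQ, ?_⟩,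
      Finset.union_subset_union_right (Finset.subset_insert _ _), subset_rfl⟩)
    · rwa [decode_write (by decide) (by decide)]
    · rw [decode_write (by decide) (by decide)]
      exact hst.insert_bad hgX hκ hset
        (Or.inr ⟨f, Finset.mem_union_left _ hf, near_of_mem_nbhd hg hgf⟩)
  · rename_i hκ
    rw [kindS_eq_unsf] at hκ
    refine holds_store (by decide) (by decide) (holds_ret ⟨Q, insert g U, insert g X,
      ⟨hgood.write (by decide) (by decide) _ _, ?_, harr'.push_unsf hgU, ?_⟩,
      subset_rfl, subset_rfl⟩)
    · rwa [decode_write (by decide) (by decide)]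
    · rw [decode_write (by decide) (by decide)]
      exact hst.insert_unsf hgX hκ.2 hκ.1 hset hf hg
  · rename_i hκ
    rw [kindS_eq_safe] at hκ
    exact holds_ret ⟨Q, U, insert g X, ⟨hgood, hevo', harr', hst.insert_safe hκ⟩,
      subset_rfl, subset_rfl⟩

/-- Afterwards all neighbors of bad edges of the component are explored. The fuel suffices, as every
iteration adds an edge to `B`. -/
lemma expandBadComp_holds (hk : H.Uniform p.k) (hu : (H.maxEdgeDegree + 1) * u ≤ p.compBound)
    (fuel : ℕ) {c : Counters} {B Q U X : Finset (Fin H.m)} {μ : Mem}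
    (h : Inv p s₀ e₀ c B Q U P K X μ) (hB : ∀ f ∈ B, nbhd f ⊆ X)
    (hfuel : p.compBound < fuel + B.card) :
    Holds H p u (expandBadComp p fuel c) (fun c' μ' => ∃ B' U' X',
      Inv p s₀ e₀ c' B' ∅ U' P K X' μ' ∧ B ∪ Q ⊆ B' ∧ X ⊆ X' ∧ ∀ f ∈ B', nbhd f ⊆ X') μ := by
  induction fuel generalizing c B Q U X μ with
  | zero => exact absurd h.st.card_le (by omega)
  | succ fuel ih =>
    rw [expandBadComp]
    by_cases h0 : c.q = 0
    · rw [if_pos h0]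
      have hQ : Q = ∅ := by rw [← Finset.card_eq_zero, h.arr.listQ.card, h0]
      subst hQ
      exact holds_ret ⟨B, U, X, h, by simp, subset_rfl, hB⟩
    rw [if_neg h0]
    obtain ⟨q, hq⟩ := Nat.exists_eq_succ_of_ne_zero h0
    have hlist := h.arr.listQ
    rw [hq] at hlist
    obtain ⟨f, hf, hcell, hrest⟩ := hlist
    refine loopLogic_holds.load ?_
    rw [hq, Nat.succ_sub_one, hcell]
    have hfB : f ∉ B := fun hc => Finset.disjoint_left.1 h.st.disjoint hc hf
    refine holds_store (by decide) (by decide) ?_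
    have hgood := h.good.write (c := .arrB) (by decide) (by decide) c.b f
    have hd : decode H (μ.write .arrB c.b f) = decode H μ := decode_write (by decide) (by decide) _ _
    by_cases hb : p.compBound < c.b + 1
    · rw [if_pos hb]
      refine ⟨?_, le_rfl⟩
      obtain ⟨T, hT, hbad⟩ := h.overflow hu hf (by rw [h.arr.listB.card]; exact hb)
      exact ⟨T, hT, by rwa [hd]⟩
    rw [if_neg hb]
    have hBc := h.arr.listB.card
    have hinv : Inv p s₀ e₀ { c with q := q, b := c.b + 1 } (insert f B) (Q.erase f) U P K X
        (μ.write .arrB c.b f) := by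
      refine ⟨hgood, by rw [hd]; exact h.evo, ?_, by rw [hd]; exact h.st.pop_bad hf (by omega)⟩
      exact Arr.push_comp (c := { c with q := q }) ⟨h.arr.inComp, h.arr.flag, h.arr.listB, hrest,
        h.arr.listU, h.arr.listX⟩ hfB
    have hBQ : insert f B ∪ Q.erase f = B ∪ Q := by
      rw [Finset.insert_union, ← Finset.union_insert, Finset.insert_erase hf]
    rw [Prog.bind_def]
    refine Holds.bind ((forNeighbors_rule loopLogic_holds hk f (fun A c' μ' => ∃ Q' U' X',
      Inv p s₀ e₀ c' (insert f B) Q' U' P K X' μ' ∧ B ∪ Q ⊆ insert f B ∪ Q' ∧ X ⊆ X' ∧ A ⊆ X')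
      ?_ ⟨_, _, _, hinv, hBQ.ge, subset_rfl, Finset.empty_subset _⟩).mono ?_)
    · rintro A c' μ' g hg ⟨Q', U', X', h1, h2, h3, h4⟩
      refine (visitNeighbor_holds hk h1 (Finset.mem_insert_self _ _) hg).mono ?_
      rintro c'' μ'' ⟨Q'', U'', X'', h5, h6, h7⟩
      have h8 : X' ⊆ X'' := (Finset.subset_insert _ _).trans h7
      exact ⟨Q'', U'', X'', h5, h2.trans h6, h3.trans h8,
        Finset.insert_subset (h7 (Finset.mem_insert_self _ _)) (h4.trans h8)⟩
    · rintro c' μ' ⟨Q', U', X', h1, h2, h3, h4⟩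
      refine (ih h1 ?_ ?_).mono ?_
      · intro g hg
        rcases Finset.mem_insert.1 hg with rfl | hg
        · exact h4
        · exact (hB g hg).trans h3
      · rw [Finset.card_insert_of_notMem hfB]; omega
      · rintro c'' μ'' ⟨B'', U'', X'', h5, h6, h7, h8⟩
        exact ⟨B'', U'', X'', h5, h2.trans h6, h3.trans h7, h8⟩

lemma startBadComp_holds (hk : H.Uniform p.k) (hu : (H.maxEdgeDegree + 1) * u ≤ p.compBound)
    (h : Inv p s₀ e₀ c B ∅ U P K X μ) (hB : ∀ f ∈ B, nbhd f ⊆ X) {g : Fin H.m} (hgX : g ∉ X)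
    (hg : H.IsBad p.threshold (decode H μ) g) (hset : Settled (decode H μ) g)
    (hc : (B = ∅ ∧ g = e₀) ∨ ∃ f ∈ B, H.Near f g) :
    Holds H p u (startBadComp p c g) (fun c' μ' => ∃ B' U' X',
      Inv p s₀ e₀ c' B' ∅ U' P K X' μ' ∧ insert g B ⊆ B' ∧ X ⊆ X' ∧ ∀ f ∈ B', nbhd f ⊆ X') μ := by
  have hd := decode_mark (H := H) μ g c.x
  have hd' : decode H (((μ.write .explored g 1).write .arrX c.x g).write .arrQ 0 g) =
    decode H μ := by rw [decode_write (by decide) (by decide), hd]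
  refine holds_store (by decide) (by decide) (holds_store (by decide) (by decide)
    (holds_store (by decide) (by decide) ?_))
  have harr := h.arr.mark hgX
  have hq : c.q = 0 := h.arr.listQ.card.symm
  have harr' := harr.push_bad (g := g) (by simp)
  rw [hq] at harr'
  have hinv : Inv p s₀ e₀ { c with q := 1, x := c.x + 1 } B {g} U P K (insert g X)
      (((μ.write .explored g 1).write .arrX c.x g).write .arrQ 0 g) := by
    refine ⟨((h.good.write (by decide) (by decide) _ _).write (by decide) (by decide) _ _).write
      (by decide) (by decide) _ _, by rw [hd']; exact h.evo, harr', ?_⟩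
    rw [hd']
    exact h.st.insert_bad hgX hg hset (by simpa using hc)
  refine (expandBadComp_holds hk hu p.badFuel hinv
    (fun f hf => (hB f hf).trans (Finset.subset_insert _ _)) ?_).mono ?_
  · rw [Params.badFuel]; omega
  · rintro c' μ' ⟨B', U', X', h1, h2, h3, h4⟩
    refine ⟨B', U', X', h1, ?_, (Finset.subset_insert _ _).trans h3, h4⟩
    rwa [Finset.union_comm, ← Finset.insert_eq] at h2

/-- A bad edge that intersects an unsafe neighbor of the component is near to the component. -/
lemma visitViaUnsafe_holds (hk : H.Uniform p.k) (hu : (H.maxEdgeDegree + 1) * u ≤ p.compBound)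
    (h : Inv p s₀ e₀ c B ∅ U P K X μ) (hB : ∀ f ∈ B, nbhd f ⊆ X) {f g : Fin H.m} (hf : f ∈ P)
    (hg : g ∈ nbhd f) :
    Holds H p u (visitViaUnsafe p c g) (fun c' μ' => ∃ B' U' X',
      Inv p s₀ e₀ c' B' ∅ U' P (insert g K) X' μ' ∧ B ⊆ B' ∧ ∀ f ∈ B', nbhd f ⊆ X') μ := by
  refine loopLogic_holds.load ?_
  split_ifs with h0
  · exact holds_ret ⟨B, U, X, ⟨h.good, h.evo, h.arr,
      h.st.insert_checked (h.st.of_mem ((h.arr.flag g).1 h0))⟩, subset_rfl, hB⟩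
  have hgX : g ∉ X := fun hc => h0 ((h.arr.flag g).2 hc)
  rw [Prog.bind_def]
  refine Holds.bind ((determineEdgeStatus_holds hk g h.good).mono ?_)
  rintro κ ν ⟨⟨hgood, hsame, hevo⟩, rfl, hset⟩
  have hinv : Inv p s₀ e₀ c B ∅ U P K X ν :=
    ⟨hgood, h.evo.trans hevo, h.arr.same hsame, h.st.evo hevo⟩
  split_ifs with hκ
  · rw [kindS_eq_bad] at hκ
    obtain ⟨hfX, -, -, -, b, hb, hfb⟩ := h.st.unsf f (Finset.mem_union_right _ hf)
    have hgf : g ≠ f := fun h => hgX (h ▸ hfX)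
    have hnear : H.Near b g := by
      rcases eq_or_ne f b with rfl | hne
      · exact near_of_mem_nbhd hg hgf
      · exact Or.inr ⟨f, mem_nbrs_of_mem_nbhd hfb hne, mem_nbrs_of_mem_nbhd hg hgf⟩
    refine (startBadComp_holds hk hu hinv hB hgX hκ hset (Or.inr ⟨b, hb, hnear⟩)).mono ?_
    rintro c' μ' ⟨B', U', X', h1, h2, h3, h4⟩
    have hgB : g ∈ B' := h2 (Finset.mem_insert_self _ _)
    refine ⟨B', U', X', ⟨h1.good, h1.evo, h1.arr, h1.st.insert_checked
      (h1.st.of_mem (h1.st.bad g (Finset.mem_union_left _ hgB)).1)⟩,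
      (Finset.subset_insert _ _).trans h2, h4⟩
  · rw [kindS_eq_bad] at hκ
    exact holds_ret ⟨B, U, X, ⟨hinv.good, hinv.evo, hinv.arr,
      hinv.st.insert_checked ⟨hset, fun hb => absurd hb hκ⟩⟩, subset_rfl, hB⟩

/-- The processed unsafe edges are neighbors of edges of `B`. -/
lemma St.card_processed_le (h : St p e₀ B Q U P K X s) :
    P.card ≤ H.maxEdgeDegree * p.compBound := by
  have hsub : P ⊆ B.biUnion H.nbrs := fun g hg => by
    obtain ⟨-, h1, -, -, b, hb, hgb⟩ := h.unsf g (Finset.mem_union_right _ hg)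
    refine Finset.mem_biUnion.2 ⟨b, hb, mem_nbrs_of_mem_nbhd hgb ?_⟩
    rintro rfl
    exact h1 (h.bad g (Finset.mem_union_left _ hb)).2.1
  refine (Finset.card_le_card hsub).trans ((Finset.card_biUnion_le_card_mul _ _ _
    fun b _ => card_nbrs_le b).trans ?_)
  rw [mul_comm]
  exact Nat.mul_le_mul_left _ h.card_le

/-- Afterwards the status of all neighbors of the unsafe edges is determined as well. -/
lemma expandViaUnsafe_holds (hk : H.Uniform p.k) (hu : (H.maxEdgeDegree + 1) * u ≤ p.compBound)
    (fuel : ℕ) {c : Counters} {B U P K X : Finset (Fin H.m)} {μ : Mem}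
    (h : Inv p s₀ e₀ c B ∅ U P K X μ) (hB : ∀ f ∈ B, nbhd f ⊆ X) (hP : ∀ f ∈ P, nbhd f ⊆ K)
    (hfuel : H.maxEdgeDegree * p.compBound < fuel + P.card) :
    Holds H p u (expandViaUnsafe p fuel c) (fun c' μ' => ∃ B' P' K' X',
      Inv p s₀ e₀ c' B' ∅ ∅ P' K' X' μ' ∧ B ⊆ B' ∧ (∀ f ∈ B', nbhd f ⊆ X') ∧
        ∀ f ∈ P', nbhd f ⊆ K') μ := by
  induction fuel generalizing c B U P K X μ with
  | zero => exact absurd h.st.card_processed_le (by omega)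
  | succ fuel ih =>
    rw [expandViaUnsafe]
    by_cases h0 : c.u = 0
    · rw [if_pos h0]
      have hU : U = ∅ := by rw [← Finset.card_eq_zero, h.arr.listU.card, h0]
      subst hU
      exact holds_ret ⟨B, P, K, X, h, subset_rfl, hB, hP⟩
    rw [if_neg h0]
    obtain ⟨q, hq⟩ := Nat.exists_eq_succ_of_ne_zero h0
    have hlist := h.arr.listU
    rw [hq] at hlist
    obtain ⟨f, hf, hcell, hrest⟩ := hlist
    refine loopLogic_holds.load ?_
    rw [hq, Nat.succ_sub_one, hcell]
    have hfP : f ∉ P := fun hc => Finset.disjoint_left.1 h.st.disjoint' hf hc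
    have hinv : Inv p s₀ e₀ { c with u := q } B ∅ (U.erase f) (insert f P) K X μ :=
      ⟨h.good, h.evo, ⟨h.arr.inComp, h.arr.flag, h.arr.listB, h.arr.listQ, hrest, h.arr.listX⟩,
        h.st.pop_unsf hf⟩
    rw [Prog.bind_def]
    refine Holds.bind ((forNeighbors_rule loopLogic_holds hk f (fun A c' μ' => ∃ B' U' K' X',
      Inv p s₀ e₀ c' B' ∅ U' (insert f P) K' X' μ' ∧ B ⊆ B' ∧ (∀ f ∈ B', nbhd f ⊆ X') ∧
        K ⊆ K' ∧ A ⊆ K')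
      ?_ ⟨_, _, _, _, hinv, subset_rfl, hB, subset_rfl, Finset.empty_subset _⟩).mono ?_)
    · rintro A c' μ' g hg ⟨B', U', K', X', h1, h2, h3, h4, h5⟩
      refine (visitViaUnsafe_holds hk hu h1 h3 (Finset.mem_insert_self _ _) hg).mono ?_
      rintro c'' μ'' ⟨B'', U'', X'', h6, h7, h8⟩
      exact ⟨B'', U'', insert g K', X'', h6, h2.trans h7, h8,
        h4.trans (Finset.subset_insert _ _), Finset.insert_subset_insert _ h5⟩
    · rintro c' μ' ⟨B', U', K', X', h1, h2, h3, h4, h5⟩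
      refine (ih h1 h3 ?_ ?_).mono ?_
      · intro g hg
        rcases Finset.mem_insert.1 hg with rfl | hg
        · exact h5
        · exact (hP g hg).trans h4
      · rw [Finset.card_insert_of_notMem hfP]; omega
      · rintro c'' μ'' ⟨B'', P'', K'', X'', h6, h7, h8, h9⟩
        exact ⟨B'', P'', K'', X'', h6, h2.trans h7, h8, h9⟩

/-- The memory between queries: it is valid, and no temporary flags are set. -/
structure Clean (H : Hypergraph) (p : Params) (μ : Mem) : Prop where
  good : Good H p μ
  inComp : ∀ g : Fin H.m, μ.cell .inComp g = 0
  flag : ∀ g : Fin H.m, μ.cell .explored g = 0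

/-- A completely explored final component with the bad edges `B`, where `X` is the set of edges that
are marked as explored. The status of all neighbors of `B` is determined, and all bad edges that
intersect `B` or an unsafe neighbor of `B` belong to `B`. -/
structure Component (p : Params) (v : Fin H.n) (c : Counters) (B X : Finset (Fin H.m))
    (μ : Mem) : Prop where
  good : Good H p μ
  inComp : ∀ g : Fin H.m, μ.cell .inComp g = 0
  flag : ∀ g : Fin H.m, μ.cell .explored g ≠ 0 → g ∈ X
  listB : Lists μ .arrB c.b B
  listX : Lists μ .arrX c.x X
  start : ∃ e ∈ B, v ∈ H.edge e
  bad : ∀ f ∈ B, H.IsBad p.threshold (decode H μ) f ∧ Settled (decode H μ) f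
  settled : ∀ f ∈ B, ∀ g ∈ nbhd f, Settled (decode H μ) g
  bad_of_nbhd : ∀ f ∈ B, ∀ g ∈ nbhd f, H.IsBad p.threshold (decode H μ) g → g ∈ B
  bad_of_unsf : ∀ f ∈ B, ∀ g ∈ nbhd f, ¬ Safe (decode H μ) g → g ∉ B →
    ∀ h ∈ nbhd g, H.IsBad p.threshold (decode H μ) h → h ∈ B

/-- The exploration produces a complete component, unless it finds a satisfied witness structure. -/
lemma buildFinalComponent_holds (hk : H.Uniform p.k) (hΔ : p.Δ = H.maxEdgeDegree)
    (hu : (H.maxEdgeDegree + 1) * u ≤ p.compBound) {v : Fin H.n} {μ : Mem} (hμ : Clean H p μ)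
    (hv : decode H μ v = .troubled) :
    Holds H p u (buildFinalComponent p v) (fun c μ' => Evo p.threshold (decode H μ) (decode H μ') ∧
      ∃ B X, Component p v c B X μ') μ := by
  rw [buildFinalComponent, Prog.bind_def]
  refine Holds.bind ((holds_of_detPost (findBad_detPost hk v μ) fun _ _ h => h.1).mono ?_)
  rintro o μ' ⟨hμ', h1, h2⟩
  subst hμ'
  cases o with
  | none =>
    obtain ⟨e, hve, he⟩ := hμ.good.1.troubled v hv
    exact absurd he (h1 rfl e (mem_edgesAt.2 hve))
  | some g =>
    obtain ⟨e, rfl, hve, he⟩ := h2 g rfl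
    dsimp only
    rw [Prog.bind_def]
    refine Holds.bind ((determineEdgeStatus_holds hk e hμ.good).mono ?_)
    rintro κ ν ⟨⟨hgood, hsame, hevo⟩, -, hset⟩
    rw [Prog.bind_def]
    have hinv : Inv p (decode H μ') e ⟨0, 0, 0, 0⟩ ∅ ∅ ∅ ∅ ∅ ∅ ν := by
      refine ⟨hgood, hevo, ⟨fun i => ?_, fun g => ?_, rfl, rfl, rfl, rfl⟩, ⟨by simp, by simp,
        by simp, by simp, by simp, by simp, Or.inl rfl, by simp⟩⟩
      · rw [hsame _ _ (by decide) (by decide)]; exact hμ.inComp i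
      · rw [hsame _ _ (by decide) (by decide), hμ.flag]; simp
    refine Holds.bind ((startBadComp_holds hk hu hinv (by simp) (by simp) (hevo.2 e he) hset
      (Or.inl ⟨rfl, rfl⟩)).mono ?_)
    rintro c ν₁ ⟨B, U, X, h3, h4, -, h5⟩
    refine (expandViaUnsafe_holds hk hu p.unsafeFuel h3 h5 (by simp) ?_).mono ?_
    · rw [Params.unsafeFuel, hΔ]; omega
    · rintro c' μ₁ ⟨B', P', K', X', h6, h7, h8, h9⟩
      have hBX : ∀ {g}, g ∈ B' ∪ ∅ ↔ g ∈ B' := by simp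
      refine ⟨h6.evo, B', X', h6.good, h6.arr.inComp, fun g => (h6.arr.flag g).1, h6.arr.listB,
        h6.arr.listX, ⟨e, h7 (h4 (Finset.mem_insert_self _ _)), hve⟩,
        fun f hf => (h6.st.bad f (hBX.2 hf)).2, fun f hf g hg => (h6.st.of_mem (h8 f hf hg)).1,
        fun f hf g hg hb => hBX.1 ((h6.st.of_mem (h8 f hf hg)).2 hb),
        fun f hf g hg hs hgB h hh hb => ?_⟩
      rcases h6.st.explored g (h8 f hf hg) with h10 | h10 | h10
      · exact absurd h10 hs
      · exact absurd (hBX.1 h10) hgB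
      · rw [Finset.empty_union] at h10
        exact hBX.1 ((h6.st.checked h (h9 g h10 hh)).2 hb)

end Base

/-! ### Coloring a final component -/

namespace Base

open Prog HypergraphLCA.Hypergraph Resampling

variable {H : Hypergraph} {p : Params} {α β σ : Type} {μ μ' μ'' : Mem}

/-- The invariant `I A` holds when the edges in `A` have been visited. -/
lemma forArray_rule {W : Prog σ → (σ → Mem → Prop) → Mem → Prop} (hW : LoopLogic H W)
    {c : Region} {body : σ → ℕ → Prog σ} {len : ℕ} {S : Finset (Fin H.m)} (hS : Lists μ c len S)
    (I : Finset (Fin H.m) → σ → Mem → Prop)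
    (h : ∀ A x μ', ∀ g ∈ S, g ∉ A → I A x μ' → W (body x g) (I (insert g A)) μ')
    (hI : ∀ A x μ', I A x μ' → ∀ i, μ'.cell c i = μ.cell c i) {x : σ} (hx : I ∅ x μ) :
    W (forArray c body len x) (I S) μ := by
  have key : ∀ len R A x μ', Lists μ c len R → Disjoint A R → A ∪ R = S → I A x μ' →
      W (forArray c body len x) (I S) μ' := by
    intro len
    induction len with
    | zero =>
      rintro R A x μ' hR - hAR hx
      rw [show R = ∅ from hR, Finset.union_empty] at hAR
      exact hW.ret (hAR ▸ hx)
    | succ len ih =>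
      rintro R A x μ' ⟨g, hg, hcell, hR⟩ hdis hAR hx
      refine hW.load ?_
      rw [hI _ _ _ hx, hcell]
      refine hW.bind (hW.mono (h A x μ' g ?_ ?_ hx) fun y ν hy => ih _ _ y ν hR ?_ ?_ hy)
      · rw [← hAR]; exact Finset.mem_union_right _ hg
      · exact fun hc => Finset.disjoint_left.1 hdis hc hg
      · rw [Finset.disjoint_insert_left]
        exact ⟨Finset.notMem_erase _ _, hdis.mono_right (Finset.erase_subset _ _)⟩
      · rw [Finset.insert_union, ← Finset.union_insert, Finset.insert_erase hg, hAR]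
  exact key len S ∅ x μ hS (Finset.disjoint_empty_left _) (Finset.empty_union _) hx

/-- The flags and the array of the component `C`, in a memory that otherwise agrees with `μ`. -/
structure Coll (μ : Mem) (len : ℕ) (C : Finset (Fin H.m)) (μ' : Mem) : Prop where
  rest : ∀ c i, c ≠ .inComp → c ≠ .arrC → μ'.cell c i = μ.cell c i
  flag : ∀ g : Fin H.m, μ'.cell .inComp g ≠ 0 ↔ g ∈ C
  list : Lists μ' .arrC len C

lemma Coll.decode_eq {len : ℕ} {C : Finset (Fin H.m)} (h : Coll μ len C μ') :
    decode H μ' = decode H μ :=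
  decode_congr (fun _ => h.rest _ _ (by decide) (by decide))
    fun _ => h.rest _ _ (by decide) (by decide)

lemma Coll.add {len : ℕ} {C : Finset (Fin H.m)} (h : Coll μ len C μ') {g : Fin H.m}
    (hg : g ∉ C) :
    (addToComp len g).DetPost H (fun len' μ'' => Coll μ len' (insert g C) μ'') μ' := by
  refine ⟨_, _, ⟨rfl, rfl⟩, fun c i h1 h2 => ?_, fun f => ?_, ?_⟩
  · rw [cell_write_of_ne h2, cell_write_of_ne h1, h.rest c i h1 h2]
  · rw [Finset.mem_insert, ← h.flag f, cell_write_of_ne (by decide)]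
    rcases eq_or_ne f g with rfl | hne
    · simp
    · simp [hne, Fin.val_inj]
  · exact h.list.push hg (fun i hi => by simp [hi.ne]) (by simp)

lemma collectEdges_detPost (hk : H.Uniform p.k) {b : ℕ} {B : Finset (Fin H.m)}
    (hB : Lists μ .arrB b B) (hbad : ∀ f ∈ B, H.IsBad p.threshold (decode H μ) f)
    (hflag : ∀ g : Fin H.m, μ.cell .inComp g = 0) :
    (collectEdges p b).DetPost H (fun len μ' => ∃ C, Coll μ len C μ' ∧ ∀ g, g ∈ C ↔
      g ∈ B ∨ ∃ f ∈ B, g ∈ nbhd f ∧ kindS p.threshold (decode H μ) g = .unsf) μ := by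
  set s := decode H μ with hs
  refine (forArray_rule (loopLogic_detPost (H := H)) hB (fun A len μ' => A ⊆ B ∧ ∃ C,
    Coll μ len C μ' ∧ ∀ g, g ∈ C ↔
      g ∈ A ∨ ∃ f ∈ A, g ∈ nbhd f ∧ kindS p.threshold s g = .unsf) ?_ ?_ ?_).mono ?_
  · rintro A len μ' f hf hfA ⟨hAB, C, hC, hmem⟩
    have hkf : kindS p.threshold s f ≠ .unsf := by
      rw [kindS_eq_bad.2 (hbad f hf)]; decide
    have hfC : f ∉ C := by rw [hmem]; tauto
    rw [Prog.bind_def]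
    refine (hC.add hfC).bind fun len' μ'' hC' => ?_
    refine (forNeighbors_rule (loopLogic_detPost (H := H)) hk f (fun N len μ' => ∃ C,
      Coll μ len C μ' ∧ ∀ g, g ∈ C ↔ (g ∈ insert f A ∨ ∃ f ∈ A, g ∈ nbhd f ∧
        kindS p.threshold s g = .unsf) ∨ (g ∈ N ∧ kindS p.threshold s g = .unsf)) ?_
        ⟨insert f C, hC', fun g => by simp [hmem, or_assoc]⟩).mono ?_
    · rintro N len ν g hg ⟨C', hC', hmem'⟩
      refine loopLogic_detPost.load ?_
      split_ifs with h0
      · have hgC := (hC'.flag g).1 h0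
        refine detPost_ret ⟨C', hC', fun g' => ?_⟩
        rw [hmem']
        rcases eq_or_ne g' g with rfl | hne
        · have := (hmem' g').1 hgC
          exact iff_of_true this (this.imp_right fun h => ⟨Finset.mem_insert_of_mem h.1, h.2⟩)
        · rw [Finset.mem_insert (a := g') (b := g)]; simp [hne]
      · have hgC : g ∉ C' := fun hc => h0 ((hC'.flag g).2 hc)
        rw [Prog.bind_def]
        refine (kindOf_detPost hk g ν).bind ?_
        rintro κ ν' ⟨hν', hκ⟩
        subst hν'
        rw [hC'.decode_eq, ← hs] at hκ
        split_ifs with hu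
        · refine (hC'.add hgC).mono fun len'' ν'' h'' => ⟨_, h'', fun g' => ?_⟩
          rw [Finset.mem_insert, hmem', Finset.mem_insert (a := g') (b := g)]
          rcases eq_or_ne g' g with rfl | hne
          · rw [hu] at hκ; simp [← hκ]
          · simp [hne]
        · refine detPost_ret ⟨C', hC', fun g' => ?_⟩
          rw [hmem', Finset.mem_insert (a := g') (b := g)]
          rcases eq_or_ne g' g with rfl | hne
          · rw [hκ] at hu; simp [hu]
          · simp [hne]
    · rintro len ν ⟨C', hC', hmem'⟩
      refine ⟨Finset.insert_subset hf hAB, C', hC', fun g => ?_⟩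
      rw [hmem']
      simp only [Finset.mem_insert, exists_eq_or_imp]
      exact or_assoc.trans (or_congr_right or_comm)
  · rintro A len μ' ⟨-, C, hC, -⟩ i
    exact hC.rest _ _ (by decide) (by decide)
  · exact ⟨Finset.empty_subset _, ∅, ⟨fun _ _ _ _ => rfl, fun g => by simp [hflag], rfl⟩, by simp⟩
  · rintro len μ' ⟨-, h⟩
    exact h

/-! ### Random recoloring -/

/-- The colors stored in the memory. -/
def col (H : Hypergraph) (μ : Mem) : Fin H.n → Bool := fun v => decide (μ.cell .color v ≠ 0)

/-- The troubled vertices of `f`. -/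
def troubledIn (μ : Mem) (f : Fin H.m) : Finset (Fin H.n) :=
  (H.edge f).filter fun v : Fin H.n => μ.cell .status v = troubled

/-- The program `q` tosses coins for new colors of the vertices in `S`, and ends successfully with
the postcondition `Q`. The distribution of the new colors is expressed by the operator `rs`. -/
def Recolors (H : Hypergraph) (S : Finset (Fin H.n)) (q : Prog α) (Q : α → Mem → Prop)
    (μ : Mem) : Prop :=
  q.wp H Q (fun _ => False) μ ∧ ∀ (f : α → Mem → ℝ≥0∞) (r : Mem → ℝ≥0∞)
    (Z : (Fin H.n → Bool) → ℝ≥0∞), (∀ a μ', Q a μ' → f a μ' ≤ Z (col H μ')) →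
    q.ev H f r μ ≤ rs S Z (col H μ)

lemma Recolors.mono {S : Finset (Fin H.n)} {q : Prog α} {Q Q' : α → Mem → Prop}
    (h : Recolors H S q Q μ) (h' : ∀ a μ', Q a μ' → Q' a μ') : Recolors H S q Q' μ :=
  ⟨wp_post h.1 h', fun f r Z hf => h.2 f r Z fun a μ' hQ => hf a μ' (h' a μ' hQ)⟩

lemma Recolors.bind {S S' : Finset (Fin H.n)} {q : Prog α} {g : α → Prog β}
    {Q : α → Mem → Prop} {Q' : β → Mem → Prop} (h : Recolors H S q Q μ)
    (h' : ∀ a μ', Q a μ' → Recolors H S' (g a) Q' μ') : Recolors H (S ∪ S') (q.bind g) Q' μ := by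
  refine ⟨(wp_bind _ _ _ _ _).2 (wp_post h.1 fun a μ' hQ => (h' a μ' hQ).1), fun f r Z hf => ?_⟩
  rw [ev_bind, ← rs_rs]
  exact h.2 _ _ _ fun a μ' hQ => (h' a μ' hQ).2 f r Z hf

lemma rs_empty {V : Type*} [Fintype V] [DecidableEq V] (Z : (V → Bool) → ℝ≥0∞) (τ : V → Bool) :
    rs ∅ Z τ = Z τ := rs_congr fun _ => by simp

lemma recolors_ret {a : α} {Q : α → Mem → Prop} (h : Q a μ) : Recolors H ∅ (.ret a) Q μ :=
  ⟨h, fun f r Z hf => by rw [rs_empty]; exact hf a μ h⟩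

lemma recolors_of_detPost {q : Prog α} {Q : α → Mem → Prop} (h : q.DetPost H Q μ)
    (hcol : ∀ a μ', Q a μ' → col H μ' = col H μ) : Recolors H ∅ q Q μ := by
  refine ⟨h.wp, fun f r Z hf => ?_⟩
  obtain ⟨a, μ', h1, h2⟩ := h
  rw [h1.ev_eq, rs_empty, ← hcol a μ' h2]
  exact hf a μ' h2

/-- Only the colors of vertices in `S` may have changed, and the array `W`. -/
def Rec (S : Finset (Fin H.n)) (μ μ' : Mem) : Prop :=
  (∀ c i, c ≠ .color → c ≠ .arrW → μ'.cell c i = μ.cell c i) ∧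
    ∀ v : Fin H.n, v ∉ S → μ'.cell .color v = μ.cell .color v

lemma Rec.refl (S : Finset (Fin H.n)) (μ : Mem) : Rec S μ μ := ⟨fun _ _ _ _ => rfl, fun _ _ => rfl⟩

lemma Rec.trans {S : Finset (Fin H.n)} (h : Rec S μ μ') (h' : Rec S μ' μ'') : Rec S μ μ'' :=
  ⟨fun c i h1 h2 => (h'.1 c i h1 h2).trans (h.1 c i h1 h2),
    fun v hv => (h'.2 v hv).trans (h.2 v hv)⟩

lemma Rec.mono {S S' : Finset (Fin H.n)} (h : Rec S μ μ') (hS : S ⊆ S') : Rec S' μ μ' :=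
  ⟨h.1, fun v hv => h.2 v fun hc => hv (hS hc)⟩

lemma Rec.troubledIn_eq {S : Finset (Fin H.n)} (h : Rec S μ μ') :
    troubledIn (H := H) μ' = troubledIn μ := by
  funext f
  simp only [troubledIn, h.1 _ _ (show Region.status ≠ .color by decide) (by decide)]

lemma randomColor_recolors (v : Fin H.n) :
    Recolors H {v} (randomColor v) (fun _ μ' => Rec {v} μ μ' ∧
      ∀ i, μ'.cell .arrW i = μ.cell .arrW i) μ := by
  have hQ : ∀ b : Bool, Rec (H := H) {v} μ (μ.write .color v b.toNat) ∧
      ∀ i, (μ.write .color v b.toNat).cell .arrW i = μ.cell .arrW i := fun b =>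
    ⟨⟨fun c i h1 _ => cell_write_of_ne h1 _ _ _ _, fun w hw => by
      have : (w : ℕ) ≠ v := fun h => hw (Finset.mem_singleton.2 (Fin.ext h))
      simp [this]⟩, fun i => cell_write_of_ne (by decide) _ _ _ _⟩
  have hcol : ∀ b : Bool, col H (μ.write .color v b.toNat) = Function.update (col H μ) v b := by
    intro b
    funext w
    rcases eq_or_ne w v with rfl | hne
    · simp [col]
    · simp [col, hne, Fin.val_inj]
  refine ⟨hQ, fun f r Z hf => ?_⟩
  rw [show ({v} : Finset (Fin H.n)) = insert v ∅ from rfl, rs_insert, rs_empty, rs_empty, ← hcol,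
    ← hcol]
  exact ENNReal.div_le_div_right (add_le_add (hf _ _ (hQ true)) (hf _ _ (hQ false))) _

lemma resampleEdge_recolors (hk : H.Uniform p.k) (f : Fin H.m) :
    Recolors H (troubledIn μ f) (resampleEdge p f) (fun _ μ' => Rec (troubledIn μ f) μ μ' ∧
      ∀ i, μ'.cell .arrW i = μ.cell .arrW i) μ := by
  obtain ⟨l, hl, hs, he⟩ := exists_memberList f
  have hlen : l.length = p.k := by rw [← List.toFinset_card_of_nodup hl, hs, hk f]
  have key : ∀ j, j ≤ l.length → ∀ μ : Mem,
      Recolors H ((l.take j).toFinset.filter fun v : Fin H.n => μ.cell .status v = troubled)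
        (forMembers f (fun _ v => .load .status v fun s =>
          if s = troubled then randomColor v else .ret ()) j ()) (fun _ μ' =>
          Rec ((l.take j).toFinset.filter fun v : Fin H.n => μ.cell .status v = troubled) μ μ' ∧
            ∀ i, μ'.cell .arrW i = μ.cell .arrW i) μ := by
    intro j
    induction j with
    | zero =>
      intro _ μ
      have : ((l.take 0).toFinset.filter fun v : Fin H.n => μ.cell .status v = troubled) = ∅ := by
        simp
      rw [this]
      exact recolors_ret ⟨Rec.refl _ _, fun _ => rfl⟩
    | succ j ih =>
      intro hj μ
      have hget : (H.memberList f).getD j 0 = (l[j] : ℕ) := by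
        rw [he, getD_map_val l (by omega)]
      have htake : (l.take (j + 1)).toFinset = insert l[j] (l.take j).toFinset := by
        rw [List.take_succ_eq_append_getElem (by omega), List.toFinset_append, Finset.union_comm]
        rfl
      rw [htake, Finset.filter_insert]
      by_cases ht : μ.cell .status l[j] = troubled
      · rw [if_pos ht, Finset.insert_eq]
        have hbind := (randomColor_recolors (H := H) (μ := μ) l[j]).bind
          (g := fun _ => forMembers f (fun _ v => .load .status v fun s =>
            if s = troubled then randomColor v else .ret ()) j ())
          (Q' := fun _ μ' => Rec ({l[j]} ∪ (l.take j).toFinset.filter fun v : Fin H.n =>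
            μ.cell .status v = troubled) μ μ' ∧ ∀ i, μ'.cell .arrW i = μ.cell .arrW i)
          (S' := (l.take j).toFinset.filter fun v : Fin H.n => μ.cell .status v = troubled) (by
            rintro ⟨⟩ ν ⟨hν, hW⟩
            have := ih (by omega) ν
            have hst : ∀ v : Fin H.n, ν.cell .status v = μ.cell .status v := fun v =>
              hν.1 _ _ (by decide) (by decide)
            simp only [hst] at this
            refine this.mono fun _ ν' h => ⟨?_, fun i => (h.2 i).trans (hW i)⟩
            exact (hν.mono Finset.subset_union_left).trans (h.1.mono Finset.subset_union_right))
        refine ⟨?_, fun g r Z hg => ?_⟩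
        · have := hbind.1
          rw [wp_bind] at this
          rw [forMembers]
          simp only [Prog.bind_def, wp, wp_bind, hget, ht, if_true]
          exact this
        · have := hbind.2 g r Z hg
          rw [ev_bind] at this
          rw [forMembers]
          simp only [Prog.bind_def, ev, ev_bind, hget, ht, if_true]
          exact this
      · rw [if_neg ht]
        refine ⟨?_, fun g r Z hg => ?_⟩
        · have := (ih (by omega) μ).1
          rw [forMembers]
          simp only [Prog.bind_def, wp, wp_bind, hget, ht, if_false]
          exact this
        · have := (ih (by omega) μ).2 g r Z hg
          rw [forMembers]
          simp only [Prog.bind_def, ev, ev_bind, hget, ht, if_false]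
          exact this
  have := key l.length le_rfl μ
  rw [List.take_length, hs] at this
  rw [resampleEdge, ← hlen]
  exact this

/-! ### The resampling algorithm on a final component -/

/-- The first `w` cells of the array `W` contain edges of `C`, among them all those in `D`. -/
def WList (C : Finset (Fin H.m)) (μ : Mem) (w : ℕ) (D : Set (Fin H.m)) : Prop :=
  (∀ i < w, ∃ g ∈ C, μ.cell .arrW i = g) ∧ ∀ g ∈ D, ∃ i < w, μ.cell .arrW i = g

lemma WList.mono {C : Finset (Fin H.m)} {w : ℕ} {D D' : Set (Fin H.m)} (h : WList C μ w D)
    (hD : D' ⊆ D) : WList C μ w D' := ⟨h.1, fun g hg => h.2 g (hD hg)⟩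

lemma WList.congr {C : Finset (Fin H.m)} {w : ℕ} {D : Set (Fin H.m)} (h : WList C μ w D)
    (h' : ∀ i, μ'.cell .arrW i = μ.cell .arrW i) : WList C μ' w D := by
  simpa only [WList, h'] using h

lemma WList.push {C : Finset (Fin H.m)} {w : ℕ} {D : Set (Fin H.m)} (h : WList C μ w D)
    {g : Fin H.m} (hg : g ∈ C) : WList C (μ.write .arrW w g) (w + 1) (insert g D) := by
  refine ⟨fun i hi => ?_, fun f hf => ?_⟩
  · rcases Nat.lt_succ_iff_lt_or_eq.1 hi with hi | rfl
    · obtain ⟨f, hf, h1⟩ := h.1 i hi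
      exact ⟨f, hf, by simp [hi.ne, h1]⟩
    · exact ⟨g, hg, by simp⟩
  · rcases hf with rfl | hf
    · exact ⟨w, by omega, by simp⟩
    · obtain ⟨i, hi, h1⟩ := h.2 f hf
      exact ⟨i, by omega, by simp [hi.ne, h1]⟩

/-- The monochromatic edges of `C`. -/
def monoSet (C : Finset (Fin H.m)) (μ : Mem) : Set (Fin H.m) :=
  {g | g ∈ C ∧ Mono (troubledIn μ) g (col H μ)}

lemma mono_iff {f : Fin H.m} : Mono (troubledIn μ) f (col H μ) ↔
    ((H.edge f).filter fun v : Fin H.n =>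
      μ.cell .status v = troubled ∧ μ.cell .color v = 0).card = 0 ∨
    ((H.edge f).filter fun v : Fin H.n =>
      μ.cell .status v = troubled ∧ μ.cell .color v ≠ 0).card = 0 := by
  have hb : ∀ P : Fin H.n → Prop, ∀ _ : DecidablePred P, ((H.edge f).filter P).card = 0 ↔
      ∀ v ∈ H.edge f, ¬ P v := fun P _ => by
    rw [Finset.card_eq_zero, Finset.filter_eq_empty_iff]
  rw [hb, hb, Mono, Bool.exists_bool, or_comm]
  simp only [troubledIn, Finset.mem_filter, col, and_imp, not_and, decide_eq_false_iff_not,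
    decide_eq_true_eq]

lemma findMonochromatic_detPost (hk : H.Uniform p.k) {C : Finset (Fin H.m)} (w : ℕ)
    {D : Set (Fin H.m)} (h : WList C μ w D) :
    (findMonochromatic p w).DetPost H (fun o μ' => μ' = μ ∧
      (o = none → ∀ g ∈ D, ¬ Mono (troubledIn μ) g (col H μ)) ∧
      ∀ x, o = some x → ∃ f ∈ C, x.1 = (f : ℕ) ∧ Mono (troubledIn μ) f (col H μ) ∧
        WList C μ x.2 {g | g ∈ D ∧ Mono (troubledIn μ) g (col H μ) ∧ g ≠ f}) μ := by
  induction w generalizing D with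
  | zero =>
    refine detPost_ret ⟨rfl, fun _ g hg => ?_, by simp⟩
    obtain ⟨i, hi, -⟩ := h.2 g hg
    omega
  | succ w ih =>
    obtain ⟨f, hf, hcell⟩ := h.1 w (by omega)
    refine loopLogic_detPost.load ?_
    rw [hcell, Prog.bind_def]
    refine (countColors_detPost hk troubled f μ).bind ?_
    rintro x ν ⟨hν, h1, h2⟩
    subst hν
    have hrest : WList C ν w {g | g ∈ D ∧ g ≠ f} := by
      refine ⟨fun i hi => h.1 i (by omega), fun g hg => ?_⟩
      obtain ⟨i, hi, h3⟩ := h.2 g hg.1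
      rcases Nat.lt_succ_iff_lt_or_eq.1 hi with hi | rfl
      · exact ⟨i, hi, h3⟩
      · exact absurd (Fin.ext (h3.symm.trans hcell)) hg.2
    have hiff : x.1 = 0 ∨ x.2 = 0 ↔ Mono (troubledIn ν) f (col H ν) := by
      rw [h1, h2, mono_iff]
    split_ifs with hx
    · refine detPost_ret ⟨rfl, by simp, ?_⟩
      rintro y hy
      obtain rfl := Option.some.inj hy
      exact ⟨f, hf, rfl, hiff.1 hx, hrest.mono fun g hg => ⟨hg.1, hg.2.2⟩⟩
    · have hm : ¬ Mono (troubledIn ν) f (col H ν) := fun h => hx (hiff.2 h)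
      refine (ih hrest).mono ?_
      rintro o ν' ⟨hν', h3, h4⟩
      refine ⟨hν', fun ho g hg hmg => ?_, fun y hy => ?_⟩
      · rcases eq_or_ne g f with rfl | hne
        · exact hm hmg
        · exact h3 ho g ⟨hg, hne⟩ hmg
      · obtain ⟨f', hf', h5, h6, h7⟩ := h4 y hy
        refine ⟨f', hf', h5, h6, h7.mono fun g hg => ⟨⟨hg.1, ?_⟩, hg.2⟩⟩
        rintro rfl
        exact hm hg.2.1

/-- One step of the resampling algorithm for the monochromatic edge `f`. An edge can only become
monochromatic if it intersects `f`. -/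
lemma resampleStep_recolors (hk : H.Uniform p.k) (hk0 : 0 < p.k) {C : Finset (Fin H.m)}
    (hflag : ∀ g : Fin H.m, μ.cell .inComp g ≠ 0 ↔ g ∈ C) {f : Fin H.m} {w : ℕ}
    (hw : WList C μ w {g | g ∈ monoSet C μ ∧ Mono (troubledIn μ) g (col H μ) ∧ g ≠ f}) :
    Recolors H (troubledIn μ f) ((resampleEdge p f).bind fun _ =>
      forNeighbors p f (fun w g => .load .inComp g fun flag =>
        if flag ≠ 0 then .store .arrW w g (.ret (w + 1)) else .ret w) w)
      (fun w' μ' => Rec (troubledIn μ f) μ μ' ∧ WList C μ' w' (monoSet C μ')) μ := by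
  rw [← Finset.union_empty (troubledIn μ f)]
  refine (resampleEdge_recolors hk f).bind ?_
  rintro ⟨⟩ ν ⟨hν, hνW⟩
  rw [Finset.union_empty]
  have hflag' : ∀ g : Fin H.m, ν.cell .inComp g ≠ 0 ↔ g ∈ C := fun g => by
    rw [hν.1 _ _ (by decide) (by decide)]; exact hflag g
  set D : Set (Fin H.m) := {g | g ∈ monoSet C μ ∧ Mono (troubledIn μ) g (col H μ) ∧ g ≠ f}
  refine (recolors_of_detPost (Q := fun w' μ' => (∀ c i, c ≠ .arrW →
    μ'.cell c i = ν.cell c i) ∧ WList C μ' w' (D ∪ {g | g ∈ nbhd f ∧ g ∈ C})) ?_ ?_).mono ?_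
  · refine forNeighbors_rule (loopLogic_detPost (H := H)) hk f (fun A w' μ' => (∀ c i, c ≠ .arrW →
      μ'.cell c i = ν.cell c i) ∧ WList C μ' w' (D ∪ {g | g ∈ A ∧ g ∈ C})) ?_
      ⟨fun _ _ _ => rfl, (hw.congr hνW).mono (by simp)⟩
    rintro A w' μ' g hg ⟨h1, h2⟩
    refine loopLogic_detPost.load ?_
    rw [h1 _ _ (by decide)]
    split_ifs with h0
    · have hgC := (hflag' g).1 h0
      refine ⟨_, _, ⟨rfl, rfl⟩, fun c i hc => ?_, (h2.push hgC).mono ?_⟩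
      · rw [cell_write_of_ne hc, h1 c i hc]
      · rintro g' (hg' | ⟨hg', hgC'⟩)
        · exact Or.inr (Or.inl hg')
        · rcases Finset.mem_insert.1 hg' with rfl | hg'
          · exact Or.inl rfl
          · exact Or.inr (Or.inr ⟨hg', hgC'⟩)
    · refine detPost_ret ⟨h1, h2.mono ?_⟩
      rintro g' (hg' | ⟨hg', hgC'⟩)
      · exact Or.inl hg'
      · rcases Finset.mem_insert.1 hg' with rfl | hg'
        · exact absurd ((hflag' _).2 hgC') h0
        · exact Or.inr ⟨hg', hgC'⟩
  · rintro w' μ' ⟨h1, -⟩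
    funext v
    simp only [col, h1 _ _ (show Region.color ≠ .arrW by decide)]
  · rintro w' μ' ⟨h1, h2⟩
    have hrec : Rec (troubledIn μ f) μ μ' := ⟨fun c i hc hc' => by
      rw [h1 c i hc', hν.1 c i hc hc'], fun v hv => by rw [h1 _ _ (by decide), hν.2 v hv]⟩
    refine ⟨hrec, h2.mono ?_⟩
    rintro g ⟨hgC, hg⟩
    by_cases hgf : g ∈ nbhd f
    · exact Or.inr ⟨hgf, hgC⟩
    · -- the colors of `g` have not changed
      have hm : Mono (troubledIn μ) g (col H μ) := by
        rw [hrec.troubledIn_eq] at hg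
        obtain ⟨b, hb⟩ := hg
        refine ⟨b, fun v hv => ?_⟩
        have hvf : v ∉ troubledIn μ f := fun hvf =>
          hgf (mem_nbhd_of_mem (Finset.mem_filter.1 hvf).1 (Finset.mem_filter.1 hv).1)
        rw [← hb v hv, col, col, hrec.2 v hvf]
      refine Or.inl ⟨⟨hgC, hm⟩, hm, ?_⟩
      rintro rfl
      obtain ⟨v, hv⟩ : (H.edge g).Nonempty := by rw [← Finset.card_pos, hk g]; exact hk0
      exact hgf (mem_nbhd_of_mem hv hv)

/-- The neighborhoods in the component `C`. -/
def compNbhd (C : Finset (Fin H.m)) (f : {f // f ∈ C}) : Finset {f // f ∈ C} :=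
  Finset.univ.filter fun g => (g : Fin H.m) ∈ nbhd (f : Fin H.m)

lemma isNbhd_compNbhd (hk : H.Uniform p.k) (hk0 : 0 < p.k) (C : Finset (Fin H.m)) (μ : Mem) :
    IsNbhd (fun f : {f // f ∈ C} => troubledIn μ (f : Fin H.m)) (compNbhd C) where
  self_mem f := by
    obtain ⟨v, hv⟩ : (H.edge (f : Fin H.m)).Nonempty := by rw [← Finset.card_pos, hk f]; exact hk0
    exact Finset.mem_filter.2 ⟨Finset.mem_univ _, mem_nbhd_of_mem hv hv⟩
  symm f g h := by
    simp only [compNbhd, Finset.mem_filter, Finset.mem_univ, true_and] at h ⊢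
    rwa [mem_nbhd_comm]
  disjoint f g h := by
    rw [Finset.disjoint_left]
    intro v hv hv'
    exact h (Finset.mem_filter.2 ⟨Finset.mem_univ _, mem_nbhd_of_mem
      (v := v) (Finset.mem_filter.1 hv).1 (Finset.mem_filter.1 hv').1⟩)

/-- The upper bound for the number of resampling steps in the component `C`. -/
noncomputable def compPot (C : Finset (Fin H.m)) (μ : Mem) (τ : Fin H.n → Bool) : ℝ≥0∞ :=
  stepPot (fun f : {f // f ∈ C} => troubledIn μ (f : Fin H.m)) (compNbhd C) Finset.univ τ

lemma ev_le_one {q : Prog α} {f : α → Mem → ℝ≥0∞} {r : Mem → ℝ≥0∞} (hf : ∀ a μ, f a μ ≤ 1)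
    (hr : ∀ μ, r μ ≤ 1) (μ : Mem) : q.ev H f r μ ≤ 1 := by
  have h1 : q.ev H f r μ ≤ q.ev H (fun _ _ => 0 + 1) (fun _ => 0 + 1) μ :=
    ev_mono (by simpa using hf) (by simpa using hr)
  rw [ev_add_const_le] at h1
  refine h1.trans ?_
  have h2 := q.ev_mul_const (H := H) (fun _ _ => 0) (fun _ => 0) 0 μ
  simp only [zero_mul] at h2
  rw [h2, zero_add]

/-- The recursion without the join points of the `do` notation. -/
lemma resample_succ (p : Params) (s w : ℕ) : resample p (s + 1) w =
    (findMonochromatic p w).bind fun found => match found with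
      | none => .ret true
      | some (f, w') => ((resampleEdge p f).bind fun _ =>
          forNeighbors p f (fun w g => .load .inComp g fun flag =>
            if flag ≠ 0 then .store .arrW w g (.ret (w + 1)) else .ret w) w').bind
              fun w'' => resample p s w'' := by
  rw [resample, Prog.bind_def]
  congr 1
  funext found
  rcases found with _ | ⟨f, w'⟩
  · rfl
  · simp only [Prog.bind_def, Base.bind_assoc]

lemma resample_wp (hk : H.Uniform p.k) (hk0 : 0 < p.k) {C : Finset (Fin H.m)} (s : ℕ) :
    ∀ (w : ℕ) (μ : Mem), (∀ g : Fin H.m, μ.cell .inComp g ≠ 0 ↔ g ∈ C) →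
    WList C μ w (monoSet C μ) →
    (resample p s w).wp H (fun ok μ' => Rec (C.biUnion (troubledIn μ)) μ μ' ∧
      (ok = true → monoSet C μ' = ∅)) (fun _ => False) μ := by
  induction s with
  | zero => exact fun w μ _ _ => ⟨Rec.refl _ _, by simp⟩
  | succ s ih =>
    intro w μ hflag hw
    rw [resample_succ]
    refine (findMonochromatic_detPost hk w hw).wp_bind ?_
    rintro o ν ⟨hν, h1, h2⟩
    subst hν
    rcases o with _ | ⟨f, w'⟩
    · exact ⟨Rec.refl _ _, fun _ => Set.eq_empty_of_forall_notMem fun g hg => h1 rfl g hg hg.2⟩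
    · obtain ⟨f, hf, rfl, -, hw'⟩ := h2 _ rfl
      refine (wp_bind _ _ _ _ _).2 (wp_post (resampleStep_recolors hk hk0 hflag hw').1 ?_)
      rintro w'' μ' ⟨hrec, hw''⟩
      refine wp_post (ih w'' μ' (fun g => ?_) hw'') ?_
      · rw [hrec.1 _ _ (by decide) (by decide)]; exact hflag g
      · rintro ok μ'' ⟨h3, h4⟩
        rw [hrec.troubledIn_eq] at h3
        exact ⟨(hrec.mono (Finset.subset_biUnion_of_mem _ hf)).trans h3, h4⟩

/-- Markov's inequality for the number of resampling steps: a run that is not successful makes `s`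
steps, and each of them is paid by the potential. -/
lemma mul_ev_resample_le (hk : H.Uniform p.k) (hk0 : 0 < p.k) {C : Finset (Fin H.m)} (s : ℕ) :
    ∀ (w : ℕ) (μ : Mem), (∀ g : Fin H.m, μ.cell .inComp g ≠ 0 ↔ g ∈ C) →
    WList C μ w (monoSet C μ) →
    s * (resample p s w).ev H (fun ok _ => if ok = true then 0 else 1) (fun _ => 0) μ ≤
      compPot C μ (col H μ) := by
  induction s with
  | zero => intro w μ _ _; simp
  | succ s ih =>
    intro w μ hflag hw
    obtain ⟨o, ν, hdet, hν, h1, h2⟩ := findMonochromatic_detPost hk w hw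
    subst hν
    rw [resample_succ, hdet.ev_bind]
    rcases o with _ | ⟨f, w'⟩
    · simp [ev]
    · obtain ⟨f, hf, rfl, hm, hw'⟩ := h2 _ rfl
      have hN := isNbhd_compNbhd hk hk0 C ν
      have hm' : Mono (fun g : {g // g ∈ C} => troubledIn ν (g : Fin H.m)) ⟨f, hf⟩ (col H ν) := hm
      refine le_trans ?_ (one_add_rs_stepPot_le hN (Finset.mem_univ _) hm')
      dsimp only
      rw [Nat.cast_add, Nat.cast_one, add_comm, add_mul, one_mul]
      refine add_le_add (ev_le_one (fun a _ => by split_ifs <;> simp) (fun _ => by simp) _) ?_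
      rw [← ev_mul_const, ev_bind]
      refine (resampleStep_recolors hk hk0 hflag hw').2 _ _ _ ?_
      rintro w'' μ' ⟨hrec, hw''⟩
      have := ih w'' μ' (fun g => by
        rw [hrec.1 _ _ (by decide) (by decide)]; exact hflag g) hw''
      rw [compPot, hrec.troubledIn_eq] at this
      refine le_trans (le_of_eq ?_) this
      rw [← ev_mul_const]

end Base

/-! ### The final coloring phase -/

namespace Base

open Prog HypergraphLCA.Hypergraph Resampling

variable {H : Hypergraph} {p : Params} {u : ℕ} {μ μ' : Mem}

/-- A trial starts with random colors for all troubled vertices of the component, and with a list of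
all its edges. -/
lemma initTrial_recolors (hk : H.Uniform p.k) {C : Finset (Fin H.m)} (len : ℕ) :
    ∀ (R : Finset (Fin H.m)) (w : ℕ) (μ : Mem) (D : Set (Fin H.m)), Lists μ .arrC len R → R ⊆ C →
    WList C μ w D → Recolors H (R.biUnion (troubledIn μ))
      (forArray .arrC (fun w f => (resampleEdge p f).bind fun _ =>
        .store .arrW w f (.ret (w + 1))) len w)
      (fun w' μ' => Rec (R.biUnion (troubledIn μ)) μ μ' ∧ WList C μ' w' (D ∪ R)) μ := by
  induction len with
  | zero =>
    intro R w μ D hR _ hw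
    rw [show R = ∅ from hR, Finset.biUnion_empty]
    exact recolors_ret ⟨Rec.refl _ _, by simpa using hw⟩
  | succ len ih =>
    rintro R w μ D ⟨g, hg, hcell, hR⟩ hRC hw
    have hstep : Recolors H (troubledIn μ g) ((resampleEdge p g).bind fun _ =>
        .store .arrW w g (.ret (w + 1)))
        (fun w' μ' => Rec (troubledIn μ g) μ μ' ∧ WList C μ' w' (insert g D)) μ := by
      rw [← Finset.union_empty (troubledIn μ g)]
      refine (resampleEdge_recolors hk g).bind ?_
      rintro ⟨⟩ ν ⟨hν, hνW⟩
      rw [Finset.union_empty]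
      have hdet : (Prog.store .arrW w g (.ret (w + 1))).DetPost H
          (fun w' μ' => w' = w + 1 ∧ μ' = ν.write .arrW w g) ν := ⟨_, _, ⟨rfl, rfl⟩, rfl, rfl⟩
      refine (recolors_of_detPost hdet ?_).mono ?_
      · rintro _ _ ⟨-, rfl⟩
        funext v
        simp [col]
      · rintro _ _ ⟨rfl, rfl⟩
        refine ⟨⟨fun c i h1 h2 => ?_, fun v hv => ?_⟩, (hw.congr hνW).push (hRC hg)⟩
        · rw [cell_write_of_ne h2, hν.1 c i h1 h2]
        · rw [cell_write_of_ne (by decide), hν.2 v hv]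
    have hunion : R.biUnion (troubledIn μ) =
        troubledIn μ g ∪ (R.erase g).biUnion (troubledIn μ) := by
      rw [← Finset.biUnion_insert, Finset.insert_erase hg]
    have hbind := hstep.bind (g := fun w' => forArray .arrC (fun w f =>
      (resampleEdge p f).bind fun _ => .store .arrW w f (.ret (w + 1))) len w')
      (S' := (R.erase g).biUnion (troubledIn μ))
      (Q' := fun w' μ' => Rec (R.biUnion (troubledIn μ)) μ μ' ∧ WList C μ' w' (D ∪ R)) (by
        rintro w' ν ⟨hν, hw'⟩
        have := ih (R.erase g) w' ν _ (hR.congr fun i _ => hν.1 _ _ (by decide) (by decide))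
          ((Finset.erase_subset _ _).trans hRC) hw'
        rw [hν.troubledIn_eq] at this
        refine this.mono fun w'' ν' h => ⟨?_, h.2.mono ?_⟩
        · rw [hunion]
          exact (hν.mono Finset.subset_union_left).trans (h.1.mono Finset.subset_union_right)
        · rintro f (hf | hf)
          · exact Or.inl (Or.inr hf)
          · rcases eq_or_ne f g with rfl | hne
            · exact Or.inl (Or.inl rfl)
            · exact Or.inr (Finset.mem_coe.2 (Finset.mem_erase.2 ⟨hne, hf⟩)))
    rw [← hunion] at hbind
    rw [forArray]
    refine ⟨?_, fun f r Z hf => ?_⟩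
    · rw [wp, hcell]
      exact hbind.1
    · rw [ev, hcell]
      exact hbind.2 f r Z hf

/-- The memory represents the component `C`, whose edges have sufficiently many troubled
vertices. -/
structure TrialOK (p : Params) (len : ℕ) (C : Finset (Fin H.m)) (μ : Mem) : Prop where
  list : Lists μ .arrC len C
  flag : ∀ g : Fin H.m, μ.cell .inComp g ≠ 0 ↔ g ∈ C
  le_card : ∀ f ∈ C, p.a ≤ (troubledIn μ f).card
  nonempty : C.Nonempty

lemma TrialOK.of_rec {len : ℕ} {C : Finset (Fin H.m)} {S : Finset (Fin H.n)}
    (h : TrialOK p len C μ) (h' : Rec S μ μ') : TrialOK p len C μ' where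
  list := h.list.congr fun i _ => h'.1 _ _ (by decide) (by decide)
  flag g := by rw [h'.1 _ _ (by decide) (by decide)]; exact h.flag g
  le_card := by rw [h'.troubledIn_eq]; exact h.le_card
  nonempty := h.nonempty

/-- The condition of the local lemma for the resampling of components: `2 / 2 ^ a` is the probability
that an edge with `a` troubled vertices is monochromatic, `Δ + 1` bounds the number of edges that
intersect it, including the edge itself, and `1 / max Δ 1` is the weight given to an edge. -/
def LocalLemma (p : Params) : Prop :=
  (2 / 2 ^ p.a : ℝ≥0∞) * (1 + ((max p.Δ 1 : ℕ) : ℝ≥0∞)⁻¹) ^ (p.Δ + 1) ≤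
    ((max p.Δ 1 : ℕ) : ℝ≥0∞)⁻¹

lemma card_compNbhd_le (C : Finset (Fin H.m)) (f : {f // f ∈ C}) :
    (compNbhd C f).card ≤ H.maxEdgeDegree + 1 := by
  have h1 : ((compNbhd C f).map (Function.Embedding.subtype _)) ⊆
      insert (f : Fin H.m) (H.nbrs f) := fun g hg => by
    obtain ⟨g', hg', rfl⟩ := Finset.mem_map.1 hg
    rw [Finset.mem_insert, or_iff_not_imp_left]
    exact fun hne => mem_nbrs_of_mem_nbhd (Finset.mem_filter.1 hg').2 hne
  rw [← Finset.card_map (Function.Embedding.subtype _)]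
  refine (Finset.card_le_card h1).trans ((Finset.card_insert_le _ _).trans ?_)
  exact Nat.succ_le_succ (card_nbrs_le _)

lemma two_mul_le_steps (p : Params) (c : ℕ) :
    2 * ((c : ℝ≥0∞) * ((max p.Δ 1 : ℕ) : ℝ≥0∞)⁻¹) ≤ p.steps c := by
  have hD : 0 < max p.Δ 1 := lt_max_of_lt_right one_pos
  have h1 : (2 * c : ℚ) / (max p.Δ 1 : ℕ) ≤ p.steps c := Nat.le_ceil _
  rw [div_le_iff₀ (by exact_mod_cast hD)] at h1
  have h2 : 2 * c ≤ p.steps c * max p.Δ 1 := by exact_mod_cast h1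
  rw [← mul_assoc, ← div_eq_mul_inv]
  refine ENNReal.div_le_of_le_mul ?_
  exact_mod_cast h2

/-- A trial may make twice the expected number of steps, so that it fails with probability at most
`1 / 2`. -/
lemma trial_spec (hk : H.Uniform p.k) (hk0 : 0 < p.k) (hΔ : p.Δ = H.maxEdgeDegree)
    (hL : LocalLemma p) {len : ℕ} {C : Finset (Fin H.m)} (h : TrialOK p len C μ) :
    (trial p len).wp H (fun ok μ' => Rec (C.biUnion (troubledIn μ)) μ μ' ∧
      (ok = true → monoSet C μ' = ∅)) (fun _ => False) μ ∧
    (trial p len).ev H (fun ok _ => if ok = true then 0 else 1) (fun _ => 0) μ ≤ 1 / 2 := by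
  have hinit := initTrial_recolors (C := C) hk len C 0 μ ∅ h.list subset_rfl
    ⟨by simp, by simp⟩
  have hmono : ∀ μ', (C : Set (Fin H.m)) ⊇ monoSet C μ' := fun μ' g hg => hg.1
  rw [trial, Prog.bind_def]
  simp only [Prog.bind_def]
  constructor
  · refine (wp_bind _ _ _ _ _).2 (wp_post hinit.1 ?_)
    rintro w ν ⟨hν, hw⟩
    refine wp_post (resample_wp hk hk0 (p.steps len) w ν (h.of_rec hν).flag
      (hw.mono ((hmono ν).trans Set.subset_union_right))) ?_
    rintro ok ν' ⟨h1, h2⟩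
    rw [hν.troubledIn_eq] at h1
    exact ⟨hν.trans h1, h2⟩
  · set P := ((forArray .arrC (fun w f => (resampleEdge p f).bind fun _ =>
        .store .arrW w f (.ret (w + 1))) len 0).bind fun w => resample p (p.steps len) w).ev H
        (fun ok _ => if ok = true then 0 else 1) (fun _ => 0) μ with hP
    set y : ℝ≥0∞ := ((max p.Δ 1 : ℕ) : ℝ≥0∞)⁻¹ with hy
    have h1 : p.steps len * P ≤ rs (C.biUnion (troubledIn μ)) (compPot C μ) (col H μ) := by
      rw [hP, ← ev_mul_const, ev_bind]
      refine hinit.2 _ _ _ ?_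
      rintro w ν ⟨hν, hw⟩
      have := mul_ev_resample_le hk hk0 (p.steps len) w ν (h.of_rec hν).flag
        (hw.mono ((hmono ν).trans Set.subset_union_right))
      rw [compPot, hν.troubledIn_eq, ← ev_mul_const] at this
      exact this
    have h2 : rs (C.biUnion (troubledIn μ)) (compPot C μ) (col H μ) ≤ C.card * y := by
      have := rs_stepPot_le (S := C.biUnion (troubledIn μ)) (q := 2 / 2 ^ p.a) (y := y)
        (D := p.Δ + 1) (isNbhd_compNbhd hk hk0 C μ)
        (fun f => Finset.subset_biUnion_of_mem (troubledIn μ) f.2)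
        (fun f P _ hPm => rs_mono_le (troubledIn μ (f : Fin H.m)) p.a (h.le_card f f.2) P hPm)
        hL (fun f => by rw [hΔ]; exact card_compNbhd_le C f) Finset.univ (col H μ)
      rwa [Finset.card_univ, Fintype.card_coe] at this
    have h3 := two_mul_le_steps p C.card
    rw [← h.list.card] at h1
    have h4 : (C.card * y) * (2 * P) ≤ (C.card * y) * 1 := by
      rw [mul_one]
      refine le_trans ?_ (h1.trans h2)
      rw [mul_left_comm, ← mul_assoc]
      gcongr
    have hy0 : y ≠ 0 := by simp [hy]
    have hy1 : y ≠ ⊤ := by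
      rw [hy, ENNReal.inv_ne_top]
      exact_mod_cast (lt_max_of_lt_right one_pos : 0 < max p.Δ 1).ne'
    have hc0 : (C.card : ℝ≥0∞) ≠ 0 := by exact_mod_cast (Finset.card_pos.2 h.nonempty).ne'
    have h5 := (ENNReal.mul_le_mul_iff_right (mul_ne_zero hc0 hy0)
      (ENNReal.mul_ne_top (by simp) hy1)).1 h4
    rw [ENNReal.le_div_iff_mul_le (by simp) (by simp), mul_comm]
    exact h5

lemma trialLoop_spec (hk : H.Uniform p.k) (hk0 : 0 < p.k) (hΔ : p.Δ = H.maxEdgeDegree)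
    (hL : LocalLemma p) {len : ℕ} {C : Finset (Fin H.m)} (i : ℕ) :
    ∀ μ : Mem, TrialOK p len C μ →
    (trialLoop p len i).wp H (fun _ μ' => Rec (C.biUnion (troubledIn μ)) μ μ' ∧
      monoSet C μ' = ∅) (fun _ => True) μ ∧
    (trialLoop p len i).ev H (fun _ _ => 0) (fun _ => 1) μ ≤ (1 / 2) ^ i := by
  induction i with
  | zero => exact fun μ _ => ⟨trivial, by simp [trialLoop, ev]⟩
  | succ i ih =>
    intro μ h
    obtain ⟨h1, h2⟩ := trial_spec hk hk0 hΔ hL h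
    rw [trialLoop, Prog.bind_def]
    constructor
    · refine (wp_bind _ _ _ _ _).2 (wp_mono h1 ?_ fun _ h => h.elim)
      rintro ok ν ⟨h3, h4⟩
      split_ifs with hok
      · exact ⟨h3, h4 hok⟩
      · refine wp_post (ih ν (h.of_rec h3)).1 ?_
        rintro _ ν' ⟨h5, h6⟩
        rw [h3.troubledIn_eq] at h5
        exact ⟨h3.trans h5, h6⟩
    · rw [ev_bind, pow_succ]
      calc _ ≤ (trial p len).ev H (fun ok _ => (1 / 2) ^ i * if ok = true then 0 else 1)
            (fun _ => (1 / 2) ^ i * 0) μ := by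
            refine ev_le_ev h1 ?_ fun _ h => h.elim
            rintro ok ν ⟨h3, h4⟩
            split_ifs with hok
            · simp [ev]
            · rw [mul_one]; exact (ih ν (h.of_rec h3)).2
        _ ≤ (1 / 2) ^ i * (1 / 2) := by
            rw [ev_mul_const]
            gcongr

/-- The vertices of the component become accepted. -/
lemma acceptAll_detPost (hk : H.Uniform p.k) {len : ℕ} {C : Finset (Fin H.m)}
    (hC : Lists μ .arrC len C) :
    (forArray .arrC (fun _ f => .store .inComp f 0 <|
      forMembers f (fun _ v => .load .status v fun s =>
        if s = troubled then .store .status v accepted (.ret ()) else .ret ()) p.k ())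
      len ()).DetPost H (fun _ μ' => (∀ c i, c ≠ .inComp → c ≠ .status →
        μ'.cell c i = μ.cell c i) ∧
        (∀ g : Fin H.m, μ'.cell .inComp g = if g ∈ C then 0 else μ.cell .inComp g) ∧
        ∀ v : Fin H.n, μ'.cell .status v =
          if ∃ f ∈ C, v ∈ troubledIn μ f then accepted else μ.cell .status v) μ := by
  refine forArray_rule (loopLogic_detPost (H := H)) hC (fun A _ μ' =>
    (∀ c i, c ≠ .inComp → c ≠ .status → μ'.cell c i = μ.cell c i) ∧
    (∀ g : Fin H.m, μ'.cell .inComp g = if g ∈ A then 0 else μ.cell .inComp g) ∧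
    ∀ v : Fin H.n, μ'.cell .status v =
      if ∃ f ∈ A, v ∈ troubledIn μ f then accepted else μ.cell .status v) ?_
    (fun A _ μ' h i => h.1 _ _ (by decide) (by decide)) ⟨fun _ _ _ _ => rfl, by simp, by simp⟩
  rintro A ⟨⟩ ν f hf - ⟨h1, h2, h3⟩
  have hinner := forMembers_rule (loopLogic_detPost (H := H)) hk f (σ := Unit)
    (body := fun _ v => .load .status v fun s =>
        if s = troubled then .store .status v accepted (.ret ()) else .ret ())
    (fun N _ μ' => (∀ c i, c ≠ .inComp → c ≠ .status → μ'.cell c i = μ.cell c i) ∧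
      (∀ g : Fin H.m, μ'.cell .inComp g = if g ∈ insert f A then 0 else μ.cell .inComp g) ∧
      ∀ v : Fin H.n, μ'.cell .status v =
        if (∃ f ∈ A, v ∈ troubledIn μ f) ∨ (v ∈ N ∧ μ.cell .status v = troubled) then accepted
        else μ.cell .status v) (x := ()) (μ := ν.write .inComp f 0) ?_ ?_
  · refine DetPost.mono hinner ?_
    rintro ⟨⟩ ν' ⟨h4, h5, h6⟩
    refine ⟨h4, h5, fun v => ?_⟩
    rw [h6 v]
    refine if_congr ?_ rfl rfl
    simp only [Finset.mem_insert, exists_eq_or_imp]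
    rw [or_comm]
    exact or_congr_left (by rw [troubledIn, Finset.mem_filter])
  · rintro N ⟨⟩ ν' v - - ⟨h4, h5, h6⟩
    refine loopLogic_detPost.load ?_
    have hv := h6 v
    split_ifs with ht
    · refine ⟨_, _, ⟨rfl, rfl⟩, fun c i hc hc' => ?_, fun g => ?_, fun w => ?_⟩
      · rw [cell_write_of_ne hc', h4 c i hc hc']
      · rw [cell_write_of_ne (by decide), h5]
      · rcases eq_or_ne w v with rfl | hne
        · rw [cell_write_self]
          split_ifs at hv with hc
          · rw [ht] at hv; simp at hv
          · rw [if_pos (Or.inr ⟨Finset.mem_insert_self _ _, by rw [← hv, ht]⟩)]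
        · have hne' : (w : ℕ) ≠ v := fun h => hne (Fin.ext h)
          rw [cell_write, if_neg (by simp [hne']), h6]
          simp only [Finset.mem_insert, hne, false_or]
    · refine detPost_ret ⟨h4, h5, fun w => ?_⟩
      rcases eq_or_ne w v with rfl | hne
      · by_cases hc : (∃ f ∈ A, w ∈ troubledIn μ f) ∨ (w ∈ N ∧ μ.cell .status w = troubled)
        · rw [if_pos hc] at hv
          rw [hv, if_pos (hc.imp_right fun h => ⟨Finset.mem_insert_of_mem h.1, h.2⟩)]
        · rw [if_neg hc] at hv
          rw [hv] at ht ⊢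
          rw [if_neg]
          rintro (h | h)
          · exact hc (Or.inl h)
          · exact ht h.2
      · rw [h6]
        simp only [Finset.mem_insert, hne, false_or]
  · refine ⟨fun c i hc hc' => ?_, fun g => ?_, fun v => ?_⟩
    · rw [cell_write_of_ne hc, h1 c i hc hc']
    · simp only [Finset.mem_insert]
      rcases eq_or_ne g f with rfl | hne
      · simp
      · have hne' : (g : ℕ) ≠ f := fun h => hne (Fin.ext h)
        rw [cell_write, if_neg (by simp [hne']), h2]
        simp only [hne, false_or]
    · rw [cell_write_of_ne (by decide), h3]
      simp

lemma clearExplored_detPost {len : ℕ} {X : Finset (Fin H.m)} (hX : Lists μ .arrX len X)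
    (hflag : ∀ g : Fin H.m, μ.cell .explored g ≠ 0 → g ∈ X) :
    (forArray .arrX (fun _ g => .store .explored g 0 (.ret ())) len ()).DetPost H
      (fun _ μ' => (∀ c i, c ≠ .explored → μ'.cell c i = μ.cell c i) ∧
        ∀ g : Fin H.m, μ'.cell .explored g = 0) μ := by
  refine (forArray_rule (loopLogic_detPost (H := H)) hX (fun A (_ : Unit) μ' =>
    (∀ c i, c ≠ .explored → μ'.cell c i = μ.cell c i) ∧
      ∀ g : Fin H.m, μ'.cell .explored g = if g ∈ A then 0 else μ.cell .explored g) ?_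
      (fun A _ μ' h i => h.1 _ _ (by decide)) ⟨fun _ _ _ => rfl, by simp⟩).mono ?_
  · rintro A ⟨⟩ ν f - - ⟨h1, h2⟩
    refine ⟨_, _, ⟨rfl, rfl⟩, fun c i hc => ?_, fun g => ?_⟩
    · rw [cell_write_of_ne hc, h1 c i hc]
    · simp only [Finset.mem_insert]
      rcases eq_or_ne g f with rfl | hne
      · simp
      · have hne' : (g : ℕ) ≠ f := fun h => hne (Fin.ext h)
        rw [cell_write, if_neg (by simp [hne']), h2]
        simp only [hne, false_or]
  · rintro ⟨⟩ ν ⟨h1, h2⟩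
    refine ⟨h1, fun g => ?_⟩
    rw [h2]
    split_ifs with hg
    · rfl
    · by_contra hc
      exact hg (hflag g hc)

/-- The statuses before (`s`) and after (`s'`) the troubled vertices in `S` become accepted, where the
edges that contain some of them are safe before or afterwards. -/
structure Accepts (S : Finset (Fin H.n)) (s s' : Fin H.n → VStatus) : Prop where
  troubled : ∀ v ∈ S, s v = .troubled
  accepted : ∀ v ∈ S, ∃ b, s' v = .accepted b
  rest : ∀ v ∉ S, s' v = s v
  safe : ∀ v ∈ S, ∀ e, v ∈ H.edge e → Safe s e ∨ Safe s' e

section Accepts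

variable {S : Finset (Fin H.n)} {s s' : Fin H.n → VStatus}

lemma Accepts.acceptedIn_subset (h : Accepts S s s') (e : Fin H.m) (b : Bool) :
    H.acceptedIn s e b ⊆ H.acceptedIn s' e b := by
  intro v hv
  rw [mem_acceptedIn] at hv ⊢
  have hvS : v ∉ S := fun hvS => by simp [h.troubled v hvS] at hv
  exact ⟨hv.1, by rw [h.rest v hvS, hv.2]⟩

lemma Accepts.safe_mono (h : Accepts S s s') {e : Fin H.m} (he : Safe s e) : Safe s' e :=
  ⟨he.1.mono (h.acceptedIn_subset e _), he.2.mono (h.acceptedIn_subset e _)⟩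

/-- An edge is safe afterwards, or the statuses of its vertices are unchanged. -/
lemma Accepts.eq_or_safe (h : Accepts S s s') (e : Fin H.m) :
    Safe s' e ∨ ∀ v ∈ H.edge e, s' v = s v := by
  by_cases hS : ∃ v ∈ H.edge e, v ∈ S
  · obtain ⟨v, hve, hv⟩ := hS
    exact Or.inl ((h.safe v hv e hve).elim h.safe_mono id)
  · push Not at hS
    exact Or.inr fun v hv => h.rest v (hS v hv)

lemma acceptedIn_eq_of_eq {e : Fin H.m} (h : ∀ v ∈ H.edge e, s' v = s v) (b : Bool) :
    H.acceptedIn s' e b = H.acceptedIn s e b :=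
  acceptedIn_congr b fun v hv => by rw [h v hv]

lemma Accepts.treePot_le (h : Accepts S s s') (r u : ℕ) :
    treePot (H := H) r u s' ≤ treePot r u s := by
  refine Finset.sum_le_sum fun T _ => Finset.prod_le_prod' fun e _ => ?_
  rcases h.eq_or_safe e with he | he
  · rw [edgePot, if_pos he]; exact zero_le
  · exact (edgePot_congr (acceptedIn_eq_of_eq he)).le

/-- The hypothesis `hclosed` says that the bad edges of the remaining troubled vertices are not
affected. -/
lemma Accepts.abs (h : Accepts S s s') {r : ℕ} (hs : Abs (H := H) r s)
    (hclosed : ∀ v, s v = .troubled → v ∉ S → ∀ e, v ∈ H.edge e → H.IsBad r s e →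
      ∀ w ∈ H.edge e, w ∉ S) : Abs (H := H) r s' := by
  refine ⟨fun v hv => ?_, fun e he => ?_⟩
  · have hvS : v ∉ S := fun hvS => by
      obtain ⟨b, hb⟩ := h.accepted v hvS
      simp [hb] at hv
    rw [h.rest v hvS] at hv
    obtain ⟨e, hve, he⟩ := hs.troubled v hv
    have heq : ∀ w ∈ H.edge e, s' w = s w := fun w hw =>
      h.rest w (hclosed v hv hvS e hve he w hw)
    exact ⟨e, hve, by simpa only [IsBad, acceptedIn_eq_of_eq heq] using he⟩
  · rcases h.eq_or_safe e with hs' | heq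
    · exact absurd hs' he
    · simp only [numAcc, Safe, acceptedIn_eq_of_eq heq] at he ⊢
      exact hs.numAcc_le e he

end Accepts

lemma mem_troubledIn (hμ : Good H p μ) {f : Fin H.m} {v : Fin H.n} :
    v ∈ troubledIn μ f ↔ v ∈ H.edge f ∧ decode H μ v = .troubled := by
  have := hμ.2 v
  rw [troubledIn, Finset.mem_filter, decode]
  refine and_congr_right fun _ => ?_
  split_ifs with h1 h2
  · simp [h1]
  · simp [h2]
  · simp only [iff_true]
    change _ = 2
    omega

/-- An edge whose status is determined, and that is not safe, has many troubled vertices. -/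
lemma le_card_troubledIn (hk : H.Uniform p.k) (hak : p.a ≤ p.k) (hμ : Good H p μ) {f : Fin H.m}
    (hset : Settled (decode H μ) f) (hs : ¬ Safe (decode H μ) f) :
    p.a ≤ (troubledIn μ f).card := by
  have h1 := hμ.1.numAcc_le f hs
  have h2 : ∀ v ∈ H.edge f, decode H μ v ≠ .uncolored := hset.resolve_left hs
  have h3 : H.edge f ⊆ troubledIn μ f ∪ (H.acceptedIn (decode H μ) f true ∪
      H.acceptedIn (decode H μ) f false) := fun v hv => by
    simp only [Finset.mem_union, mem_troubledIn hμ, mem_acceptedIn, hv, true_and]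
    have := h2 v hv
    rcases h : decode H μ v with _ | _ | b
    · exact absurd h this
    · exact Or.inl rfl
    · cases b <;> simp
  have h4 := (Finset.card_le_card h3).trans ((Finset.card_union_le _ _).trans
    (Nat.add_le_add_left (Finset.card_union_le _ _) _))
  rw [hk f] at h4
  rw [numAcc, Params.threshold] at h1
  omega

/-- The final coloring phase keeps the memory valid and does not increase the potential, as all edges
that it affects become safe; it fails only if all trials are unsuccessful. -/
lemma colorFinalComponent_spec (hk : H.Uniform p.k) (hk0 : 0 < p.k) (hak : p.a ≤ p.k)
    (hΔ : p.Δ = H.maxEdgeDegree) (hL : LocalLemma p) {v : Fin H.n} {c : Counters}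
    {B X : Finset (Fin H.m)} (h : Component p v c B X μ) (hv : decode H μ v = .troubled) :
    (colorFinalComponent p c).wp H (fun _ μ' => Clean H p μ' ∧
      memPot H p u μ' ≤ memPot H p u μ ∧
      (∀ w b, decode H μ w = .accepted b → decode H μ' w = .accepted b) ∧
      ∃ b, decode H μ' v = .accepted b) (fun _ => True) μ ∧
    (colorFinalComponent p c).ev H (fun _ _ => 0) (fun _ => 1) μ ≤ (1 / 2) ^ p.trials := by
  classical
  obtain ⟨len, ν, hdet, C, hC, hmem⟩ := collectEdges_detPost hk h.listB (fun f hf => (h.bad f hf).1)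
    h.inComp
  have hdν : decode H ν = decode H μ := hC.decode_eq
  have hgood : Good H p ν := ⟨by rw [hdν]; exact h.good.1, fun w => by
    rw [hC.rest _ _ (by decide) (by decide)]; exact h.good.2 w⟩
  have hCs : ∀ f ∈ C, Settled (decode H ν) f ∧ ¬ Safe (decode H ν) f := by
    intro f hf
    rw [hdν]
    rcases (hmem f).1 hf with hf | ⟨f', hf', hff', hu⟩
    · exact ⟨(h.bad f hf).2, (Hypergraph.isBad_iff.1 (h.bad f hf).1).2⟩
    · exact ⟨h.settled f' hf' f hff', (kindS_eq_unsf.1 hu).1⟩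
  obtain ⟨e₀, he₀, hve₀⟩ := h.start
  have hBC : ∀ f ∈ B, f ∈ C := fun f hf => (hmem f).2 (Or.inl hf)
  have htrial : TrialOK p len C ν := ⟨hC.list, hC.flag, fun f hf =>
    le_card_troubledIn hk hak hgood (hCs f hf).1 (hCs f hf).2, ⟨e₀, hBC _ he₀⟩⟩
  -- each troubled vertex of the component lies in one of its bad edges
  have hbadB : ∀ f ∈ C, ∀ w ∈ troubledIn ν f, ∃ e ∈ B, w ∈ H.edge e := by
    intro f hf w hw
    rw [mem_troubledIn hgood, hdν] at hw
    obtain ⟨e, hwe, he⟩ := h.good.1.troubled w hw.2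
    refine ⟨e, ?_, hwe⟩
    have hfe : e ∈ nbhd f := mem_nbhd_of_mem hw.1 hwe
    by_cases hfB : f ∈ B
    · exact h.bad_of_nbhd f hfB e hfe he
    · obtain ⟨f', hf', hff', hu⟩ := ((hmem f).1 hf).resolve_left hfB
      exact h.bad_of_unsf f' hf' f hff' (kindS_eq_unsf.1 hu).1 hfB e hfe he
  -- hence an edge with a troubled vertex of the component is safe or belongs to the component
  have hclosed : ∀ f ∈ C, ∀ w ∈ troubledIn ν f, ∀ e, w ∈ H.edge e →
      e ∈ C ∨ Safe (decode H μ) e := by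
    intro f hf w hw e hwe
    obtain ⟨b, hb, hwb⟩ := hbadB f hf w hw
    have hbe : e ∈ nbhd b := mem_nbhd_of_mem hwb hwe
    rcases hκ : kindS p.threshold (decode H μ) e with _ | _ | _
    · exact Or.inr (kindS_eq_safe.1 hκ)
    · exact Or.inl (hBC e (h.bad_of_nbhd b hb e hbe (kindS_eq_bad.1 hκ)))
    · exact Or.inl ((hmem e).2 (Or.inr ⟨b, hb, hbe, hκ⟩))
  set S := C.biUnion (troubledIn ν) with hS
  obtain ⟨h1, h2⟩ := trialLoop_spec hk hk0 hΔ hL p.trials ν htrial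
  -- the remaining part of the program does not fail
  have hrest : ∀ ν', Rec S ν ν' ∧ monoSet C ν' = ∅ →
      ((forArray .arrC (fun _ f => .store .inComp f 0 <|
        forMembers f (fun _ v => .load .status v fun s =>
          if s = troubled then .store .status v accepted (.ret ()) else .ret ()) p.k ())
        len ()).bind fun _ =>
        forArray .arrX (fun _ g => .store .explored g 0 (.ret ())) c.x ()).DetPost H
      (fun _ μ' => Clean H p μ' ∧ memPot H p u μ' ≤ memPot H p u μ ∧
      (∀ w b, decode H μ w = .accepted b → decode H μ' w = .accepted b) ∧
      ∃ b, decode H μ' v = .accepted b) ν' := by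
    rintro ν' ⟨hrec, hmono⟩
    refine (acceptAll_detPost hk (htrial.of_rec hrec).list).bind ?_
    rintro ⟨⟩ ν₁ ⟨h3, h4, h5⟩
    have hX : ∀ c i, c ≠ .inComp → c ≠ .status → c ≠ .color → c ≠ .arrW → c ≠ .arrC →
        ν₁.cell c i = μ.cell c i := fun c i c1 c2 c3 c4 c5 => by
      rw [h3 c i c1 c2, hrec.1 c i c3 c4, hC.rest c i c1 c5]
    refine (clearExplored_detPost (X := X) (h.listX.congr fun i _ => hX _ _ (by decide) (by decide)
      (by decide) (by decide) (by decide)) fun g hg => h.flag g ?_).mono ?_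
    · rwa [hX _ _ (by decide) (by decide) (by decide) (by decide) (by decide)] at hg
    rintro ⟨⟩ ν₂ ⟨h6, h7⟩
    have hst : ∀ w : Fin H.n, ν₂.cell .status w =
        if w ∈ S then accepted else μ.cell .status w := fun w => by
      rw [h6 _ _ (by decide), h5, hrec.troubledIn_eq, hrec.1 _ _ (by decide) (by decide),
        hC.rest _ _ (by decide) (by decide), hS]
      simp only [Finset.mem_biUnion]
    have hcol : ∀ w : Fin H.n, ν₂.cell .color w = ν'.cell .color w := fun w => by
      rw [h6 _ _ (by decide), h3 _ _ (by decide) (by decide)]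
    have hin : ∀ w ∈ S, decode H ν₂ w = .accepted (col H ν' w) := fun w hw => by
      rw [decode_eq_accepted, hst, hcol, if_pos hw]
      exact ⟨rfl, rfl⟩
    have hout : ∀ w ∉ S, decode H ν₂ w = decode H μ w := fun w hw => by
      rw [decode, decode, hst, hcol, if_neg hw, hrec.2 w hw, hC.rest _ _ (by decide) (by decide)]
    have hStr : ∀ w ∈ S, decode H μ w = .troubled := fun w hw => by
      obtain ⟨f, hf, hw⟩ := Finset.mem_biUnion.1 hw
      rw [← hdν]
      exact ((mem_troubledIn hgood).1 hw).2
    have hCsafe : ∀ f ∈ C, Safe (decode H ν₂) f := by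
      intro f hf
      have hm : ¬ Mono (troubledIn ν') f (col H ν') := fun hm => by
        have : f ∈ monoSet C ν' := ⟨hf, hm⟩
        rw [hmono] at this
        exact this
      rw [hrec.troubledIn_eq, Mono, not_exists] at hm
      have key : ∀ b, (H.acceptedIn (decode H ν₂) f b).Nonempty := fun b => by
        have hb := hm (!b)
        push Not at hb
        obtain ⟨w, hw, hwb⟩ := hb
        refine ⟨w, mem_acceptedIn.2 ⟨(Finset.mem_filter.1 hw).1, ?_⟩⟩
        rw [hin w (Finset.mem_biUnion.2 ⟨f, hf, hw⟩)]
        congr 1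
        revert hwb
        cases col H ν' w <;> cases b <;> simp
      exact ⟨key _, key _⟩
    have hacc : Accepts S (decode H μ) (decode H ν₂) := by
      refine ⟨hStr, fun w hw => ⟨_, hin w hw⟩, hout, fun w hw e hwe => ?_⟩
      obtain ⟨f, hf, hw⟩ := Finset.mem_biUnion.1 hw
      exact (hclosed f hf w hw e hwe).symm.imp_right (hCsafe e)
    refine ⟨⟨⟨hacc.abs h.good.1 ?_, fun w => ?_⟩, fun g => ?_, h7⟩, hacc.treePot_le _ _,
      fun w b hw => ?_, ?_⟩
    · intro w hw hwS e hwe he x hx hxS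
      obtain ⟨f, hf, hxf⟩ := Finset.mem_biUnion.1 hxS
      rcases hclosed f hf x hxf e hx with heC | hsafe
      · refine hwS (Finset.mem_biUnion.2 ⟨e, heC, (mem_troubledIn hgood).2 ⟨hwe, ?_⟩⟩)
        rw [hdν, hw]
      · exact (Hypergraph.isBad_iff.1 he).2 hsafe
    · rw [hst]
      split_ifs
      exacts [one_le_two, h.good.2 w]
    · rw [h6 _ _ (by decide), h4, hrec.1 _ _ (by decide) (by decide)]
      split_ifs with hg
      · rfl
      · by_contra hc
        exact hg ((hC.flag g).1 hc)
    · rw [hout w fun hwS => ?_, hw]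
      rw [hStr w hwS] at hw
      simp at hw
    · refine ⟨_, hin v (Finset.mem_biUnion.2 ⟨e₀, hBC _ he₀, (mem_troubledIn hgood).2 ⟨hve₀, ?_⟩⟩)⟩
      rw [hdν, hv]
  rw [colorFinalComponent, Prog.bind_def]
  constructor
  · rw [hdet.wp_bind]
    simp only [Prog.bind_def]
    rw [wp_bind]
    exact wp_post h1 fun _ ν' h3 => (hrest ν' h3).wp
  · rw [hdet.ev_bind]
    simp only [Prog.bind_def]
    rw [ev_bind]
    refine le_trans (ev_le_ev h1 (fun _ ν' h3 => ?_) fun _ _ => le_rfl) h2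
    obtain ⟨_, _, h4, -⟩ := hrest ν' h3
    rw [h4.ev_eq]

end Base

/-! ### Queries -/

namespace Base

open Prog HypergraphLCA.Hypergraph

variable {H : Hypergraph} {p : Params} {u : ℕ} {μ μ' : Mem}

open Classical in
/-- The number of vertices that are not accepted. -/
noncomputable def numRest (H : Hypergraph) (μ : Mem) : ℕ :=
  (Finset.univ.filter fun v : Fin H.n => ∀ b, decode H μ v ≠ .accepted b).card

/-- Accepted vertices stay accepted with the same color. -/
def Keeps (s s' : Fin H.n → VStatus) : Prop := ∀ w b, s w = .accepted b → s' w = .accepted b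

lemma Evo.keeps {r : ℕ} {s s' : Fin H.n → VStatus} (h : Evo r s s') : Keeps s s' :=
  fun w b hw => by rw [h.1 w (by simp [hw]), hw]

lemma Keeps.trans {s s' s'' : Fin H.n → VStatus} (h : Keeps s s') (h' : Keeps s' s'') :
    Keeps s s'' := fun w b hw => h' w b (h w b hw)

lemma numRest_le (h : Keeps (decode H μ) (decode H μ')) : numRest H μ' ≤ numRest H μ := by
  classical
  refine Finset.card_le_card fun v hv => ?_
  rw [Finset.mem_filter] at hv ⊢
  exact ⟨hv.1, fun b hb => hv.2 b (h v b hb)⟩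

lemma numRest_lt (h : Keeps (decode H μ) (decode H μ')) {v : Fin H.n}
    (hv : decode H μ v = .troubled) {b : Bool} (hv' : decode H μ' v = .accepted b) :
    numRest H μ' < numRest H μ := by
  classical
  refine Finset.card_lt_card (Finset.ssubset_iff_subset_ne.2 ⟨fun v hv => ?_, fun heq => ?_⟩)
  · rw [Finset.mem_filter] at hv ⊢
    exact ⟨hv.1, fun b hb => hv.2 b (h v b hb)⟩
  · have : v ∈ Finset.univ.filter fun v : Fin H.n => ∀ b, decode H μ v ≠ .accepted b := by
      simp [hv]
    rw [← heq, Finset.mem_filter] at this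
    exact this.2 b hv'

/-- An upper bound for the probability of a failure from the memory `μ` on: a failure needs a
satisfied witness structure, or one of the final components (each of them contains a vertex that is
not accepted) has only unsuccessful trials. -/
noncomputable def failPot (H : Hypergraph) (p : Params) (u : ℕ) (μ : Mem) : ℝ≥0∞ :=
  memPot H p u μ + numRest H μ * (1 / 2) ^ p.trials

/-- The conditions on the parameters that the analysis of the base algorithm needs. By `size` a set
of more than `compBound` bad edges yields a witness structure of size `u + 1`. -/
structure Suits (H : Hypergraph) (p : Params) (u : ℕ) : Prop where
  uniform : H.Uniform p.k
  pos : 0 < p.a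
  le : p.a ≤ p.k
  delta : p.Δ = H.maxEdgeDegree
  localLemma : LocalLemma p
  size : (H.maxEdgeDegree + 1) * u ≤ p.compBound

lemma Clean.next (h : Clean H p μ) (h' : Next H p μ μ') : Clean H p μ' :=
  ⟨h'.1, fun g => by rw [h'.2.1 _ _ (by decide) (by decide)]; exact h.inComp g,
    fun g => by rw [h'.2.1 _ _ (by decide) (by decide)]; exact h.flag g⟩

/-- For a troubled vertex, building and coloring its final component makes it accepted, unless the
algorithm fails. -/
lemma finalComponent_spec (hs : Suits H p u) (h : Clean H p μ) {v : Fin H.n}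
    (hv : decode H μ v = .troubled) :
    ((buildFinalComponent p v).bind (colorFinalComponent p)).wp H (fun _ μ' => Clean H p μ' ∧
      Keeps (decode H μ) (decode H μ') ∧ ∃ b, decode H μ' v = .accepted b) (fun _ => True) μ ∧
    ((buildFinalComponent p v).bind (colorFinalComponent p)).ev H (fun _ => failPot H p u)
      (fun _ => 1) μ ≤ failPot H p u μ := by
  obtain ⟨h1, h2⟩ := buildFinalComponent_holds hs.uniform hs.delta hs.size h hv
  have hcolor := fun (c : Counters) (ν : Mem)
      (hevo : Evo p.threshold (decode H μ) (decode H ν)) (B X : Finset (Fin H.m))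
      (hcomp : Component p v c B X ν) =>
    colorFinalComponent_spec (u := u) hs.uniform (hs.pos.trans_le hs.le) hs.le hs.delta
      hs.localLemma hcomp (by rw [hevo.1 v (by simp [hv]), hv])
  constructor
  · refine (wp_bind _ _ _ _ _).2 (wp_mono h1 (fun c ν hν => ?_) fun _ _ => trivial)
    obtain ⟨hevo, B, X, hcomp⟩ := hν
    refine wp_post (hcolor c ν hevo B X hcomp).1 ?_
    rintro _ μ' ⟨h3, -, h4, h5⟩
    exact ⟨h3, hevo.keeps.trans h4, h5⟩
  · rw [ev_bind]
    set K : ℝ≥0∞ := numRest H μ * (1 / 2) ^ p.trials with hK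
    have h3 : (buildFinalComponent p v).ev H
        (fun c μ' => (colorFinalComponent p c).ev H (fun _ => failPot H p u) (fun _ => 1) μ')
        (fun _ => 1) μ ≤ (buildFinalComponent p v).ev H (fun _ μ' => memPot H p u μ' + K)
          (fun μ' => memPot H p u μ' + K) μ := by
      refine ev_le_ev h1 (fun c ν hν => ?_) fun ν hν => hν.one_le.trans le_self_add
      obtain ⟨hevo, B, X, hcomp⟩ := hν
      obtain ⟨h4, h5⟩ := hcolor c ν hevo B X hcomp
      -- the number of vertices that are not accepted becomes smaller, and this pays for failures
      obtain ⟨N, hN⟩ : ∃ N, numRest H μ = N + 1 := Nat.exists_eq_succ_of_ne_zero (by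
        have : v ∈ Finset.univ.filter fun v : Fin H.n => ∀ b, decode H μ v ≠ .accepted b := by
          simp [hv]
        classical
        rw [numRest]
        convert (Finset.card_pos.2 ⟨v, this⟩).ne')
      set L : ℝ≥0∞ := memPot H p u ν + N * (1 / 2) ^ p.trials with hL
      have h6 : (colorFinalComponent p c).ev H (fun _ => failPot H p u) (fun _ => 1) ν ≤
          (colorFinalComponent p c).ev H (fun _ _ => 0 + L) (fun _ => 1 + L) ν := by
        refine ev_le_ev h4 ?_ fun _ _ => le_self_add
        rintro _ ν' ⟨-, h7, h8, b, h9⟩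
        rw [zero_add, failPot, hL]
        have h10 := numRest_lt (hevo.keeps.trans h8) hv h9
        have h11 : numRest H ν' ≤ N := by omega
        gcongr
      rw [ev_add_const_le] at h6
      refine h6.trans ((add_le_add_left h5 L).trans (le_of_eq ?_))
      rw [hL, hK, hN, Nat.cast_add, Nat.cast_one, add_mul, one_mul]
      ring
    refine h3.trans ?_
    rw [ev_add_const_le, failPot]
    exact add_le_add_left h2 K

/-- A query keeps the memory valid and returns the final color of `v`; the bound for the probability
of a failure does not grow on average. -/
lemma query_spec (hs : Suits H p u) (h : Clean H p μ) (v : Fin H.n) :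
    (query p v).wp H (fun a μ' => Clean H p μ' ∧ Keeps (decode H μ) (decode H μ') ∧
      decode H μ' v = .accepted a) (fun _ => True) μ ∧
    (query p v).ev H (fun _ => failPot H p u) (fun _ => 1) μ ≤ failPot H p u μ := by
  rw [query_eq]
  have hfirst : Holds H p u (if μ.cell .status v = uncolored then processVertex p v else .ret ())
      (fun _ μ' => Next H p μ μ' ∧ decode H μ' v ≠ .uncolored) μ := by
    split_ifs with h0
    · exact processVertex_holds hs.uniform v h.good (decode_eq_uncolored.2 h0)
    · exact holds_ret ⟨Next.refl h.good, fun hc => h0 (decode_eq_uncolored.1 hc)⟩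
  -- the part of the query after `v` has been processed
  have hsecond : ∀ ν, Next H p μ ν → decode H ν v ≠ .uncolored →
      (Prog.load .status v fun s' => (if s' = troubled then
          (buildFinalComponent p v).bind (colorFinalComponent p) else .ret ()).bind fun _ =>
        .load .color v fun b => .ret (decide (b ≠ 0))).wp H (fun a μ' => Clean H p μ' ∧
          Keeps (decode H ν) (decode H μ') ∧ decode H μ' v = .accepted a) (fun _ => True) ν ∧
      (Prog.load .status v fun s' => (if s' = troubled then
          (buildFinalComponent p v).bind (colorFinalComponent p) else .ret ()).bind fun _ =>
        .load .color v fun b => .ret (decide (b ≠ 0))).ev H (fun _ => failPot H p u)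
          (fun _ => 1) ν ≤ failPot H p u ν := by
    intro ν hν hu
    have hclean := h.next hν
    have hcol : ∀ ν' b, decode H ν' v = .accepted b →
        decode H ν' v = .accepted (decide (ν'.cell .color v ≠ 0)) := fun ν' b hb => by
      have := (decode_eq_accepted.1 hb).1
      exact decode_eq_accepted.2 ⟨this, rfl⟩
    by_cases ht : ν.cell .status v = troubled
    · have htv : decode H ν v = .troubled := by
        rw [decode, ht]; rfl
      obtain ⟨h1, h2⟩ := finalComponent_spec hs hclean htv
      constructor
      · simp only [wp, wp_bind, ht, if_true]
        rw [wp_bind] at h1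
        refine wp_post h1 fun _ ν' h3 => wp_post h3 ?_
        rintro _ ν'' ⟨h4, h5, b, h6⟩
        exact ⟨h4, h5, hcol _ _ h6⟩
      · simp only [ev, ev_bind, ht, if_true]
        rw [ev_bind] at h2
        exact h2
    · simp only [wp, wp_bind, ev, ev_bind, ht, if_false]
      refine ⟨⟨hclean, fun _ _ h => h, ?_⟩, le_rfl⟩
      refine hcol ν (decide (ν.cell .color v ≠ 0)) (decode_eq_accepted.2 ⟨?_, rfl⟩)
      have h3 := hclean.good.2 v
      have h4 : ν.cell .status v ≠ 0 := fun hc => hu (decode_eq_uncolored.2 hc)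
      change _ ≠ 2 at ht
      omega
  constructor
  · rw [wp, wp_bind]
    refine wp_mono hfirst.1 ?_ fun _ _ => trivial
    rintro _ ν ⟨hν, hu⟩
    refine wp_post (hsecond ν hν hu).1 ?_
    rintro a ν' ⟨h1, h2, h3⟩
    exact ⟨h1, hν.2.2.keeps.trans h2, h3⟩
  · rw [ev, ev_bind]
    set K : ℝ≥0∞ := numRest H μ * (1 / 2) ^ p.trials with hK
    calc _ ≤ Prog.ev H (if μ.cell .status v = uncolored then processVertex p v else .ret ())
          (fun _ μ' => memPot H p u μ' + K) (fun μ' => memPot H p u μ' + K) μ := by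
          refine ev_le_ev hfirst.1 ?_ fun ν hν => hν.one_le.trans le_self_add
          rintro _ ν ⟨hν, hu⟩
          refine (hsecond ν hν hu).2.trans ?_
          rw [failPot, hK]
          have := numRest_le hν.2.2.keeps
          gcongr
      _ ≤ failPot H p u μ := by
          rw [ev_add_const_le, failPot]
          exact add_le_add_left hfirst.2 K

/-! ### Runs of the base algorithm -/

/-- Further queries do not affect the earlier answers. -/
lemma runQueries_append (H : Hypergraph) (q : ℕ → Prog Bool) (qs' : List (Fin H.n)) :
    ∀ (qs : List (Fin H.n)) (μ : Mem),
      (runQueries H q (qs ++ qs') μ).map (List.take qs.length) = runQueries H q qs μ := by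
  intro qs
  induction qs with
  | nil =>
    intro μ
    rw [runQueries]
    exact PMF.map_const _ _
  | cons v vs ih =>
    intro μ
    rw [List.cons_append, runQueries, runQueries, PMF.map_bind]
    congr 1
    funext r
    rcases r.value with _ | a
    · dsimp only
      rw [PMF.pure_map]
      simp
    · dsimp only
      rw [← ih, PMF.map_comp, PMF.map_comp]
      rfl

/-- The answers `rs` to the queries `qs` agree with valid statuses `s` of the vertices. -/
def Answers (p : Params) (qs : List (Fin H.n)) (s₀ : Fin H.n → VStatus)
    (rs : List (Result Bool)) : Prop :=
  ∃ s : Fin H.n → VStatus, Abs p.threshold s ∧ Keeps s₀ s ∧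
    List.Forall₂ (fun v r => ∃ b, r.value = some b ∧ s v = .accepted b) qs rs

open Classical in
lemma expect_not_answers_le (hs : Suits H p u) (qs : List (Fin H.n)) :
    ∀ μ, Clean H p μ → expect (runQueries H (query p) qs μ)
      (fun rs => if Answers p qs (decode H μ) rs then 0 else 1) ≤ failPot H p u μ := by
  induction qs with
  | nil =>
    intro μ h
    rw [runQueries, expect_pure, if_pos]
    · exact zero_le
    · exact ⟨decode H μ, h.good.1, fun _ _ h => h, List.Forall₂.nil⟩
  | cons v vs ih =>
    intro μ h
    obtain ⟨h1, h2⟩ := query_spec hs h v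
    rw [runQueries, expect_bind]
    have hone : ∀ (P : PMF (List (Result Bool))) (s₀ : Fin H.n → VStatus),
        expect P (fun rs => if Answers p (v :: vs) s₀ rs then 0 else 1) ≤ 1 := by
      intro P s₀
      calc _ ≤ expect P fun _ => 1 := expect_mono fun rs _ => by split_ifs <;> simp
        _ = 1 := by simp [expect, PMF.tsum_coe]
    refine le_trans ?_ ((ev_le_ev (f := fun a μ' => if Clean H p μ' ∧
      Keeps (decode H μ) (decode H μ') ∧ decode H μ' v = .accepted a then failPot H p u μ' else 1)
      (r := fun _ => 1) h1 (fun a μ' hc => by rw [if_pos hc]) fun _ _ => le_rfl).trans h2)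
    rw [← expect_exec]
    refine expect_mono fun r _ => ?_
    rcases hr : r.value with _ | a
    · exact hone _ _
    · dsimp only
      split_ifs with hc
      · refine le_trans ?_ (ih r.mem hc.1)
        rw [expect_map]
        refine expect_mono fun rs _ => ?_
        by_cases h4 : Answers p vs (decode H r.mem) rs
        · obtain ⟨s, hs1, hs2, hs3⟩ := h4
          rw [Function.comp, if_pos]
          · exact zero_le
          · exact ⟨s, hs1, hc.2.1.trans hs2, List.Forall₂.cons ⟨a, hr, hs2 v a hc.2.2⟩ hs3⟩
        · rw [if_neg h4, Function.comp]
          split_ifs <;> simp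
      · exact hone _ _

lemma clean_empty (H : Hypergraph) (p : Params) : Clean H p Mem.empty := by
  have hd : decode H Mem.empty = fun _ => .uncolored := rfl
  refine ⟨⟨⟨?_, ?_⟩, ?_⟩, ?_, ?_⟩
  · simp [hd]
  · intro e _
    simp [hd, numAcc, acceptedIn]
  · simp [Mem.empty]
  · simp [Mem.empty]
  · simp [Mem.empty]

/-- If all vertices are accepted, the colors form a proper coloring. -/
lemma properColoring_of_accepted (hs : Suits H p u) {s : Fin H.n → VStatus}
    (habs : Abs p.threshold s) {χ : Fin H.n → Bool} (hχ : ∀ v, s v = .accepted (χ v)) :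
    H.ProperColoring χ := by
  intro e
  have hsafe : Safe s e := by
    by_contra hc
    have h1 := habs.numAcc_le e hc
    have h2 : H.edge e ⊆ H.acceptedIn s e true ∪ H.acceptedIn s e false := fun v hv => by
      rw [Finset.mem_union, mem_acceptedIn, mem_acceptedIn, hχ]
      cases χ v <;> simp [hv]
    have h3 := (Finset.card_le_card h2).trans (Finset.card_union_le _ _)
    rw [hs.uniform e] at h3
    rw [numAcc, Params.threshold] at h1
    have := hs.pos
    have := hs.le
    omega
  obtain ⟨⟨v, hv⟩, w, hw⟩ := hsafe
  rw [mem_acceptedIn, hχ] at hv hw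
  refine ⟨v, hv.1, w, hw.1, ?_⟩
  rw [VStatus.accepted.inj hv.2, VStatus.accepted.inj hw.2]
  decide

/-- The answers are consistent unless there is a failure, whose probability is at most the initial
value of `failPot`. -/
lemma toOuterMeasure_not_consistent_le (hs : Suits H p u) (qs : List (Fin H.n)) :
    (runQueries H (query p) qs Mem.empty).toOuterMeasure {rs | ¬ Consistent H qs rs} ≤
      treePot (H := H) p.threshold (u + 1) (fun _ => .uncolored) +
        H.n * (1 / 2) ^ p.trials := by
  classical
  -- Afterwards all vertices are queried once more. If these queries do not fail either, all vertices
  -- are accepted in the end, and their final colors agree with the earlier answers.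
  set L := List.finRange H.n
  rw [← runQueries_append H (query p) L, toOuterMeasure_eq_expect, expect_map]
  have h0 : failPot H p u Mem.empty = treePot (H := H) p.threshold (u + 1) (fun _ => .uncolored) +
      H.n * (1 / 2) ^ p.trials := by
    have hd : decode H Mem.empty = fun _ => .uncolored := rfl
    rw [failPot, memPot, hd]
    congr 3
    simp [numRest, hd]
  rw [← h0]
  refine le_trans (expect_mono fun rs _ => ?_) (expect_not_answers_le hs (qs ++ L) _
    (clean_empty H p))
  by_cases hA : Answers p (qs ++ L) (decode H Mem.empty) rs
  · rw [Function.comp, if_pos hA, if_neg]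
    rw [Set.mem_ofPred_eq, not_not]
    obtain ⟨s, habs, -, hall⟩ := hA
    have hacc : ∀ v, ∃ b, s v = .accepted b := by
      intro v
      have hv : v ∈ qs ++ L := List.mem_append_right _ (List.mem_finRange v)
      obtain ⟨i, hi, rfl⟩ := List.getElem_of_mem hv
      have hlen := hall.length_eq
      obtain ⟨b, -, hb⟩ := (List.forall₂_iff_get.1 hall).2 i hi (by omega)
      exact ⟨b, hb⟩
    choose χ hχ using hacc
    refine ⟨χ, properColoring_of_accepted hs habs hχ, ?_⟩
    have h1 := List.forall₂_take qs.length hall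
    rw [List.take_left'] at h1
    · refine h1.imp fun v r h => ?_
      obtain ⟨b, hb, hvb⟩ := h
      rw [hχ] at hvb
      rw [hb, VStatus.accepted.inj hvb]
    · rfl
  · rw [if_neg hA]
    simp only [Function.comp]
    split_ifs <;> simp

end Base

/-! ### Time and space of runs -/

lemma runQueries_time_space {H : Hypergraph} {S : Sizes} (hS : S.Fits H) {q : ℕ → Prog Bool} {T : ℕ}
    (hq : ∀ v < S.n, (q v).Within S T fun _ => True) :
    ∀ (qs : List (Fin H.n)) (μ : Mem), S.MemOK μ → ∀ rs ∈ (runQueries H q qs μ).support,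
      ∀ r ∈ rs, r.time ≤ T + 1 ∧ r.space ≤ S.space := by
  intro qs
  induction qs with
  | nil =>
    intro μ _ rs hrs
    rw [runQueries, PMF.mem_support_pure_iff] at hrs
    simp [hrs]
  | cons v vs ih =>
    intro μ hμ rs hrs
    rw [runQueries, PMF.mem_support_bind_iff] at hrs
    obtain ⟨r, hr, hrs⟩ := hrs
    have hv : (v : ℕ) < S.n := by rw [hS.n_eq]; exact v.2
    obtain ⟨h1, h2, h3⟩ := Prog.exec_of_cost hS (hq v hv T le_rfl) hμ hr
    rcases hval : r.value with _ | a
    · rw [hval] at hrs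
      rw [PMF.mem_support_pure_iff] at hrs
      simp [hrs, h1, h2]
    · rw [hval] at hrs
      obtain ⟨rs', hrs', rfl⟩ := (PMF.mem_support_map_iff _ _ _).1 hrs
      intro r' hr'
      rcases List.mem_cons.1 hr' with rfl | hr'
      · exact ⟨h1, h2⟩
      · exact ih r.mem h3 rs' hrs' r' hr'

/-! ### The parameters of admissible hypergraphs -/

namespace Admissible

open HypergraphLCA.Hypergraph Base

variable {k : ℕ} {α : ℝ} {H : Hypergraph}

/-- The parameters that the base algorithm uses. -/
noncomputable abbrev params (k : ℕ) (α : ℝ) (H : Hypergraph) : Params :=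
  ⟨k, ⌈α * k⌉₊, H.maxEdgeDegree, H.m⟩

lemma two_lt (h : Admissible k α H) : 2 < α * k := by
  have h1 := h.2.2
  have h2 := Real.exp_one_gt_d9
  have h3 : (0 : ℝ) ≤ H.maxEdgeDegree := Nat.cast_nonneg _
  have h4 : (2 : ℝ) ^ (2 : ℝ) < 2 ^ (α * k) := by
    rw [Real.rpow_two]
    nlinarith
  exact (Real.rpow_lt_rpow_left_iff (by norm_num)).1 h4

lemma ceil_pos (h : Admissible k α H) : 0 < ⌈α * k⌉₊ := Nat.ceil_pos.2 (by linarith [h.two_lt])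

lemma ceil_lt (h : Admissible k α H) : (⌈α * k⌉₊ : ℝ) < α * k + 1 :=
  Nat.ceil_lt_add_one (by linarith [h.two_lt])

lemma le_quarter (hα : α ≤ 1 / 4) : α * k ≤ k / 4 := by
  have := mul_le_mul_of_nonneg_right hα (Nat.cast_nonneg (α := ℝ) k)
  linarith

lemma ceil_le (h : Admissible k α H) (hα : α ≤ 1 / 4) : ⌈α * k⌉₊ ≤ k := by
  have h1 := h.two_lt
  have h2 := le_quarter (k := k) hα
  rw [Nat.ceil_le]
  linarith

lemma two_pow_ceil (h : Admissible k α H) :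
    2 * Real.exp 1 * ((H.maxEdgeDegree : ℝ) + 1) < 2 ^ ⌈α * k⌉₊ := by
  refine h.2.2.trans_le ?_
  rw [← Real.rpow_natCast]
  exact Real.rpow_le_rpow_of_exponent_le (by norm_num) (Nat.le_ceil _)

lemma one_add_inv_pow_le (D : ℕ) :
    (1 + ((max D 1 : ℕ) : ℝ)⁻¹) ^ (D + 1) ≤ Real.exp 1 * (D + 1) * ((max D 1 : ℕ) : ℝ)⁻¹ := by
  rcases Nat.eq_zero_or_pos D with rfl | hD
  · have := Real.exp_one_gt_d9
    norm_num
    linarith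
  · rw [max_eq_left (by omega : 1 ≤ D)]
    have hD' : (0 : ℝ) < D := by exact_mod_cast hD
    have h1 : (1 + (D : ℝ)⁻¹) ^ D ≤ Real.exp 1 := by
      calc (1 + (D : ℝ)⁻¹) ^ D ≤ Real.exp (D : ℝ)⁻¹ ^ D := by
            gcongr
            rw [add_comm]
            exact Real.add_one_le_exp _
        _ = Real.exp 1 := by
            rw [← Real.exp_nat_mul, mul_inv_cancel₀ hD'.ne']
    rw [pow_succ, mul_assoc]
    refine mul_le_mul h1 (le_of_eq ?_) (by positivity) (Real.exp_pos _).le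
    field_simp

/-- By `2e(Δ + 1) < 2 ^ a` the condition of the local lemma holds with the weight `1 / Δ`. -/
lemma localLemma (h : Admissible k α H) : LocalLemma (params k α H) := by
  set D := H.maxEdgeDegree
  have h1 := one_add_inv_pow_le D
  have h2 := h.two_pow_ceil
  have hD0 : (0 : ℝ) < (max D 1 : ℕ) := by exact_mod_cast lt_max_of_lt_right one_pos
  have h3 : (2 : ℝ) / 2 ^ ⌈α * k⌉₊ * (1 + ((max D 1 : ℕ) : ℝ)⁻¹) ^ (D + 1) ≤
      ((max D 1 : ℕ) : ℝ)⁻¹ := by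
    calc (2 : ℝ) / 2 ^ ⌈α * k⌉₊ * (1 + ((max D 1 : ℕ) : ℝ)⁻¹) ^ (D + 1)
        ≤ 2 / 2 ^ ⌈α * k⌉₊ * (Real.exp 1 * (D + 1) * ((max D 1 : ℕ) : ℝ)⁻¹) := by gcongr
      _ = (2 * Real.exp 1 * (D + 1)) / 2 ^ ⌈α * k⌉₊ * ((max D 1 : ℕ) : ℝ)⁻¹ := by ring
      _ ≤ 1 * ((max D 1 : ℕ) : ℝ)⁻¹ := by
          gcongr
          rw [div_le_one (by positivity)]
          exact h2.le
      _ = _ := one_mul _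
  have h4 := ENNReal.ofReal_le_ofReal h3
  rw [ENNReal.ofReal_mul (by positivity), ENNReal.ofReal_div_of_pos (by positivity),
    ENNReal.ofReal_pow (by norm_num), ENNReal.ofReal_pow (by positivity),
    ENNReal.ofReal_add (by norm_num) (by positivity), ENNReal.ofReal_inv_of_pos hD0,
    ENNReal.ofReal_natCast, ENNReal.ofReal_one, ENNReal.ofReal_ofNat] at h4
  exact h4

/-- The degree condition of the witness structures: as `α ≤ 1/4`, the threshold `k - a` is almost
`3αk`, and `2 ^ (3αk)` is larger than `(4(Δ + 1))³`. -/
lemma sixteen_mul_lt (h : Admissible k α H) (hα : α ≤ 1 / 4) :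
    16 * (H.maxEdgeDegree : ℝ) ^ 3 < 2 ^ (params k α H).threshold := by
  have hle := h.ceil_le hα
  have h1 := h.2.2
  have h2 := Real.exp_one_gt_d9
  set D : ℝ := (H.maxEdgeDegree : ℝ)
  have hD0 : 0 ≤ D := Nat.cast_nonneg _
  have h3 : 3 * (α * k) - 1 ≤ ((k - ⌈α * k⌉₊ : ℕ) : ℝ) := by
    have := le_quarter (k := k) hα
    have := h.ceil_lt
    rw [Nat.cast_sub hle]
    linarith
  have h4 : 4 * (D + 1) ≤ (2 : ℝ) ^ (α * k) := by nlinarith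
  have h5 : (4 * (D + 1)) ^ 3 / 2 ≤ (2 : ℝ) ^ (k - ⌈α * k⌉₊) := by
    calc (4 * (D + 1)) ^ 3 / 2 ≤ ((2 : ℝ) ^ (α * k)) ^ 3 / 2 := by gcongr
      _ = 2 ^ (3 * (α * k) - 1) := by
          rw [Real.rpow_sub (by norm_num), Real.rpow_one, mul_comm 3]
          exact congrArg (· / 2) (Real.rpow_mul_natCast (by norm_num) _ 3).symm
      _ ≤ 2 ^ ((k - ⌈α * k⌉₊ : ℕ) : ℝ) := Real.rpow_le_rpow_of_exponent_le (by norm_num) h3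
      _ = _ := Real.rpow_natCast _ _
  refine lt_of_lt_of_le ?_ h5
  have h6 : D ^ 3 ≤ (D + 1) ^ 3 := by gcongr; linarith
  have h7 : 0 < (D + 1) ^ 3 := by positivity
  nlinarith

lemma suits (h : Admissible k α H) (hα : α ≤ 1 / 4) (hm : 1 ≤ H.m) :
    Suits H (params k α H) (Nat.log 2 (H.m ^ 2)) where
  uniform := h.1
  pos := h.ceil_pos
  le := h.ceil_le hα
  delta := rfl
  localLemma := h.localLemma
  size := by
    change _ ≤ Nat.log 2 (H.m ^ (2 * (H.maxEdgeDegree + 1)))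
    refine Nat.le_log_of_pow_le (by norm_num) ?_
    rw [mul_comm, pow_mul, pow_mul]
    exact Nat.pow_le_pow_left (Nat.pow_log_le_self 2 (pow_ne_zero _ (by omega))) _

/-- A bound for the degrees that depends only on `k` and `α`. -/
noncomputable def degBound (k : ℕ) (α : ℝ) : ℕ := ⌈(2 : ℝ) ^ (α * k)⌉₊

lemma degree_le (h : Admissible k α H) : H.maxEdgeDegree + 1 ≤ degBound k α := by
  have h1 := h.2.2
  have h2 := Real.exp_one_gt_d9
  have h3 : (0 : ℝ) ≤ H.maxEdgeDegree := Nat.cast_nonneg _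
  have h4 : ((H.maxEdgeDegree + 1 : ℕ) : ℝ) ≤ degBound k α := by
    refine le_trans ?_ (Nat.le_ceil _)
    push_cast
    nlinarith
  exact_mod_cast h4

lemma k_pos (h : Admissible k α H) : 0 < k := by
  rcases Nat.eq_zero_or_pos k with rfl | hk
  · have := h.two_lt
    norm_num at this
  · exact hk

lemma n_le (h : Admissible k α H) : H.n ≤ k * H.m := by
  have h1 : (Finset.univ : Finset (Fin H.n)) ⊆ Finset.univ.biUnion H.edge := fun v _ => by
    obtain ⟨e, he⟩ := h.2.1 v
    exact Finset.mem_biUnion.2 ⟨e, Finset.mem_univ _, he⟩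
  have h2 := (Finset.card_le_card h1).trans
    (Finset.card_biUnion_le_card_mul _ _ k fun e _ => (h.1 e).le)
  simpa [mul_comm] using h2

lemma m_le (h : Admissible k α H) : H.m ≤ H.n * degBound k α := by
  have h1 : (Finset.univ : Finset (Fin H.m)) ⊆ Finset.univ.biUnion H.edgesAt := fun e _ => by
    obtain ⟨v, hv⟩ : (H.edge e).Nonempty := by rw [← Finset.card_pos, h.1 e]; exact h.k_pos
    exact Finset.mem_biUnion.2 ⟨v, Finset.mem_univ _, mem_edgesAt.2 hv⟩
  have h2 := (Finset.card_le_card h1).trans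
    (Finset.card_biUnion_le_card_mul _ _ (degBound k α) fun v _ =>
      (card_edgesAt_le v).trans h.degree_le)
  simpa using h2

/-- An upper bound for the logarithm of the number of edges. -/
def logBound (D n : ℕ) : ℕ := Nat.log 2 n + 1 + D

/-- An upper bound for the number of bad edges in final components and for the number of trials. -/
def sizeBound (D n : ℕ) : ℕ := 2 * D * logBound D n + 2

lemma m_le_two_pow (h : Admissible k α H) : H.m ≤ 2 ^ logBound (degBound k α) H.n := by
  rw [logBound, pow_add]
  exact h.m_le.trans (Nat.mul_le_mul (Nat.lt_pow_succ_log_self (by norm_num) _).le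
    Nat.lt_two_pow_self.le)

lemma one_le_degBound (h : Admissible k α H) : 1 ≤ degBound k α :=
  (Nat.le_add_left _ _).trans h.degree_le

lemma compBound_le (h : Admissible k α H) :
    (params k α H).compBound + 2 ≤ sizeBound (degBound k α) H.n := by
  refine Nat.add_le_add_right ?_ 2
  change Nat.log 2 (H.m ^ (2 * (H.maxEdgeDegree + 1))) ≤ _
  calc Nat.log 2 (H.m ^ (2 * (H.maxEdgeDegree + 1)))
      ≤ Nat.log 2 ((2 ^ logBound (degBound k α) H.n) ^ (2 * (H.maxEdgeDegree + 1))) :=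
        Nat.log_mono_right (Nat.pow_le_pow_left h.m_le_two_pow _)
    _ = logBound (degBound k α) H.n * (2 * (H.maxEdgeDegree + 1)) := by
        rw [← pow_mul, Nat.log_pow (by norm_num)]
    _ ≤ 2 * degBound k α * logBound (degBound k α) H.n := by
        rw [mul_comm]
        exact Nat.mul_le_mul_right _ (Nat.mul_le_mul_left _ h.degree_le)

lemma trials_le (h : Admissible k α H) :
    (params k α H).trials ≤ sizeBound (degBound k α) H.n := by
  have h1 : (params k α H).trials ≤ 2 * logBound (degBound k α) H.n := by
    change Nat.clog 2 (H.m ^ 2) ≤ _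
    refine Nat.clog_le_of_le_pow ?_
    rw [mul_comm, pow_mul]
    exact Nat.pow_le_pow_left h.m_le_two_pow _
  rw [sizeBound]
  have h2 := Nat.mul_le_mul_right (2 * logBound (degBound k α) H.n) h.one_le_degBound
  rw [one_mul] at h2
  linarith

/-- The bounds for the memory. -/
noncomputable def sizes (k : ℕ) (α : ℝ) (H : Hypergraph) : Sizes :=
  ⟨H.n, H.m, degBound k α, lengthConst k (degBound k α) * sizeBound (degBound k α) H.n ^ 2⟩

lemma run_time_space (h : Admissible k α H) (qs : List (Fin H.n)) {rs : List (Result Bool)}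
    (hrs : rs ∈ ((baseAlgorithm k α).run H qs).support) {r : Result Bool} (hr : r ∈ rs) :
    r.time ≤ timeConst k (degBound k α) * sizeBound (degBound k α) H.n ^ 2 + 1 ∧
      r.space ≤ (sizes k α H).space := by
  rcases qs with _ | ⟨v, vs⟩
  · rw [Procedure.run, runQueries, PMF.mem_support_pure_iff] at hrs
    simp [hrs] at hr
  · obtain ⟨e, -⟩ := h.2.1 v
    have hfits : (sizes k α H).Fits H := ⟨rfl, rfl, v.pos, e.pos, h.degree_le⟩
    obtain ⟨h1, h2, h3⟩ := lt_lengthConst h.compBound_le h.degree_le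
    refine runQueries_time_space hfits (fun w hw => ?_) (v :: vs) Mem.empty ⟨by simp [Mem.empty],
      fun c i => ?_⟩ rs hrs r hr
    · exact (within_query (p := params k α H) h1 h2 h3 hw).le
        (queryTime_le h.compBound_le h.trials_le h.degree_le)
    · have : 0 < H.m := e.pos
      cases c <;> simp [Sizes.Val, Mem.empty, sizes, this]

lemma space_le (h : Admissible k α H) : (sizes k α H).space ≤
    6 * (1 + degBound k α) * H.n +
      6 * lengthConst k (degBound k α) * sizeBound (degBound k α) H.n ^ 3 := by
  set D := degBound k α
  set b := sizeBound D H.n with hb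
  have h1 : 1 + Nat.size H.m ≤ b := by
    have h2 : Nat.size H.m ≤ logBound D H.n + 1 := by
      rw [Nat.size_le, pow_succ]
      have : H.m ≤ 2 ^ logBound D H.n := h.m_le_two_pow
      have := Nat.two_pow_pos (logBound D H.n)
      omega
    have h3 := Nat.mul_le_mul_right (2 * logBound D H.n) h.one_le_degBound
    rw [one_mul] at h3
    rw [hb, sizeBound]
    nlinarith
  have h4 := h.m_le
  calc (sizes k α H).space
      = 6 * H.n + 6 * H.m + 6 * (lengthConst k D * b ^ 2 * (1 + Nat.size H.m)) := rfl
    _ ≤ 6 * H.n + 6 * (H.n * D) + 6 * (lengthConst k D * b ^ 2 * b) := by gcongr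
    _ = _ := by ring

/-- The bound for the probability of a failure. The trivial bound is used for `n ≤ k`, where there may
be a single edge only. -/
noncomputable def failBound (k n : ℕ) : ℝ := if n ≤ k then 1 else (k + k ^ 2) / n

/-- For `u = ⌊2 log₂ m⌋` both summands of the bound for the failure probability are at most
`max m n / m ^ 2`, and `n ≤ k m` as there are no isolated vertices. -/
lemma run_failure_le (h : Admissible k α H) (hα : α ≤ 1 / 4) (qs : List (Fin H.n)) :
    ((baseAlgorithm k α).run H qs).toOuterMeasure {rs | ¬ Consistent H qs rs} ≤
      ENNReal.ofReal (failBound k H.n) := by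
  classical
  rw [failBound]
  split_ifs with hn
  · rw [toOuterMeasure_eq_expect, ENNReal.ofReal_one]
    calc _ ≤ expect ((baseAlgorithm k α).run H qs) fun _ => 1 :=
          expect_mono fun rs _ => by split_ifs <;> simp
      _ = 1 := by simp [expect, PMF.tsum_coe]
  · have hnm := h.n_le
    have hm : 2 ≤ H.m := by
      by_contra hc
      have : H.m ≤ 1 := by omega
      have := Nat.mul_le_mul_left k this
      omega
    have hn0 : (0 : ℝ) < H.n := by
      have : 0 < H.n := by omega
      exact_mod_cast this
    have hm0 : (0 : ℝ) < H.m := by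
      have : 0 < H.m := by omega
      exact_mod_cast this
    set u := Nat.log 2 (H.m ^ 2)
    have hu1 : 2 ≤ u + 1 := by
      have : 0 < u := Nat.log_pos (by norm_num) (by nlinarith)
      omega
    have hpow : H.m ^ 2 < 2 ^ (u + 1) := Nat.lt_pow_succ_log_self (by norm_num) _
    have htr : H.m ^ 2 ≤ 2 ^ (params k α H).trials := Nat.le_pow_clog (by norm_num) _
    refine (toOuterMeasure_not_consistent_le (h.suits hα (by omega)) qs).trans ?_
    have h1 := (treePot_initial_lt (r := (params k α H).threshold) (by omega : 1 ≤ H.m) hu1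
      (h.sixteen_mul_lt hα)).le
    have h2 : (H.n : ℝ≥0∞) * (1 / 2) ^ (params k α H).trials =
        ENNReal.ofReal (H.n * (1 / 2) ^ (params k α H).trials) := by
      rw [ENNReal.ofReal_mul (by positivity), ENNReal.ofReal_natCast,
        ENNReal.ofReal_pow (by norm_num), ENNReal.ofReal_div_of_pos (by norm_num)]
      simp
    rw [h2]
    refine (add_le_add_left h1 _).trans ?_
    rw [← ENNReal.ofReal_add (by positivity) (by positivity)]
    refine ENNReal.ofReal_le_ofReal ?_
    have hnm' : (H.n : ℝ) ≤ k * H.m := by exact_mod_cast hnm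
    have h3 : (1 / 2 : ℝ) ^ (u + 1) ≤ 1 / H.m ^ 2 := by
      rw [one_div_pow]
      exact one_div_le_one_div_of_le (by positivity) (by exact_mod_cast hpow.le)
    have h4 : (1 / 2 : ℝ) ^ (params k α H).trials ≤ 1 / H.m ^ 2 := by
      rw [one_div_pow]
      exact one_div_le_one_div_of_le (by positivity) (by exact_mod_cast htr)
    calc (H.m : ℝ) * (1 / 2) ^ (u + 1) + H.n * (1 / 2) ^ (params k α H).trials
        ≤ H.m * (1 / H.m ^ 2) + H.n * (1 / H.m ^ 2) := by gcongr
      _ = (H.m * H.n + H.n * H.n) / H.m ^ 2 / H.n := by field_simp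
      _ ≤ (k + k ^ 2) / H.n := by
          refine div_le_div_of_nonneg_right ?_ hn0.le
          rw [div_le_iff₀ (by positivity)]
          nlinarith [mul_le_mul_of_nonneg_left hnm' hm0.le, mul_le_mul hnm' hnm' hn0.le
            (by positivity : (0 : ℝ) ≤ k * H.m)]

end Admissible

/-! ### Asymptotics -/

open Admissible

lemma const_isBigO_log (c : ℝ) : (fun _ : ℕ => c) =O[atTop] fun n : ℕ => Real.log n :=
  (Real.isLittleO_const_log_atTop.comp_tendsto tendsto_natCast_atTop_atTop).isBigO

lemma sizeBound_isBigO (D : ℕ) :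
    (fun n : ℕ => (sizeBound D n : ℝ)) =O[atTop] fun n : ℕ => Real.log n := by
  have h1 : (fun n : ℕ => (Nat.log 2 n : ℝ)) =O[atTop] fun n : ℕ => Real.log n := by
    refine IsBigO.of_bound (1 / Real.log 2) (Eventually.of_forall fun n => ?_)
    have h2 := Real.natLog_le_logb n 2
    have h4 : 0 ≤ Real.log n := Real.log_natCast_nonneg n
    rw [Real.norm_of_nonneg (Nat.cast_nonneg _), Real.norm_of_nonneg h4]
    refine h2.trans (le_of_eq ?_)
    rw [Real.logb, Nat.cast_ofNat]
    ring
  have h5 : (fun n : ℕ => (sizeBound D n : ℝ)) =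
      fun n : ℕ => 2 * (D : ℝ) * ((Nat.log 2 n : ℝ) + (1 + D)) + 2 := by
    funext n
    rw [sizeBound, logBound]
    push_cast
    ring
  rw [h5]
  exact ((h1.add (const_isBigO_log _)).const_mul_left _).add (const_isBigO_log _)

lemma time_isBigO (K D : ℕ) : (fun n : ℕ => ((K * sizeBound D n ^ 2 + 1 : ℕ) : ℝ)) =O[atTop]
    fun n : ℕ => Real.log n ^ 2 := by
  push_cast
  refine (((sizeBound_isBigO D).pow 2).const_mul_left _).add ?_
  simpa using (const_isBigO_log 1).pow 2

lemma space_isBigO (K K' D : ℕ) :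
    (fun n : ℕ => ((K * n + K' * sizeBound D n ^ 3 : ℕ) : ℝ)) =O[atTop] fun n : ℕ => (n : ℝ) := by
  push_cast
  refine ((isBigO_refl _ _).const_mul_left _).add (IsBigO.const_mul_left ?_ _)
  refine ((sizeBound_isBigO D).pow 3).trans ?_
  exact ((Real.isLittleO_pow_log_id_atTop (n := 3)).comp_tendsto
    tendsto_natCast_atTop_atTop).isBigO

lemma failBound_isBigO (k : ℕ) : failBound k =O[atTop] fun n : ℕ => 1 / (n : ℝ) := by
  have h : failBound k =ᶠ[atTop] fun n : ℕ => ((k : ℝ) + k ^ 2) * (1 / (n : ℝ)) := by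
    filter_upwards [eventually_gt_atTop k] with n hn
    rw [failBound, if_neg (by omega)]
    ring
  exact h.trans_isBigO ((isBigO_refl _ _).const_mul_left _)

end HypergraphLCA

open HypergraphLCA in
theorem mainTheorem3 :
    (∀ (k : ℕ) (α : ℝ), α ≤ 1 / 4 →
      ∃ t s δ : ℕ → ℝ,
        t =O[atTop] (fun n : ℕ => Real.log n ^ 2) ∧
        s =O[atTop] (fun n : ℕ => (n : ℝ)) ∧
        δ =O[atTop] (fun n : ℕ => 1 / (n : ℝ)) ∧
        IsLCA (Admissible k α) (baseAlgorithm k α) t s δ) ∧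
    (∀ (H : Hypergraph) (k a : ℕ) (α c : ℝ) (σ : H.OnlineOrder),
      H.Uniform k → 1 ≤ H.m → a ≤ k → α * k = a → 0 < c →
      8 * (H.maxEdgeDegree : ℝ) ^ 3 / (2 : ℝ) ^ ((1 - α) * k) < 1 / 2 →
      (H.shattering (k - a) σ).toOuterMeasure
          {st | H.HasSatisfiedWitness (k - a) ⌈(c + 1) * Real.logb 2 H.m⌉₊ st} <
        ENNReal.ofReal (1 / (H.m : ℝ) ^ c)) := by
  refine ⟨fun k α hα => ?_, fun H k a α c σ _ hm hak hαk hc h => ?_⟩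
  · set D := Admissible.degBound k α
    refine ⟨_, _, _, time_isBigO (Base.timeConst k D) D,
      space_isBigO (6 * (1 + D)) (6 * Base.lengthConst k D) D, failBound_isBigO k, ?_⟩
    refine ⟨fun H hH qs rs hrs r hr => ?_, fun H hH qs rs hrs r hr => ?_, fun H hH qs => ?_⟩
    · exact_mod_cast (hH.run_time_space qs hrs hr).1
    · exact_mod_cast (hH.run_time_space qs hrs hr).2.trans hH.space_le
    · exact hH.run_failure_le hα qs
  · refine H.shattering_hasSatisfiedWitness_lt _ c σ hm hc ?_
    have h1 : (1 - α) * k = ((k - a : ℕ) : ℝ) := by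
      rw [Nat.cast_sub hak, sub_mul, one_mul, hαk]
    rw [h1, Real.rpow_natCast, div_lt_iff₀ (by positivity)] at h
    linarith
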